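/- **Setting and definitions.** Manifolds are smooth, finite-dimensional, Hausdorff and without boundary. Let $\pi:P\to M$ be a smooth principal bundle over a $\sigma$-compact manifold $M$ (for example a compact one) whose structure group is a Lie group $G$ with Lie algebra $\mathfrak g$, with right translations $R_a$, $a\in G$. Write $V_uP=\ker T_u\pi$. A *smooth diffusion operator* $L$ on a manifold $N$ is a linear second order differential operator on $C^2(N)$ which annihilates constants, sends $C^\infty$ functions to $C^\infty$ functions, and is semi-elliptic, that is, $df(\sigma^L(df))\ge 0$ for all $f\in C^2(N)$; here the *symbol* $\sigma^L:T^*N\to TN$ is determined by $df(\sigma^L(dg))=\tfrac12L(fg)-\tfrac12(Lf)g-\tfrac12f(Lg)$. Let $\delta^L$ be the unique linear operator from smooth one-forms to functions with $\delta^L(f\phi)=df(\sigma^L(\phi))+f\,\delta^L(\phi)$ and $\delta^L(df)=Lf$ for smooth $f$ and $\phi$. For a family $S=(S_x)_{x\in N}$ of subspaces $S_x\subset T_xN$, $L$ is *along* $S$ if $\delta^L\phi=0$ for every smooth one-form $\phi$ that vanishes on $S$. $L$ is *strongly cohesive* if $\sigma^L$ has constant rank and $L$ is along $\operatorname{Im}\sigma^L$.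 Let $\mathcal B$ be a smooth diffusion operator on $P$ which is *equivariant*: $(\mathcal Bf)\circ R_a=\mathcal B(f\circ R_a)$ for all $f\in C^2(P)$, $a\in G$. Its *induced operator* $\mathcal A$ on $M$ is given by $(\mathcal Af)(\pi(u))=\mathcal B(f\circ\pi)(u)$. Put $E=\operatorname{Im}\sigma^{\mathcal A}\subset TM$. A *semi-connection* on $P$ over $E$ is a smooth subbundle $H$ of $TP$ such that $T_u\pi$ maps $H_u$ bijectively onto $E_{\pi(u)}$ and $TR_a(H_u)=H_{u\cdot a}$ for all $u\in P$, $a\in G$. A smooth diffusion operator on $P$ is *horizontal* (for $H$) if it is along $H$, and *vertical* if it is along $VP$. For $A\in\mathfrak g$ let $A^*(u)=\frac{d}{dt}\big|_{t=0}u\cdot\exp(tA)$ be its fundamental vector field. A *connection form* is a smooth $\mathfrak g$-valued one-form $\tilde\omega$ on $P$ with $\tilde\omega(A^*)=A$ for $A\in\mathfrak g$ and $R_a^*\tilde\omega=\operatorname{Ad}(a^{-1})\tilde\omega$ for $a\in G$. **Theorem 2.4.** Suppose that $\mathcal A$ is strongly cohesive. Then there is a unique semi-connection $H$ on $P$ over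 $E$ for which there are smooth diffusion operators $\mathcal A^H$ and $\mathcal B^V$ on $P$, with $\mathcal A^H$ horizontal and $\mathcal B^V$ vertical, such that $$\mathcal B=\mathcal A^H+\mathcal B^V .$$ Moreover, for this semi-connection, $\mathcal A^H$ can be taken to be a lift of $\mathcal A$, that is, $\mathcal A^H(f\circ\pi)=(\mathcal Af)\circ\pi$ for all $f\in C^2(M)$, and, for any basis $(A_i)$ of $\mathfrak g$, $\mathcal B^V$ then has the expression $$\mathcal B^V=\sum_{i,j}\alpha^{ij}\,\mathcal L_{A_i^*}\mathcal L_{A_j^*}+\sum_k\beta^k\,\mathcal L_{A_k^*}$$ with smooth functions $\alpha^{ij},\beta^k$ on $P$. There exist connection forms on $P$ that vanish on $H$, and for every such form $\tilde\omega=\sum_k\tilde\omega^kA_k$ $$\alpha^{k\ell}=\tilde\omega^k\big(\sigma^{\mathcal B}(\tilde\omega^\ell)\big),\qquad \beta^\ell=\delta^{\mathcal B}(\tilde\omega^\ell).$$ -/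

import Mathlib

open scoped Manifold ContDiff Topology RightActions

namespace EquivariantDiffusion

noncomputable section

section Operators

variable {E : Type*} [NormedAddCommGroup E] [NormedSpace ℝ E]
  {N : Type*} [TopologicalSpace N] [ChartedSpace E N]

variable (E N) in
/-- The algebra of real-valued `C²` functions on the manifold `N` (without boundary, modelled on
`E`). -/
abbrev C2 := C^2⟮𝓘(ℝ, E), N; 𝓘(ℝ, ℝ), ℝ⟯

theorem two_le_infty : (2 : WithTop ℕ∞) ≤ ∞ := WithTop.coe_le_coe.2 (le_top : (2 : ℕ∞) ≤ ⊤)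

/-- A function read in the preferred chart at `x`. -/
def inChart (f : N → ℝ) (x : N) : E → ℝ := f ∘ (extChartAt 𝓘(ℝ, E) x).symm

/-- `½ L(fg) - ½ (L f) g - ½ f (L g)`, the expression that determines the symbol of `L`. -/
def squareField (L : C2 E N →ₗ[ℝ] (N → ℝ)) (f g : C2 E N) (x : N) : ℝ :=
  1 / 2 * L (f * g) x - 1 / 2 * L f x * g x - 1 / 2 * f x * L g x

variable (E N) in
/-- A smooth diffusion operator on `N`: a linear second order differential operator on `C²`
functions which is semi-elliptic, annihilates constants, and sends smooth functions to smooth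
functions. That it is a second order differential operator means that the value at `x` is a linear
function of the derivatives of order at most two at `x`, computed in a chart around `x`; the second
derivative is `D²f : E → E → ℝ`, and `a`, `b`, `c` are the coefficients at `x`. -/
structure DiffusionOperator where
  /-- the operator on functions -/
  toLin : C2 E N →ₗ[ℝ] (N → ℝ)
  secondOrder : ∀ x : N, ∃ (a : (E →L[ℝ] E →L[ℝ] ℝ) →ₗ[ℝ] ℝ) (b : (E →L[ℝ] ℝ) →ₗ[ℝ] ℝ) (c : ℝ),
    ∀ f : C2 E N, toLin f x =
      a (fderiv ℝ (fderiv ℝ (inChart f x)) (extChartAt 𝓘(ℝ, E) x x))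
        + b (fderiv ℝ (inChart f x) (extChartAt 𝓘(ℝ, E) x x)) + c * f x
  semiElliptic : ∀ (f : C2 E N) (x : N), 0 ≤ squareField toLin f f x
  map_const : ∀ (r : ℝ) (x : N), toLin (ContMDiffMap.const r) x = 0
  smooth : ∀ f : C2 E N, ContMDiff 𝓘(ℝ, E) 𝓘(ℝ, ℝ) ∞ f → ContMDiff 𝓘(ℝ, E) 𝓘(ℝ, ℝ) ∞ (toLin f)

instance : CoeFun (DiffusionOperator E N) (fun _ => C2 E N → N → ℝ) := ⟨fun B => B.toLin⟩

variable (E) in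
/-- A smooth one-form on `N`: a field of covectors such that the associated function on the tangent
bundle is smooth. -/
structure OneForm (N : Type*) [TopologicalSpace N] [ChartedSpace E N] [IsManifold 𝓘(ℝ, E) ∞ N] where
  toFun : ∀ x : N, TangentSpace 𝓘(ℝ, E) x →L[ℝ] ℝ
  smooth : ContMDiff 𝓘(ℝ, E).tangent 𝓘(ℝ, ℝ) ∞
    (fun v : TangentBundle 𝓘(ℝ, E) N => toFun v.1 v.2)

namespace DiffusionOperator

variable (B : DiffusionOperator E N)

theorem exists_coeff (x : N) :
    ∃ (a : (E →L[ℝ] E →L[ℝ] ℝ) →ₗ[ℝ] ℝ) (b : (E →L[ℝ] ℝ) →ₗ[ℝ] ℝ), ∀ f : C2 E N, B f x =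
      a (fderiv ℝ (fderiv ℝ (inChart f x)) (extChartAt 𝓘(ℝ, E) x x))
        + b (fderiv ℝ (inChart f x) (extChartAt 𝓘(ℝ, E) x x)) := by
  obtain ⟨a, b, c, h⟩ := B.secondOrder x
  have h0 : inChart (E := E) (ContMDiffMap.const 1 : C2 E N) x = fun _ => (1 : ℝ) := by
    funext y; rfl
  have h1 := h (ContMDiffMap.const 1)
  rw [B.map_const, h0] at h1
  have hc : c = 0 := by
    have h2 : (ContMDiffMap.const 1 : C2 E N) x = 1 := rfl
    simpa [h2] using h1.symm
  exact ⟨a, b, fun f => by rw [h f, hc]; ring⟩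

/-- The second order coefficients of `B` at `x`, in the preferred chart at `x`. -/
def coeffTwo (x : N) : (E →L[ℝ] E →L[ℝ] ℝ) →ₗ[ℝ] ℝ := (B.exists_coeff x).choose

/-- The first order coefficients of `B` at `x`, in the preferred chart at `x`. -/
def coeffOne (x : N) : (E →L[ℝ] ℝ) →ₗ[ℝ] ℝ := (B.exists_coeff x).choose_spec.choose

theorem apply_eq (f : C2 E N) (x : N) : B f x =
    B.coeffTwo x (fderiv ℝ (fderiv ℝ (inChart f x)) (extChartAt 𝓘(ℝ, E) x x))
      + B.coeffOne x (fderiv ℝ (inChart f x) (extChartAt 𝓘(ℝ, E) x x)) :=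
  (B.exists_coeff x).choose_spec.choose_spec f

/-- The symmetric part of a bilinear form. -/
def symPart (S : E →L[ℝ] E →L[ℝ] ℝ) : E →L[ℝ] E →L[ℝ] ℝ := (1 / 2 : ℝ) • (S + S.flip)

/-- The symbol of `B` at `x` as a bilinear form on the cotangent space. -/
def symbolForm (x : N) : (E →L[ℝ] ℝ) →ₗ[ℝ] (E →L[ℝ] ℝ) →ₗ[ℝ] ℝ :=
  LinearMap.mk₂ ℝ (fun ξ η => B.coeffTwo x (symPart (ξ.smulRight η)))
    (fun ξ ξ' η => by
      rw [← map_add]; congr 1; ext v w; simp [symPart]; ring)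
    (fun r ξ η => by
      rw [← map_smul]; congr 1; ext v w; simp [symPart]; ring)
    (fun ξ η η' => by
      rw [← map_add]; congr 1; ext v w; simp [symPart]; ring)
    (fun r ξ η => by
      rw [← map_smul]; congr 1; ext v w; simp [symPart]; ring)

theorem mvfderiv_eq_inChart {f : N → ℝ} {x : N} (hf : MDifferentiableAt 𝓘(ℝ, E) 𝓘(ℝ, ℝ) f x) :
    mvfderiv 𝓘(ℝ, E) f x = fderiv ℝ (inChart f x) (extChartAt 𝓘(ℝ, E) x x) := by
  ext v
  simp only [mvfderiv, mfderiv, hf]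
  simp only [writtenInExtChartAt, extChartAt_model_space_eq_id, modelWithCornersSelf_coe, Set.range_id, fderivWithin_univ]
  rfl

theorem contDiffAt_inChart [IsManifold 𝓘(ℝ, E) ∞ N] (f : C2 E N) (x : N) :
    ContDiffAt ℝ 2 (inChart f x) (extChartAt 𝓘(ℝ, E) x x) := by
  rw [← contMDiffAt_iff_contDiffAt]
  have h2 : IsManifold 𝓘(ℝ, E) 2 N := inferInstance
  refine ContMDiffAt.comp _ f.contMDiff.contMDiffAt ?_
  have := contMDiffWithinAt_extChartAt_symm_range (I := 𝓘(ℝ, E)) (n := 2) x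
    (mem_extChartAt_target x)
  rw [← contMDiffWithinAt_univ]
  simpa using this

theorem fderiv_fderiv_mul {F G : E → ℝ} {y : E} (hF : ContDiffAt ℝ 2 F y)
    (hG : ContDiffAt ℝ 2 G y) :
    fderiv ℝ (fderiv ℝ (F * G)) y = F y • fderiv ℝ (fderiv ℝ G) y
      + G y • fderiv ℝ (fderiv ℝ F) y
      + (2 : ℝ) • symPart ((fderiv ℝ F y).smulRight (fderiv ℝ G y)) := by
  have e : fderiv ℝ (F * G) =ᶠ[𝓝 y] fun z => F z • fderiv ℝ G z + G z • fderiv ℝ F z := by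
    filter_upwards [hF.eventually (by simp), hG.eventually (by simp)] with z h1 h2
    exact fderiv_mul (h1.differentiableAt (by simp)) (h2.differentiableAt (by simp))
  rw [e.fderiv_eq]
  have dF := hF.differentiableAt (by simp)
  have dG := hG.differentiableAt (by simp)
  have dF' : DifferentiableAt ℝ (fderiv ℝ F) y :=
    (hF.fderiv_right (m := 1) (by norm_num)).differentiableAt (by simp)
  have dG' : DifferentiableAt ℝ (fderiv ℝ G) y :=
    (hG.fderiv_right (m := 1) (by norm_num)).differentiableAt (by simp)
  rw [fderiv_fun_add (dF.fun_smul dG') (dG.fun_smul dF'), fderiv_fun_smul dF dG',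
    fderiv_fun_smul dG dF']
  ext v w
  simp [symPart]
  ring

theorem fderiv_fderiv_comp {E' : Type*} [NormedAddCommGroup E'] [NormedSpace ℝ E']
    {F : E' → ℝ} {Φ : E → E'} {y : E} (hF : ContDiffAt ℝ 2 F (Φ y)) (hΦ : ContDiffAt ℝ 2 Φ y) :
    fderiv ℝ (fderiv ℝ (F ∘ Φ)) y =
      (fderiv ℝ (fderiv ℝ F) (Φ y)).bilinearComp (fderiv ℝ Φ y) (fderiv ℝ Φ y)
      + (ContinuousLinearMap.compL ℝ E E' ℝ (fderiv ℝ F (Φ y))).comp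
        (fderiv ℝ (fderiv ℝ Φ) y) := by
  have e : fderiv ℝ (F ∘ Φ) =ᶠ[𝓝 y] fun z => (fderiv ℝ F (Φ z)).comp (fderiv ℝ Φ z) := by
    filter_upwards [hΦ.continuousAt.eventually (hF.eventually (by simp)),
      hΦ.eventually (by simp)] with z h1 h2
    exact fderiv_comp z (h1.differentiableAt (by simp)) (h2.differentiableAt (by simp))
  rw [e.fderiv_eq]
  have dΦ : DifferentiableAt ℝ Φ y := hΦ.differentiableAt (by simp)
  have dF' : DifferentiableAt ℝ (fderiv ℝ F) (Φ y) :=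
    (hF.fderiv_right (m := 1) (by norm_num)).differentiableAt (by simp)
  have dΦ' : DifferentiableAt ℝ (fderiv ℝ Φ) y :=
    (hΦ.fderiv_right (m := 1) (by norm_num)).differentiableAt (by simp)
  have h := (dF'.hasFDerivAt.comp y dΦ.hasFDerivAt).clm_comp dΦ'.hasFDerivAt
  have h' := h.fderiv
  simp only [Function.comp_def] at h'
  rw [h']
  ext v w
  simp
  ring

theorem symbolForm_apply (x : N) (ξ η : E →L[ℝ] ℝ) :
    B.symbolForm x ξ η = B.coeffTwo x (symPart (η.smulRight ξ)) := by
  simp only [symbolForm, LinearMap.mk₂_apply]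
  congr 1
  ext v w
  simp [symPart]
  ring

/-- A one-form read in the preferred chart at `x`, as a function with values in the dual of `E`. -/
def OneForm.inChart [IsManifold 𝓘(ℝ, E) ∞ N] (φ : OneForm E N) (x : N) : E → (E →L[ℝ] ℝ) :=
  fun y => (φ.toFun ((extChartAt 𝓘(ℝ, E) x).symm y)).comp
    (mfderiv 𝓘(ℝ, E) 𝓘(ℝ, E) (extChartAt 𝓘(ℝ, E) x).symm y)

/-- The first order operator `δ^B` from one-forms to functions associated with `B`. It is the unique
additive operator with `δ^B (f φ) = df (σ^B φ) + f δ^B φ` (see `delta_smul`) and `δ^B (df) = B f`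
(see `delta_d`). In a chart, if `B f = a (D²f) + b (Df)`, then `δ^B φ = a (sym Dφ) + b φ`. -/
def delta [IsManifold 𝓘(ℝ, E) ∞ N] (φ : OneForm E N) (x : N) : ℝ :=
  B.coeffTwo x (symPart (fderiv ℝ (OneForm.inChart φ x) (extChartAt 𝓘(ℝ, E) x x)))
    + B.coeffOne x (φ.toFun x)

theorem mfderiv_chart_symm [IsManifold 𝓘(ℝ, E) ∞ N] (x : N) (v : E) :
    mfderiv 𝓘(ℝ, E) 𝓘(ℝ, E) (extChartAt 𝓘(ℝ, E) x).symm (extChartAt 𝓘(ℝ, E) x x) v = v := by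
  have hd : MDifferentiableAt 𝓘(ℝ, E) 𝓘(ℝ, E) (extChartAt 𝓘(ℝ, E) x).symm
      (extChartAt 𝓘(ℝ, E) x x) := by
    have := (contMDiffWithinAt_extChartAt_symm_range (I := 𝓘(ℝ, E)) (n := 1) x
      (mem_extChartAt_target x)).mdifferentiableWithinAt (by simp)
    rw [← mdifferentiableWithinAt_univ]
    simpa using this
  have e : writtenInExtChartAt 𝓘(ℝ, E) 𝓘(ℝ, E) (extChartAt 𝓘(ℝ, E) x x)
      (extChartAt 𝓘(ℝ, E) x).symm =ᶠ[𝓝 (extChartAt 𝓘(ℝ, E) x x)] id := by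
    filter_upwards [extChartAt_target_mem_nhds (I := 𝓘(ℝ, E)) x] with y hy
    simp only [writtenInExtChartAt, extChartAt_model_space_eq_id, Function.comp,
      PartialEquiv.refl_symm, PartialEquiv.refl_coe, id, extChartAt_to_inv]
    exact (extChartAt 𝓘(ℝ, E) x).right_inv hy
  simp only [mfderiv, hd]
  simp only [extChartAt_model_space_eq_id, PartialEquiv.refl_coe,
    modelWithCornersSelf_coe, Set.range_id, fderivWithin_univ, id]
  have := congrArg (fun L : E →L[ℝ] E => L v) e.fderiv_eq
  simp only [fderiv_id, ContinuousLinearMap.id_apply] at this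
  exact this

theorem OneForm.inChart_self [IsManifold 𝓘(ℝ, E) ∞ N] (φ : OneForm E N) (x : N) :
    OneForm.inChart φ x (extChartAt 𝓘(ℝ, E) x x) = φ.toFun x := by
  ext v
  have h := mfderiv_chart_symm x v
  have h2 : ∀ (z : N), z = x → φ.toFun z (v : E) = φ.toFun x (v : E) := by
    rintro z rfl; rfl
  refine Eq.trans ?_ (h2 _ (extChartAt_to_inv (I := 𝓘(ℝ, E)) x))
  exact congrArg (φ.toFun ((extChartAt 𝓘(ℝ, E) x).symm (extChartAt 𝓘(ℝ, E) x x))) h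

/-- Second characteristic property of `delta`. -/
theorem delta_d [IsManifold 𝓘(ℝ, E) ∞ N] (f : C2 E N) (φ : OneForm E N)
    (h : ∀ x, φ.toFun x = mvfderiv 𝓘(ℝ, E) f x) (x : N) : B.delta φ x = B f x := by
  have df := mvfderiv_eq_inChart (f.contMDiff.mdifferentiableAt (x := x) (by simp))
  have hf := contDiffAt_inChart f x
  have e : OneForm.inChart φ x =ᶠ[𝓝 (extChartAt 𝓘(ℝ, E) x x)] fderiv ℝ (inChart f x) := by
    filter_upwards [extChartAt_target_mem_nhds (I := 𝓘(ℝ, E)) x] with y hy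
    have hd : MDifferentiableAt 𝓘(ℝ, E) 𝓘(ℝ, E) (extChartAt 𝓘(ℝ, E) x).symm y :=
      ((contMDiffOn_extChartAt_symm (I := 𝓘(ℝ, E)) (n := 1) x).contMDiffAt
        ((isOpen_extChartAt_target x).mem_nhds hy)).mdifferentiableAt (by simp)
    have hfd : MDifferentiableAt 𝓘(ℝ, E) 𝓘(ℝ, ℝ) f ((extChartAt 𝓘(ℝ, E) x).symm y) :=
      f.contMDiff.mdifferentiableAt (by simp)
    have := mfderiv_comp y hfd hd
    rw [OneForm.inChart, h]
    have h2 : mfderiv 𝓘(ℝ, E) 𝓘(ℝ, ℝ) (f ∘ (extChartAt 𝓘(ℝ, E) x).symm) y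
      = fderiv ℝ (inChart f x) y := mfderiv_eq_fderiv
    rw [← h2, this]
    rfl
  rw [delta, B.apply_eq, e.fderiv_eq, h, df]
  congr 2
  have hs : IsSymmSndFDerivAt ℝ (inChart f x) (extChartAt 𝓘(ℝ, E) x x) :=
    hf.isSymmSndFDerivAt (by simp)
  ext v w
  have := hs v w
  simp only [symPart, smul_apply, add_apply,
    ContinuousLinearMap.flip_apply, smul_eq_mul, this]
  ring

variable [FiniteDimensional ℝ E]

/-- The symbol `σ^B_x : T_x^*N → T_xN` of `B`. It is determined by
`df (σ^B (dg)) = ½ B(fg) - ½ (B f) g - ½ f (B g)`, see `symbol_spec`. -/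
def symbol (x : N) : (TangentSpace 𝓘(ℝ, E) x →L[ℝ] ℝ) →ₗ[ℝ] TangentSpace 𝓘(ℝ, E) x :=
  (Module.evalEquiv ℝ E).symm.toLinearMap ∘ₗ
    (LinearMap.lcomp ℝ ℝ
      (LinearMap.toContinuousLinearMap : (E →ₗ[ℝ] ℝ) ≃ₗ[ℝ] (E →L[ℝ] ℝ)).toLinearMap) ∘ₗ
    B.symbolForm x

/-- The symbol as a bundle map corresponds to the symbol as a bilinear form. -/
theorem apply_symbol (x : N) (ξ η : TangentSpace 𝓘(ℝ, E) x →L[ℝ] ℝ) :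
    η (B.symbol x ξ) = B.symbolForm x ξ η := by
  let η' : E →L[ℝ] ℝ := η
  exact Module.apply_evalEquiv_symm_apply (R := ℝ) (M := E) (η' : E →ₗ[ℝ] ℝ)
    (LinearMap.lcomp ℝ ℝ
      (LinearMap.toContinuousLinearMap : (E →ₗ[ℝ] ℝ) ≃ₗ[ℝ] (E →L[ℝ] ℝ)).toLinearMap
      (B.symbolForm x ξ))

/-- The property which determines the symbol. -/
theorem symbol_spec [IsManifold 𝓘(ℝ, E) ∞ N] (f g : C2 E N) (x : N) :
    mvfderiv 𝓘(ℝ, E) f x (B.symbol x (mvfderiv 𝓘(ℝ, E) g x)) = squareField B.toLin f g x := by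
  have df := mvfderiv_eq_inChart (f.contMDiff.mdifferentiableAt (x := x) (by simp))
  have dg := mvfderiv_eq_inChart (g.contMDiff.mdifferentiableAt (x := x) (by simp))
  rw [apply_symbol, df, dg, squareField, B.apply_eq, B.apply_eq, B.apply_eq]
  have hm : inChart (E := E) (f * g : C2 E N) x = inChart f x * inChart g x := rfl
  have hf := contDiffAt_inChart f x
  have hg := contDiffAt_inChart g x
  rw [hm, fderiv_fderiv_mul hf hg, fderiv_mul (hf.differentiableAt (by simp))
    (hg.differentiableAt (by simp))]
  have e1 : inChart f x (extChartAt 𝓘(ℝ, E) x x) = f x := by simp [inChart]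
  have e2 : inChart g x (extChartAt 𝓘(ℝ, E) x x) = g x := by simp [inChart]
  have e3 : B.symbolForm x (fderiv ℝ (inChart g x) (extChartAt 𝓘(ℝ, E) x x))
      (fderiv ℝ (inChart f x) (extChartAt 𝓘(ℝ, E) x x)) =
      B.coeffTwo x (symPart ((fderiv ℝ (inChart f x) (extChartAt 𝓘(ℝ, E) x x)).smulRight
        (fderiv ℝ (inChart g x) (extChartAt 𝓘(ℝ, E) x x)))) :=
    B.symbolForm_apply x _ _
  rw [e3, e1, e2]
  simp only [map_add, map_smul, smul_eq_mul]
  ring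

theorem OneForm.differentiableAt_inChart [IsManifold 𝓘(ℝ, E) ∞ N] (φ : OneForm E N) (x : N) :
    DifferentiableAt ℝ (OneForm.inChart φ x) (extChartAt 𝓘(ℝ, E) x x) := by
  set c := extChartAt 𝓘(ℝ, E) x with hc
  have ho : IsOpen c.target := isOpen_extChartAt_target x
  suffices h : ContDiffOn ℝ ∞ (OneForm.inChart φ x) c.target from
    (h.contDiffAt (ho.mem_nhds (mem_extChartAt_target x))).differentiableAt (by simp)
  rw [contDiffOn_clm_apply]
  intro v
  have h1 : ContMDiffOn 𝓘(ℝ, E).tangent 𝓘(ℝ, E).tangent ∞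
      (tangentMapWithin 𝓘(ℝ, E) 𝓘(ℝ, E) c.symm c.target) (Bundle.TotalSpace.proj ⁻¹' c.target) :=
    (contMDiffOn_extChartAt_symm (I := 𝓘(ℝ, E)) (n := ∞) x).contMDiffOn_tangentMapWithin
      (by simp) ho.uniqueMDiffOn
  have h2 : ContMDiffOn 𝓘(ℝ, E) 𝓘(ℝ, E).tangent ∞
      (fun y : E => (Bundle.TotalSpace.mk' E y v : TangentBundle 𝓘(ℝ, E) E)) c.target :=
    contMDiffOn_vectorSpace_iff_contDiffOn.2 contDiffOn_const
  have h3 := φ.smooth.comp_contMDiffOn (h1.comp h2 (fun y hy => hy))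
  rw [← contMDiffOn_iff_contDiffOn]
  refine h3.congr fun y hy => ?_
  simp only [OneForm.inChart, Function.comp, tangentMapWithin]
  rw [mfderivWithin_of_isOpen ho hy]
  rfl

/-- `delta` is additive. -/
theorem delta_add [IsManifold 𝓘(ℝ, E) ∞ N] (φ φ' ψ : OneForm E N)
    (h : ∀ x, ψ.toFun x = φ.toFun x + φ'.toFun x) (x : N) :
    B.delta ψ x = B.delta φ x + B.delta φ' x := by
  have e : OneForm.inChart ψ x = fun y => OneForm.inChart φ x y + OneForm.inChart φ' x y := by
    funext y
    simp only [OneForm.inChart, h]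
    rfl
  have e4 : ∀ S T : E →L[ℝ] E →L[ℝ] ℝ, symPart (S + T) = symPart S + symPart T := by
    intro S T
    ext v w
    simp [symPart]
    ring
  have e5 : B.coeffOne x (φ.toFun x + φ'.toFun x)
      = B.coeffOne x (φ.toFun x) + B.coeffOne x (φ'.toFun x) :=
    map_add (B.coeffOne x) _ _
  rw [delta, delta, delta, e, fderiv_fun_add, e4, map_add, h, e5]
  · ring
  · exact OneForm.differentiableAt_inChart φ x
  · exact OneForm.differentiableAt_inChart φ' x

/-- First characteristic property of `delta`. -/
theorem delta_smul [IsManifold 𝓘(ℝ, E) ∞ N] (f : C2 E N) (φ ψ : OneForm E N)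
    (h : ∀ x, ψ.toFun x = f x • φ.toFun x) (x : N) :
    B.delta ψ x = mvfderiv 𝓘(ℝ, E) f x (B.symbol x (φ.toFun x)) + f x * B.delta φ x := by
  have df := mvfderiv_eq_inChart (f.contMDiff.mdifferentiableAt (x := x) (by simp))
  have e : OneForm.inChart ψ x = fun y => inChart f x y • OneForm.inChart φ x y := by
    funext y
    simp only [OneForm.inChart, h]
    rfl
  have e1 : inChart f x (extChartAt 𝓘(ℝ, E) x x) = f x := by simp [inChart]
  have e2 := OneForm.inChart_self φ x
  rw [apply_symbol, df, delta, delta, h, e, fderiv_fun_smul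
    ((contDiffAt_inChart f x).differentiableAt (by simp)) (OneForm.differentiableAt_inChart φ x),
    e1, e2]
  have e3 : B.symbolForm x (φ.toFun x) (fderiv ℝ (inChart f x) (extChartAt 𝓘(ℝ, E) x x)) =
      B.coeffTwo x (symPart ((fderiv ℝ (inChart f x) (extChartAt 𝓘(ℝ, E) x x)).smulRight
        (φ.toFun x : E →L[ℝ] ℝ))) :=
    B.symbolForm_apply x _ _
  have e4 : ∀ (r : ℝ) (S T : E →L[ℝ] E →L[ℝ] ℝ), symPart (r • S + T) = r • symPart S + symPart T := by
    intro r S T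
    ext v w
    simp [symPart]
    ring
  rw [e3, e4, map_add, map_smul, smul_eq_mul]
  have e5 : B.coeffOne x (f x • φ.toFun x) = f x * B.coeffOne x (φ.toFun x) :=
    map_smul (B.coeffOne x) (f x) _
  rw [e5]
  ring

end DiffusionOperator

end Operators

section Subbundles

variable {E : Type*} [NormedAddCommGroup E] [NormedSpace ℝ E]
  {N : Type*} [TopologicalSpace N] [ChartedSpace E N] [IsManifold 𝓘(ℝ, E) ∞ N]

/-- A family of subspaces of the tangent spaces of `N` is a smooth subbundle of `TN` if it is
locally spanned by a smooth frame. -/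
def IsSmoothSubbundle (S : ∀ x : N, Submodule ℝ (TangentSpace 𝓘(ℝ, E) x)) : Prop :=
  ∀ x₀ : N, ∃ U ∈ 𝓝 x₀, ∃ (k : ℕ) (X : Fin k → ∀ x : N, TangentSpace 𝓘(ℝ, E) x),
    (∀ i, ContMDiffOn 𝓘(ℝ, E) 𝓘(ℝ, E).tangent ∞
      (fun x => (⟨x, X i x⟩ : TangentBundle 𝓘(ℝ, E) N)) U) ∧
    ∀ x ∈ U, LinearIndependent ℝ (fun i => X i x) ∧
      Submodule.span ℝ (Set.range fun i => X i x) = S x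

/-- `B` is along the family of subspaces `S` if `δ^B φ = 0` for every one-form `φ` vanishing
on `S`. -/
def DiffusionOperator.IsAlong (B : DiffusionOperator E N)
    (S : ∀ x : N, Submodule ℝ (TangentSpace 𝓘(ℝ, E) x)) : Prop :=
  ∀ φ : OneForm E N, (∀ x, ∀ v ∈ S x, φ.toFun x v = 0) → ∀ x, B.delta φ x = 0

variable [FiniteDimensional ℝ E]

/-- The image of the symbol. -/
def DiffusionOperator.symbolRange (B : DiffusionOperator E N) (x : N) :
    Submodule ℝ (TangentSpace 𝓘(ℝ, E) x) := LinearMap.range (B.symbol x)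

/-- The symbol has constant rank, and the operator is along the image of its symbol. -/
def DiffusionOperator.IsStronglyCohesive (B : DiffusionOperator E N) : Prop :=
  (∃ p : ℕ, ∀ x : N, Module.finrank ℝ (B.symbolRange x) = p) ∧ B.IsAlong B.symbolRange

end Subbundles

section Bundle

variable {EM : Type*} [NormedAddCommGroup EM] [NormedSpace ℝ EM]
  {M : Type*} [TopologicalSpace M] [ChartedSpace EM M]
  {EG : Type*} [NormedAddCommGroup EG] [NormedSpace ℝ EG]
  {G : Type*} [TopologicalSpace G] [ChartedSpace EG G] [Group G]
  {EP : Type*} [NormedAddCommGroup EP] [NormedSpace ℝ EP]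
  {P : Type*} [TopologicalSpace P] [ChartedSpace EP P] [MulAction Gᵐᵒᵖ P]

variable (EM EG G EP) in
/-- `π : P → M` is a smooth principal bundle with structure group the Lie group `G`: the right
action of `G` on `P` is smooth, its orbits are the fibres of the smooth surjection `π`, and locally
there are `G`-equivariant diffeomorphisms `π ⁻¹ U ≃ U × G` over `U`. -/
structure IsPrincipalBundle (π : P → M) : Prop where
  smooth_proj : ContMDiff 𝓘(ℝ, EP) 𝓘(ℝ, EM) ∞ π
  smooth_action : ContMDiff (𝓘(ℝ, EP).prod 𝓘(ℝ, EG)) 𝓘(ℝ, EP) ∞ (fun q : P × G => q.1 <• q.2)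
  surjective_proj : Function.Surjective π
  orbit_iff : ∀ u v : P, π u = π v ↔ ∃ a : G, u <• a = v
  locallyTrivial : ∀ x : M, ∃ (U : Set M) (τ : OpenPartialHomeomorph P (M × G)),
    IsOpen U ∧ x ∈ U ∧ τ.source = π ⁻¹' U ∧ τ.target = U ×ˢ Set.univ ∧
    ContMDiffOn 𝓘(ℝ, EP) (𝓘(ℝ, EM).prod 𝓘(ℝ, EG)) ∞ τ τ.source ∧
    ContMDiffOn (𝓘(ℝ, EM).prod 𝓘(ℝ, EG)) 𝓘(ℝ, EP) ∞ τ.symm τ.target ∧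
    ∀ u ∈ τ.source, (τ u).1 = π u ∧ ∀ a : G, τ (u <• a) = (π u, (τ u).2 * a)

namespace IsPrincipalBundle

variable {π : P → M}

theorem smooth_right (hπ : IsPrincipalBundle EM EG G EP π) (a : G) :
    ContMDiff 𝓘(ℝ, EP) 𝓘(ℝ, EP) ∞ (fun u : P => u <• a) :=
  hπ.smooth_action.comp (contMDiff_id.prodMk contMDiff_const)

/-- The projection as a bundled `C²` map. -/
def proj (hπ : IsPrincipalBundle EM EG G EP π) : C^2⟮𝓘(ℝ, EP), P; 𝓘(ℝ, EM), M⟯ :=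
  ⟨π, hπ.smooth_proj.of_le two_le_infty⟩

/-- The right translation `R_a` as a bundled `C²` map. -/
def right (hπ : IsPrincipalBundle EM EG G EP π) (a : G) : C^2⟮𝓘(ℝ, EP), P; 𝓘(ℝ, EP), P⟯ :=
  ⟨fun u => u <• a, (hπ.smooth_right a).of_le two_le_infty⟩

/-- `(B f) ∘ R_a = B (f ∘ R_a)` for all `f` and `a`. -/
def IsEquivariant (hπ : IsPrincipalBundle EM EG G EP π) (B : DiffusionOperator EP P) : Prop :=
  ∀ (a : G) (f : C2 EP P) (u : P), B f (u <• a) = B (f.comp (hπ.right a)) u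

variable {B : DiffusionOperator EP P}

theorem apply_proj_eq (hπ : IsPrincipalBundle EM EG G EP π) (hB : hπ.IsEquivariant B) (f : C2 EM M) {u v : P} (h : π u = π v) :
    B (f.comp hπ.proj) u = B (f.comp hπ.proj) v := by
  obtain ⟨a, rfl⟩ := (hπ.orbit_iff u v).1 h
  have h : (f.comp hπ.proj).comp (hπ.right a) = f.comp hπ.proj := by
    refine DFunLike.ext _ _ fun w => ?_
    have hw : π (w <• a) = π w := ((hπ.orbit_iff w (w <• a)).2 ⟨a, rfl⟩).symm
    change f (π (w <• a)) = f (π w)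
    rw [hw]
  rw [hB, h]

end IsPrincipalBundle

section Induced

variable {π : P → M}

theorem exists_induced_coeff [IsManifold 𝓘(ℝ, EM) ∞ M] [IsManifold 𝓘(ℝ, EP) ∞ P]
    (hπ : IsPrincipalBundle EM EG G EP π) (B : DiffusionOperator EP P)
    (u : P) : ∃ (a : (EM →L[ℝ] EM →L[ℝ] ℝ) →ₗ[ℝ] ℝ) (b : (EM →L[ℝ] ℝ) →ₗ[ℝ] ℝ),
      ∀ f : C2 EM M, B (f.comp hπ.proj) u =
        a (fderiv ℝ (fderiv ℝ (inChart f (π u))) (extChartAt 𝓘(ℝ, EM) (π u) (π u)))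
          + b (fderiv ℝ (inChart f (π u)) (extChartAt 𝓘(ℝ, EM) (π u) (π u))) := by
  set y := extChartAt 𝓘(ℝ, EP) u u with hy
  let Φ : EP → EM := writtenInExtChartAt 𝓘(ℝ, EP) 𝓘(ℝ, EM) u π
  have hΦy : Φ y = extChartAt 𝓘(ℝ, EM) (π u) (π u) := by
    simp [Φ, writtenInExtChartAt, hy]
  have hΦ : ContDiffAt ℝ 2 Φ y := by
    have h1 : ContMDiffAt 𝓘(ℝ, EP) 𝓘(ℝ, EM) 2 π u :=
      (hπ.smooth_proj.of_le two_le_infty).contMDiffAt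
    have h2 := (contMDiffAt_iff.1 h1).2
    simp only [modelWithCornersSelf_coe, Set.range_id, contDiffWithinAt_univ] at h2
    exact h2
  let L1 : (EM →L[ℝ] EM →L[ℝ] ℝ) →ₗ[ℝ] (EP →L[ℝ] EP →L[ℝ] ℝ) :=
    { toFun := fun S => S.bilinearComp (fderiv ℝ Φ y) (fderiv ℝ Φ y)
      map_add' := fun S T => by ext v w; simp
      map_smul' := fun r S => by ext v w; simp }
  let L2 : (EM →L[ℝ] ℝ) →ₗ[ℝ] (EP →L[ℝ] EP →L[ℝ] ℝ) :=
    { toFun := fun l => (ContinuousLinearMap.compL ℝ EP EM ℝ l).comp (fderiv ℝ (fderiv ℝ Φ) y)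
      map_add' := fun S T => by ext v w; simp
      map_smul' := fun r S => by ext v w; simp }
  let L3 : (EM →L[ℝ] ℝ) →ₗ[ℝ] (EP →L[ℝ] ℝ) :=
    { toFun := fun l => l.comp (fderiv ℝ Φ y)
      map_add' := fun S T => by ext v; simp
      map_smul' := fun r S => by ext v; simp }
  refine ⟨B.coeffTwo u ∘ₗ L1, B.coeffTwo u ∘ₗ L2 + B.coeffOne u ∘ₗ L3, fun f => ?_⟩
  have hF : ContDiffAt ℝ 2 (inChart f (π u)) (Φ y) := by
    rw [hΦy]; exact DiffusionOperator.contDiffAt_inChart f (π u)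
  have e : inChart (f.comp hπ.proj) u =ᶠ[𝓝 y] inChart f (π u) ∘ Φ := by
    have hc : ContinuousAt (fun z => π ((extChartAt 𝓘(ℝ, EP) u).symm z)) y := by
      refine ContinuousAt.comp hπ.smooth_proj.continuous.continuousAt ?_
      exact continuousAt_extChartAt_symm u
    have hn : (extChartAt 𝓘(ℝ, EM) (π u)).source ∈
        𝓝 (π ((extChartAt 𝓘(ℝ, EP) u).symm y)) := by
      rw [hy, extChartAt_to_inv]
      exact extChartAt_source_mem_nhds (π u)
    filter_upwards [hc.preimage_mem_nhds hn] with z hz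
    change f (π _) = f ((extChartAt 𝓘(ℝ, EM) (π u)).symm
      (extChartAt 𝓘(ℝ, EM) (π u) (π ((extChartAt 𝓘(ℝ, EP) u).symm z))))
    rw [(extChartAt 𝓘(ℝ, EM) (π u)).left_inv hz]
  rw [B.apply_eq, e.fderiv.fderiv_eq, e.fderiv_eq,
    DiffusionOperator.fderiv_fderiv_comp hF hΦ,
    fderiv_comp y (hF.differentiableAt (by simp)) (hΦ.differentiableAt (by simp)), hΦy]
  simp only [map_add, LinearMap.add_apply, LinearMap.comp_apply]
  change _ + _ + _ = _ + (_ + _)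
  rw [add_assoc]
  rfl

/-- The operator `A` induced by an equivariant diffusion operator `B` on the base manifold:
`(A f)(x) = B (f ∘ π)(u)` for any `u` in the fibre over `x`. -/
def inducedOperator [IsManifold 𝓘(ℝ, EM) ∞ M] [IsManifold 𝓘(ℝ, EP) ∞ P]
    (hπ : IsPrincipalBundle EM EG G EP π) (B : DiffusionOperator EP P)
    (hB : hπ.IsEquivariant B) : DiffusionOperator EM M where
  toLin :=
    { toFun := fun f x => B (f.comp hπ.proj) (hπ.surjective_proj x).choose
      map_add' := fun f g => by
        funext x
        have : (f + g).comp hπ.proj = f.comp hπ.proj + g.comp hπ.proj := rfl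
        rw [this, map_add]; rfl
      map_smul' := fun r f => by
        funext x
        have : (r • f).comp hπ.proj = r • f.comp hπ.proj := rfl
        rw [this, map_smul]; rfl }
  secondOrder x := by
    obtain ⟨a, b, h⟩ := exists_induced_coeff hπ B (hπ.surjective_proj x).choose
    rw [(hπ.surjective_proj x).choose_spec] at h
    exact ⟨a, b, 0, fun f => by rw [zero_mul, add_zero]; exact h f⟩
  semiElliptic f x := by
    have h := B.semiElliptic (f.comp hπ.proj) (hπ.surjective_proj x).choose
    have hx : π (hπ.surjective_proj x).choose = x := (hπ.surjective_proj x).choose_spec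
    have h2 : (f.comp hπ.proj) (hπ.surjective_proj x).choose = f x := congrArg f hx
    have h3 : (f * f).comp hπ.proj = f.comp hπ.proj * f.comp hπ.proj := rfl
    simp only [squareField, h2] at h
    simp only [squareField, LinearMap.coe_mk, AddHom.coe_mk, h3]
    exact h
  map_const r x := B.map_const r _
  smooth f hf := by
    intro x₀
    obtain ⟨U, τ, hU, hx, hs, ht, hτ, hτs, hloc⟩ := hπ.locallyTrivial x₀
    have hs : ContMDiffOn 𝓘(ℝ, EM) 𝓘(ℝ, EP) ∞ (fun x => τ.symm (x, (1 : G))) U :=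
      hτs.comp (contMDiff_id.prodMk contMDiff_const).contMDiffOn (fun x hx => by simp [ht, hx])
    have hBf : ContMDiff 𝓘(ℝ, EP) 𝓘(ℝ, ℝ) ∞ (B (f.comp hπ.proj)) :=
      B.smooth _ (hf.comp hπ.smooth_proj)
    refine ContMDiffOn.contMDiffAt ?_ (hU.mem_nhds hx)
    refine (hBf.comp_contMDiffOn hs).congr fun x hx => ?_
    have hmem : (x, (1 : G)) ∈ τ.target := by simp [ht, hx]
    refine hπ.apply_proj_eq hB f ?_
    rw [(hπ.surjective_proj x).choose_spec, ← (hloc _ (τ.map_target hmem)).1,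
      τ.right_inv hmem]

/-- The defining property of the induced operator. -/
theorem inducedOperator_apply [IsManifold 𝓘(ℝ, EM) ∞ M] [IsManifold 𝓘(ℝ, EP) ∞ P]
    (hπ : IsPrincipalBundle EM EG G EP π) (B : DiffusionOperator EP P)
    (hB : hπ.IsEquivariant B) (f : C2 EM M) (u : P) :
    inducedOperator hπ B hB f (π u) = B (f.comp hπ.proj) u :=
  hπ.apply_proj_eq hB f (hπ.surjective_proj (π u)).choose_spec

end Induced

section Connections

/-- `B'` is a lift of `A` over `π` : `B' (f ∘ π) = (A f) ∘ π`. -/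
def IsPrincipalBundle.IsLift {π : P → M} (hπ : IsPrincipalBundle EM EG G EP π) (A : DiffusionOperator EM M)
    (B' : DiffusionOperator EP P) : Prop :=
  ∀ (f : C2 EM M) (u : P), B' (f.comp hπ.proj) u = A f (π u)

/-- The vertical tangent space `ker T_u π`. -/
def verticalSpace (π : P → M) (u : P) : Submodule ℝ (TangentSpace 𝓘(ℝ, EP) u) :=
  LinearMap.ker (mfderiv 𝓘(ℝ, EP) 𝓘(ℝ, EM) π u).toLinearMap

/-- The fundamental vector field of `A ∈ 𝔤`: the value at `u` is the derivative at `t = 0` of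
`u · exp (t A)`, that is, the image of `A` under the derivative at `1` of `a ↦ u · a`. -/
def fundamentalField (A : GroupLieAlgebra 𝓘(ℝ, EG) G) (u : P) : TangentSpace 𝓘(ℝ, EP) u :=
  (mfderiv 𝓘(ℝ, EG) 𝓘(ℝ, EP) (fun a : G => u <• a) 1 A : EP)

/-- The adjoint action of `a` on the Lie algebra. -/
def adjoint (a : G) (A : GroupLieAlgebra 𝓘(ℝ, EG) G) : GroupLieAlgebra 𝓘(ℝ, EG) G :=
  (mfderiv 𝓘(ℝ, EG) 𝓘(ℝ, EG) (fun g : G => a * g * a⁻¹) 1 A : EG)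

/-- The Lie derivative of the function `f` in the direction of the vector field `X`. -/
def lieDeriv (X : ∀ u : P, TangentSpace 𝓘(ℝ, EP) u) (f : P → ℝ) (u : P) : ℝ :=
  mvfderiv 𝓘(ℝ, EP) f u (X u)

variable [IsManifold 𝓘(ℝ, EP) ∞ P]

/-- `H` is a semi-connection on `π : P → M` over the family `D` of subspaces of the tangent spaces
of `M`: a smooth `G`-invariant subbundle of `TP` which `Tπ` maps bijectively onto `D`. -/
structure IsSemiConnection (G : Type*) [Group G] [MulAction Gᵐᵒᵖ P] (π : P → M)
    (D : ∀ x : M, Submodule ℝ (TangentSpace 𝓘(ℝ, EM) x))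
    (H : ∀ u : P, Submodule ℝ (TangentSpace 𝓘(ℝ, EP) u)) : Prop where
  smooth : IsSmoothSubbundle H
  bijOn : ∀ u : P, Set.BijOn (mfderiv 𝓘(ℝ, EP) 𝓘(ℝ, EM) π u) (H u) (D (π u))
  map_right : ∀ (u : P) (a : G),
    (H u).map (mfderiv 𝓘(ℝ, EP) 𝓘(ℝ, EP) (fun v : P => v <• a) u).toLinearMap = H (u <• a)

variable (EG G EP P) in
/-- A smooth connection one-form: a smooth `𝔤`-valued one-form `θ` on `P` (smoothness is tested on
linear functionals of `𝔤`) with `θ (A*) = A` for `A ∈ 𝔤` and `R_a^* θ = Ad (a⁻¹) θ`. -/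
structure ConnectionForm where
  toFun : ∀ u : P, TangentSpace 𝓘(ℝ, EP) u →L[ℝ] GroupLieAlgebra 𝓘(ℝ, EG) G
  smooth : ∀ l : GroupLieAlgebra 𝓘(ℝ, EG) G →L[ℝ] ℝ, ContMDiff 𝓘(ℝ, EP).tangent 𝓘(ℝ, ℝ) ∞
    (fun v : TangentBundle 𝓘(ℝ, EP) P => l (toFun v.1 v.2))
  apply_fundamentalField : ∀ (u : P) (A : GroupLieAlgebra 𝓘(ℝ, EG) G),
    toFun u (fundamentalField A u) = A
  map_right : ∀ (a : G) (u : P) (v : TangentSpace 𝓘(ℝ, EP) u),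
    toFun (u <• a) (mfderiv 𝓘(ℝ, EP) 𝓘(ℝ, EP) (fun w : P => w <• a) u v)
      = adjoint a⁻¹ (toFun u v)

/-- The real-valued one-form `l ∘ θ`. -/
def ConnectionForm.component (θ : ConnectionForm EG G EP P)
    (l : GroupLieAlgebra 𝓘(ℝ, EG) G →L[ℝ] ℝ) : OneForm EP P where
  toFun u := l.comp (θ.toFun u)
  smooth := θ.smooth l

/-- The `k`-th coordinate functional of a basis of the Lie algebra. -/
def coordCLM [FiniteDimensional ℝ EG] {ι : Type*}
    (b : Module.Basis ι ℝ (GroupLieAlgebra 𝓘(ℝ, EG) G)) (k : ι) :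
    GroupLieAlgebra 𝓘(ℝ, EG) G →L[ℝ] ℝ :=
  (LinearMap.toContinuousLinearMap (b.coord k : EG →ₗ[ℝ] ℝ) : EG →L[ℝ] ℝ)

/-- `θ` vanishes on the subspaces `H u`. -/
def ConnectionForm.VanishesOn (θ : ConnectionForm EG G EP P)
    (H : ∀ u : P, Submodule ℝ (TangentSpace 𝓘(ℝ, EP) u)) : Prop :=
  ∀ u, ∀ v ∈ H u, θ.toFun u v = 0

variable (EM) in
/-- `B = AH + BV` with `AH` horizontal for `H` and `BV` vertical for `π`. -/
structure IsDecomposition (π : P → M) (H : ∀ u : P, Submodule ℝ (TangentSpace 𝓘(ℝ, EP) u))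
    (B AH BV : DiffusionOperator EP P) : Prop where
  horizontal : AH.IsAlong H
  vertical : BV.IsAlong (verticalSpace (EM := EM) π)
  sum_eq : ∀ (f : C2 EP P) (u : P), B f u = AH f u + BV f u

end Connections

end Bundle
end
end EquivariantDiffusion

open EquivariantDiffusion

set_option linter.unusedSectionVars false

namespace EquivariantDiffusion

noncomputable section

/-! ### Smooth vector fields and covector fields on open sets, cut-offs and extension by zero. -/

section Toolkit

variable {E : Type*} [NormedAddCommGroup E] [NormedSpace ℝ E]
  {N : Type*} [TopologicalSpace N] [ChartedSpace E N]
  {E' : Type*} [NormedAddCommGroup E'] [NormedSpace ℝ E']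
  {N' : Type*} [TopologicalSpace N'] [ChartedSpace E' N']
  {F : Type*} [NormedAddCommGroup F] [NormedSpace ℝ F]

/-! The semi-connection is read off from the symbol of `B`: take `H u = σ^B (π^* T^*M)`, the vectors
that the symbol produces from covectors pulled back from the base (`liftedSpace`). By definition of
the induced operator `A`, `B` is a lift of `A`, hence `Tπ (σ^B (π^*ξ)) = σ^A ξ`, and `Tπ` maps `H u`
onto `E`. It is injective there by nonnegativity: if `σ^A ξ = 0`, then `σ^B (π^*ξ, π^*ξ) = σ^A (ξ,
ξ) = 0`, and a semidefinite form kills its null vectors, so `σ^B (π^*ξ) = 0` (`bijOn_liftedSpace`).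
Invariance follows from equivariance of `B`, and constant rank of `σ^A` gives smooth local frames
`σ^B (d(f i ∘ π))`.

Uniqueness: in a decomposition over `H'` the vertical part does not see pulled back covectors, so
`σ^B (π^*ξ)` is a value of the symbol of the horizontal part and lies in `H'`. Thus `H ≤ H'`, and
both project bijectively onto `E` (`eq_liftedSpace`).

Existence: choose a connection form `θ` that vanishes on `H`, glued from local ones by a partition
of unity on `M`. If `B = A^H + B^V`, the horizontal part contributes nothing to the symbol or to `δ`
of the coordinates `θ^k`, while `θ^k` takes constant values on fundamental fields. This forces the
coefficients `σ^B (θ^k, θ^l)` and `δ^B θ^l` of `B^V`; take them as its definition and put `A^H = B -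
B^V`. `B^V` is semi-elliptic because its second order coefficients form a Gram matrix. `A^H` is
semi-elliptic because every covector is a combination of the `θ^k` plus a pulled back covector: the
`θ^k` lie in the kernel of `σ^B - σ^{B^V}`, and on pulled back covectors this difference is `σ^B`
(`symbolForm_verticalPart_le`).

That `A^H` is horizontal is where cohesion of `A` enters. A form vanishing on `H` is a combination
of the `θ^k`, which `δ` of `A^H` kills, plus a form vanishing on `Tπ⁻¹ E`. The latter is locally `∑
g i • π^*(ψ i)` with `ψ i` vanishing on `E`, and for a lift of `A` one has `δ (π^*ψ) = (δ^A ψ) ∘ π =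
0` (`delta_eq_zero_of_isLift`).

Throughout, `δ` is handled by writing a one-form locally as `∑ g i • d(f i)`: this turns statements
about `δ` and symbols into statements about the operator on functions. -/

theorem mvfderiv_apply (f : N → F) (x : N) (v : TangentSpace 𝓘(ℝ, E) x) :
    mvfderiv 𝓘(ℝ, E) f x v = (mfderiv 𝓘(ℝ, E) 𝓘(ℝ, F) f x v : F) := rfl

theorem mvfderiv_comp_mfderiv {g : N' → F} {f : N → N'} {x : N}
    (hg : MDifferentiableAt 𝓘(ℝ, E') 𝓘(ℝ, F) g (f x))
    (hf : MDifferentiableAt 𝓘(ℝ, E) 𝓘(ℝ, E') f x) (v : TangentSpace 𝓘(ℝ, E) x) :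
    mvfderiv 𝓘(ℝ, E) (g ∘ f) x v
      = mvfderiv 𝓘(ℝ, E') g (f x) (mfderiv 𝓘(ℝ, E) 𝓘(ℝ, E') f x v) := by
  have h := mfderiv_comp x hg hf
  exact congrArg (fun L : E →L[ℝ] F => L v) h

theorem mvfderiv_congr {f g : N → F} {x : N} (h : f =ᶠ[𝓝 x] g) :
    mvfderiv 𝓘(ℝ, E) f x = mvfderiv 𝓘(ℝ, E) g x := by
  have h1 : (mfderiv 𝓘(ℝ, E) 𝓘(ℝ, F) f x : E →L[ℝ] F) = mfderiv 𝓘(ℝ, E) 𝓘(ℝ, F) g x := h.mfderiv_eq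
  ext v
  exact congrArg (fun L : E →L[ℝ] F => L v) h1

theorem mvfderiv_clm_comp (l : F →L[ℝ] E') {f : N → F} {x : N}
    (hf : MDifferentiableAt 𝓘(ℝ, E) 𝓘(ℝ, F) f x) (v : TangentSpace 𝓘(ℝ, E) x) :
    mvfderiv 𝓘(ℝ, E) (fun y => l (f y)) x v = l (mvfderiv 𝓘(ℝ, E) f x v) := by
  refine (mvfderiv_comp_mfderiv (g := l)
    ((l.contMDiff (n := 1)).mdifferentiableAt (by simp)) hf v).trans ?_
  rw [mvfderiv_apply, mfderiv_eq_fderiv, l.fderiv]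
  rfl

/-- The vector field `X` is smooth on `W`. -/
def SmoothFieldOn (X : ∀ x : N, TangentSpace 𝓘(ℝ, E) x) [IsManifold 𝓘(ℝ, E) ∞ N] (W : Set N) :
    Prop :=
  ContMDiffOn 𝓘(ℝ, E) 𝓘(ℝ, E).tangent ∞ (fun x => (⟨x, X x⟩ : TangentBundle 𝓘(ℝ, E) N)) W

/-- The field of covectors `φ` is smooth on `W`. -/
def SmoothFormOn (φ : ∀ x : N, TangentSpace 𝓘(ℝ, E) x →L[ℝ] ℝ) [IsManifold 𝓘(ℝ, E) ∞ N]
    (W : Set N) : Prop :=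
  ContMDiffOn 𝓘(ℝ, E).tangent 𝓘(ℝ, ℝ) ∞ (fun v : TangentBundle 𝓘(ℝ, E) N => φ v.1 v.2)
    (Bundle.TotalSpace.proj ⁻¹' W)

theorem contMDiffOn_tangentMap {n m : WithTop ℕ∞} (hmn : m + 1 ≤ n) [IsManifold 𝓘(ℝ, E) n N]
    [IsManifold 𝓘(ℝ, E') n N'] [IsManifold 𝓘(ℝ, E) 1 N] [IsManifold 𝓘(ℝ, E') 1 N']
    {f : N → N'} {W : Set N} (hW : IsOpen W)
    (hf : ContMDiffOn 𝓘(ℝ, E) 𝓘(ℝ, E') n f W) :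
    ContMDiffOn 𝓘(ℝ, E).tangent 𝓘(ℝ, E').tangent m (tangentMap 𝓘(ℝ, E) 𝓘(ℝ, E') f)
      (Bundle.TotalSpace.proj ⁻¹' W) := by
  refine (hf.contMDiffOn_tangentMapWithin hmn hW.uniqueMDiffOn).congr fun v hv => ?_
  rw [tangentMapWithin_eq_tangentMap (hW.uniqueMDiffOn _ hv)
    (((hf.contMDiffAt (hW.mem_nhds hv)).mdifferentiableAt ?_))]
  rintro rfl
  simp at hmn

variable [IsManifold 𝓘(ℝ, E) ∞ N] [IsManifold 𝓘(ℝ, E') ∞ N']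

theorem contMDiffOn_mvfderiv {n m : WithTop ℕ∞} (hmn : m + 1 ≤ n) [IsManifold 𝓘(ℝ, E) n N]
    [IsManifold 𝓘(ℝ, E) 1 N] {f : N → F} {W : Set N}
    (hW : IsOpen W) (hf : ContMDiffOn 𝓘(ℝ, E) 𝓘(ℝ, F) n f W) :
    ContMDiffOn 𝓘(ℝ, E).tangent 𝓘(ℝ, F) m
      (fun v : TangentBundle 𝓘(ℝ, E) N => mvfderiv 𝓘(ℝ, E) f v.1 v.2)
      (Bundle.TotalSpace.proj ⁻¹' W) :=
  (contMDiff_snd_tangentBundle_modelSpace F 𝓘(ℝ, F)).comp_contMDiffOn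
    (contMDiffOn_tangentMap hmn hW hf)

theorem SmoothFieldOn.mono {X : ∀ x : N, TangentSpace 𝓘(ℝ, E) x} {W W' : Set N}
    (h : SmoothFieldOn X W) (hW : W' ⊆ W) : SmoothFieldOn X W' := ContMDiffOn.mono h hW

theorem SmoothFormOn.mono {φ : ∀ x : N, TangentSpace 𝓘(ℝ, E) x →L[ℝ] ℝ} {W W' : Set N}
    (h : SmoothFormOn φ W) (hW : W' ⊆ W) : SmoothFormOn φ W' :=
  ContMDiffOn.mono h (Set.preimage_mono hW)

theorem OneForm.smoothFormOn (φ : OneForm E N) (W : Set N) : SmoothFormOn φ.toFun W :=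
  φ.smooth.contMDiffOn

theorem smoothFormOn_mvfderiv {f : N → ℝ} {W : Set N} (hW : IsOpen W)
    (hf : ContMDiffOn 𝓘(ℝ, E) 𝓘(ℝ, ℝ) ∞ f W) : SmoothFormOn (mvfderiv 𝓘(ℝ, E) f) W :=
  contMDiffOn_mvfderiv (by simp) hW hf

theorem SmoothFormOn.apply {φ : ∀ x : N, TangentSpace 𝓘(ℝ, E) x →L[ℝ] ℝ} {W : Set N}
    (h : SmoothFormOn φ W) {X : ∀ x : N, TangentSpace 𝓘(ℝ, E) x} (hX : SmoothFieldOn X W) :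
    ContMDiffOn 𝓘(ℝ, E) 𝓘(ℝ, ℝ) ∞ (fun x => φ x (X x)) W :=
  ContMDiffOn.comp h hX fun _ hx => hx

theorem contMDiffOn_mvfderiv_apply {n m : WithTop ℕ∞} (hmn : m + 1 ≤ n) (hn : n ≤ ∞) {f : N → F}
    {W : Set N} (hW : IsOpen W) (hf : ContMDiffOn 𝓘(ℝ, E) 𝓘(ℝ, F) n f W)
    {X : ∀ x : N, TangentSpace 𝓘(ℝ, E) x} (hX : SmoothFieldOn X W) :
    ContMDiffOn 𝓘(ℝ, E) 𝓘(ℝ, F) m (fun x => mvfderiv 𝓘(ℝ, E) f x (X x)) W := by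
  have : IsManifold 𝓘(ℝ, E) n N := .of_le hn
  have hm : m ≤ ∞ := (le_self_add.trans hmn).trans hn
  have h := contMDiffOn_mvfderiv hmn hW hf
  exact h.comp (ContMDiffOn.of_le hX hm) fun _ hx => hx

theorem SmoothFormOn.smul {φ : ∀ x : N, TangentSpace 𝓘(ℝ, E) x →L[ℝ] ℝ} {W : Set N} {f : N → ℝ}
    (hf : ContMDiffOn 𝓘(ℝ, E) 𝓘(ℝ, ℝ) ∞ f W) (h : SmoothFormOn φ W) :
    SmoothFormOn (fun x => f x • φ x) W :=
  (hf.comp (Bundle.contMDiff_proj _).contMDiffOn fun _ hx => hx).smul h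

theorem SmoothFormOn.sub {φ ψ : ∀ x : N, TangentSpace 𝓘(ℝ, E) x →L[ℝ] ℝ} {W : Set N}
    (h : SmoothFormOn φ W) (h' : SmoothFormOn ψ W) : SmoothFormOn (fun x => φ x - ψ x) W :=
  ContMDiffOn.sub h h'

theorem SmoothFormOn.sum {κ : Type*} (s : Finset κ)
    {φ : κ → ∀ x : N, TangentSpace 𝓘(ℝ, E) x →L[ℝ] ℝ} {W : Set N}
    (h : ∀ i ∈ s, SmoothFormOn (φ i) W) : SmoothFormOn (fun x => ∑ i ∈ s, φ i x) W := by
  have := contMDiffOn_finsetSum (t := s)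
    (f := fun i => fun v : TangentBundle 𝓘(ℝ, E) N => φ i v.1 v.2) h
  refine ContMDiffOn.congr this fun v hv => ?_
  simp only [sum_apply]

theorem SmoothFormOn.pullback {φ : ∀ x : N', TangentSpace 𝓘(ℝ, E') x →L[ℝ] ℝ} {W' : Set N'}
    (h : SmoothFormOn φ W') {W : Set N} (hW : IsOpen W) {f : N → N'}
    (hf : ContMDiffOn 𝓘(ℝ, E) 𝓘(ℝ, E') ∞ f W) (hm : Set.MapsTo f W W') :
    SmoothFormOn (fun x => (φ (f x)).comp (mfderiv 𝓘(ℝ, E) 𝓘(ℝ, E') f x)) W :=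
  ContMDiffOn.comp h (contMDiffOn_tangentMap (by simp) hW hf) fun _ hx => hm hx

/-- The differential of a smooth function as a one-form. -/
def OneForm.d (f : N → ℝ) (hf : ContMDiff 𝓘(ℝ, E) 𝓘(ℝ, ℝ) ∞ f) : OneForm E N where
  toFun := mvfderiv 𝓘(ℝ, E) f
  smooth := contMDiffOn_univ.1 (smoothFormOn_mvfderiv isOpen_univ hf.contMDiffOn)

/-- A globally smooth field of covectors as a one-form. -/
def OneForm.mk' (φ : ∀ x : N, TangentSpace 𝓘(ℝ, E) x →L[ℝ] ℝ) (h : SmoothFormOn φ Set.univ) :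
    OneForm E N where
  toFun := φ
  smooth := contMDiffOn_univ.1 h

/-- A smooth function as an element of the algebra of `C²` functions. -/
def toC2 (f : N → ℝ) (hf : ContMDiff 𝓘(ℝ, E) 𝓘(ℝ, ℝ) ∞ f) : C2 E N :=
  ⟨f, hf.of_le two_le_infty⟩

/-- Extension by zero: as a function on the tangent bundle the product is supported over `tsupport
χ`, whose preimage is closed, and over `W` it is a product of smooth functions. -/
theorem SmoothFormOn.smul_bump {φ : ∀ x : N, TangentSpace 𝓘(ℝ, E) x →L[ℝ] ℝ} {W : Set N}
    (hW : IsOpen W) (h : SmoothFormOn φ W) {χ : N → ℝ} (hχ : ContMDiff 𝓘(ℝ, E) 𝓘(ℝ, ℝ) ∞ χ)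
    (hs : tsupport χ ⊆ W) : SmoothFormOn (fun x => χ x • φ x) Set.univ := by
  refine contMDiffOn_univ.2 (contMDiff_of_tsupport fun v hv => ?_)
  have hv' : v.proj ∈ tsupport χ := by
    have hc : IsClosed ((Bundle.TotalSpace.proj : TangentBundle 𝓘(ℝ, E) N → N) ⁻¹' tsupport χ) :=
      (isClosed_tsupport χ).preimage (FiberBundle.continuous_proj E _)
    refine closure_minimal (fun w hw => ?_) hc hv
    refine subset_tsupport χ fun h0 => hw ?_
    have h0 : χ w.1 = 0 := h0
    simp [h0]
  have h2 := SmoothFormOn.smul (hχ.contMDiffOn (s := W)) h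
  exact ContMDiffOn.contMDiffAt h2
    ((hW.preimage (FiberBundle.continuous_proj E _)).mem_nhds (hs hv'))

variable [FiniteDimensional ℝ E] [T2Space N]

theorem exists_bump {x : N} {W : Set N} (hW : W ∈ 𝓝 x) :
    ∃ χ : N → ℝ, ContMDiff 𝓘(ℝ, E) 𝓘(ℝ, ℝ) ∞ χ ∧ χ =ᶠ[𝓝 x] 1 ∧ tsupport χ ⊆ W := by
  obtain ⟨f, -, hf⟩ := (SmoothBumpFunction.nhds_basis_tsupport (I := 𝓘(ℝ, E)) x).mem_iff.1 hW
  exact ⟨f, f.contMDiff, f.eventuallyEq_one, hf⟩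

theorem exists_global_function {x : N} {W : Set N} (hW : IsOpen W) (hx : x ∈ W) {f : N → F}
    (hf : ContMDiffOn 𝓘(ℝ, E) 𝓘(ℝ, F) ∞ f W) :
    ∃ g : N → F, ContMDiff 𝓘(ℝ, E) 𝓘(ℝ, F) ∞ g ∧ g =ᶠ[𝓝 x] f := by
  obtain ⟨χ, hχ, h1, hs⟩ := exists_bump (E := E) (hW.mem_nhds hx)
  refine ⟨fun y => χ y • f y, contMDiff_of_tsupport fun y hy => ?_, ?_⟩
  · have hy' : y ∈ W := hs (closure_mono (Function.support_smul_subset_left χ f) hy)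
    exact hχ.contMDiffAt.smul (hf.contMDiffAt (hW.mem_nhds hy'))
  · filter_upwards [h1] with y hy
    simp [hy]

/-- The cut-off is part of the conclusion so that vanishing of `φ` on given subspaces over `W`
passes to `ψ` over all of `N`. -/
theorem exists_global_form {φ : ∀ x : N, TangentSpace 𝓘(ℝ, E) x →L[ℝ] ℝ} {x : N} {W : Set N}
    (hW : IsOpen W) (hx : x ∈ W) (h : SmoothFormOn φ W) :
    ∃ (ψ : OneForm E N) (χ : N → ℝ), (∀ y, ψ.toFun y = χ y • φ y) ∧ χ =ᶠ[𝓝 x] 1 ∧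
      ∀ y ∉ W, χ y = 0 := by
  obtain ⟨χ, hχ, h1, hs⟩ := exists_bump (E := E) (hW.mem_nhds hx)
  exact ⟨.mk' _ (h.smul_bump hW hχ hs), χ, fun _ => rfl, h1,
    fun y hy => image_eq_zero_of_notMem_tsupport fun h => hy (hs h)⟩

end Toolkit

/-! ### Fields, functions and forms read in charts. -/

section Frames

variable {E : Type*} [NormedAddCommGroup E] [NormedSpace ℝ E]
  {N : Type*} [TopologicalSpace N] [ChartedSpace E N] [IsManifold 𝓘(ℝ, E) ∞ N]
  {F : Type*} [NormedAddCommGroup F] [NormedSpace ℝ F]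

theorem contMDiffOn_chart (x : N) :
    ContMDiffOn 𝓘(ℝ, E) 𝓘(ℝ, E) ∞ (extChartAt 𝓘(ℝ, E) x) (extChartAt 𝓘(ℝ, E) x).source := by
  rw [extChartAt_source]
  exact contMDiffOn_extChartAt

/-- The differential of the preferred chart at `x`. -/
def dChart (x y : N) : TangentSpace 𝓘(ℝ, E) y →L[ℝ] E :=
  mvfderiv (F := E) 𝓘(ℝ, E) (extChartAt 𝓘(ℝ, E) x) y

theorem mfderiv_chart_symm_dChart {x y : N} (hy : y ∈ (extChartAt 𝓘(ℝ, E) x).source)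
    (v : TangentSpace 𝓘(ℝ, E) y) :
    (mfderiv 𝓘(ℝ, E) 𝓘(ℝ, E) (extChartAt 𝓘(ℝ, E) x).symm (extChartAt 𝓘(ℝ, E) x y)
      (dChart (E := E) x y v : E) : E) = (v : E) := by
  have h1 : MDifferentiableAt 𝓘(ℝ, E) 𝓘(ℝ, E) (extChartAt 𝓘(ℝ, E) x) y :=
    ((contMDiffOn_chart x).contMDiffAt ((isOpen_extChartAt_source x).mem_nhds hy)
      ).mdifferentiableAt (by simp)
  have h2 : MDifferentiableAt 𝓘(ℝ, E) 𝓘(ℝ, E) (extChartAt 𝓘(ℝ, E) x).symm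
      (extChartAt 𝓘(ℝ, E) x y) :=
    ((contMDiffOn_extChartAt_symm (I := 𝓘(ℝ, E)) (n := 1) x).contMDiffAt
      ((isOpen_extChartAt_target x).mem_nhds
        ((extChartAt 𝓘(ℝ, E) x).map_source hy))).mdifferentiableAt (by simp)
  have h3 := mfderiv_comp_apply y h2 h1 v
  have e : (extChartAt 𝓘(ℝ, E) x).symm ∘ extChartAt 𝓘(ℝ, E) x =ᶠ[𝓝 y] id := by
    filter_upwards [(isOpen_extChartAt_source (I := 𝓘(ℝ, E)) x).mem_nhds hy] with z hz
    exact (extChartAt 𝓘(ℝ, E) x).left_inv hz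
  have h4 : (mfderiv 𝓘(ℝ, E) 𝓘(ℝ, E)
      ((extChartAt 𝓘(ℝ, E) x).symm ∘ extChartAt 𝓘(ℝ, E) x) y : E →L[ℝ] E)
      = (mfderiv 𝓘(ℝ, E) 𝓘(ℝ, E) (id : N → N) y : E →L[ℝ] E) := e.mfderiv_eq
  rw [mfderiv_id] at h4
  exact h3.symm.trans (congrArg (fun L : E →L[ℝ] E => L v) h4)

theorem dChart_injective {x y : N} (hy : y ∈ (extChartAt 𝓘(ℝ, E) x).source) :
    Function.Injective (dChart (E := E) x y) := by
  intro v w h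
  have h1 := mfderiv_chart_symm_dChart hy v
  rw [h] at h1
  exact h1.symm.trans (mfderiv_chart_symm_dChart hy w)

theorem contMDiffOn_dChart (x : N) : ContMDiffOn 𝓘(ℝ, E).tangent 𝓘(ℝ, E) ∞
    (fun v : TangentBundle 𝓘(ℝ, E) N => dChart (E := E) x v.1 v.2)
    (Bundle.TotalSpace.proj ⁻¹' (extChartAt 𝓘(ℝ, E) x).source) :=
  contMDiffOn_mvfderiv (F := E) (n := ∞) (by simp) (isOpen_extChartAt_source x) (contMDiffOn_chart x)

theorem contMDiffOn_dChart_apply {X : ∀ y : N, TangentSpace 𝓘(ℝ, E) y} {W : Set N} {x : N}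
    (hX : SmoothFieldOn X W) (hW : IsOpen W) (hWx : W ⊆ (extChartAt 𝓘(ℝ, E) x).source) :
    ContMDiffOn 𝓘(ℝ, E) 𝓘(ℝ, E) ∞ (fun y => dChart (E := E) x y (X y)) W :=
  contMDiffOn_mvfderiv_apply (F := E) (n := ∞) (m := ∞) (by simp) le_rfl hW
    ((contMDiffOn_chart x).mono hWx) hX

/-- The preferred trivialization of the tangent bundle at `x` acts on vectors as the differential of
the chart at `x`. Each point is tested only in its own chart. -/
theorem smoothFieldOn_of_dChart {X : ∀ y : N, TangentSpace 𝓘(ℝ, E) y} {W : Set N}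
    (h : ∀ x ∈ W, ContMDiffAt 𝓘(ℝ, E) 𝓘(ℝ, E) ∞ (fun y => dChart (E := E) x y (X y)) x) :
    SmoothFieldOn X W := by
  intro x hx
  refine ContMDiffAt.contMDiffWithinAt ?_
  rw [Bundle.contMDiffAt_section]
  refine (h x hx).congr_of_eventuallyEq ?_
  filter_upwards [(isOpen_extChartAt_source (I := 𝓘(ℝ, E)) x).mem_nhds
    (mem_extChartAt_source x)] with y hy
  rw [extChartAt_source] at hy
  have h1 := TangentBundle.continuousLinearMapAt_trivializationAt (I := 𝓘(ℝ, E)) hy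
  have h2 := congrArg (fun L : E →L[ℝ] E => L (X y)) h1
  refine Eq.trans ?_ h2
  have hb : y ∈ (trivializationAt E (TangentSpace 𝓘(ℝ, E)) x).baseSet := by
    simpa using hy
  exact ((trivializationAt E (TangentSpace 𝓘(ℝ, E)) x).continuousLinearMapAt_apply_of_mem (R := ℝ) hb (X y)).symm

/-- A function read in a chart, as a function on the manifold with values in the dual. -/
def chartDeriv (f : N → F) (x : N) : N → E →L[ℝ] F :=
  fun y => fderiv ℝ (f ∘ (extChartAt 𝓘(ℝ, E) x).symm) (extChartAt 𝓘(ℝ, E) x y)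

theorem contMDiffOn_chartDeriv {f : N → F} (hf : ContMDiff 𝓘(ℝ, E) 𝓘(ℝ, F) ∞ f) (x : N) :
    ContMDiffOn 𝓘(ℝ, E) 𝓘(ℝ, E →L[ℝ] F) ∞ (chartDeriv (E := E) f x) (extChartAt 𝓘(ℝ, E) x).source := by
  have h1 : ContDiffOn ℝ ∞ (f ∘ (extChartAt 𝓘(ℝ, E) x).symm) (extChartAt 𝓘(ℝ, E) x).target :=
    (hf.comp_contMDiffOn (contMDiffOn_extChartAt_symm x)).contDiffOn
  exact (h1.fderiv_of_isOpen (isOpen_extChartAt_target x) (m := ∞) (by simp)).contMDiffOn.comp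
    (contMDiffOn_chart x) fun _ hy => (extChartAt 𝓘(ℝ, E) x).map_source hy

theorem chartDeriv_dChart {f : N → F} {x y : N} (hf : MDifferentiableAt 𝓘(ℝ, E) 𝓘(ℝ, F) f y)
    (hy : y ∈ (extChartAt 𝓘(ℝ, E) x).source) (v : TangentSpace 𝓘(ℝ, E) y) :
    chartDeriv f x y (dChart (E := E) x y v) = mvfderiv 𝓘(ℝ, E) f y v := by
  have h1 : MDifferentiableAt 𝓘(ℝ, E) 𝓘(ℝ, E) (extChartAt 𝓘(ℝ, E) x).symm
      (extChartAt 𝓘(ℝ, E) x y) :=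
    ((contMDiffOn_extChartAt_symm (I := 𝓘(ℝ, E)) (n := 1) x).contMDiffAt
      ((isOpen_extChartAt_target x).mem_nhds
        ((extChartAt 𝓘(ℝ, E) x).map_source hy))).mdifferentiableAt (by simp)
  have h2 : DifferentiableAt ℝ (f ∘ (extChartAt 𝓘(ℝ, E) x).symm) (extChartAt 𝓘(ℝ, E) x y) := by
    rw [← mdifferentiableAt_iff_differentiableAt]
    refine MDifferentiableAt.comp _ ?_ h1
    rwa [(extChartAt 𝓘(ℝ, E) x).left_inv hy]
  have h3 : MDifferentiableAt 𝓘(ℝ, E) 𝓘(ℝ, E) (extChartAt 𝓘(ℝ, E) x) y :=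
    ((contMDiffOn_chart x).contMDiffAt ((isOpen_extChartAt_source x).mem_nhds hy)
      ).mdifferentiableAt (by simp)
  have h4 := mvfderiv_comp_mfderiv h2.mdifferentiableAt h3 v
  have e : (f ∘ (extChartAt 𝓘(ℝ, E) x).symm) ∘ extChartAt 𝓘(ℝ, E) x =ᶠ[𝓝 y] f := by
    filter_upwards [(isOpen_extChartAt_source (I := 𝓘(ℝ, E)) x).mem_nhds hy] with z hz
    exact congrArg f ((extChartAt 𝓘(ℝ, E) x).left_inv hz)
  rw [mvfderiv_congr e] at h4
  rw [h4, mvfderiv_apply, mfderiv_eq_fderiv]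
  rfl

variable [FiniteDimensional ℝ E]

theorem OneForm.contDiffOn_inChart (φ : OneForm E N) (x : N) :
    ContDiffOn ℝ ∞ (DiffusionOperator.OneForm.inChart φ x) (extChartAt 𝓘(ℝ, E) x).target := by
  set c := extChartAt 𝓘(ℝ, E) x with hc
  have ho : IsOpen c.target := isOpen_extChartAt_target x
  rw [contDiffOn_clm_apply]
  intro v
  have h1 : ContMDiffOn 𝓘(ℝ, E).tangent 𝓘(ℝ, E).tangent ∞ (tangentMap 𝓘(ℝ, E) 𝓘(ℝ, E) c.symm)
      (Bundle.TotalSpace.proj ⁻¹' c.target) :=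
    contMDiffOn_tangentMap (n := ∞) (by simp) ho (contMDiffOn_extChartAt_symm x)
  have h2 : ContMDiffOn 𝓘(ℝ, E) 𝓘(ℝ, E).tangent ∞
      (fun y : E => (Bundle.TotalSpace.mk' E y v : TangentBundle 𝓘(ℝ, E) E)) c.target :=
    contMDiffOn_vectorSpace_iff_contDiffOn.2 contDiffOn_const
  exact (φ.smooth.comp_contMDiffOn (h1.comp h2 fun y hy => hy)).contDiffOn

/-- The coefficients of the one-form `φ` in the preferred chart at `x`. -/
def OneForm.coeff (φ : OneForm E N) (x : N) : N → E →L[ℝ] ℝ :=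
  fun y => DiffusionOperator.OneForm.inChart φ x (extChartAt 𝓘(ℝ, E) x y)

theorem OneForm.contMDiffOn_coeff (φ : OneForm E N) (x : N) :
    ContMDiffOn 𝓘(ℝ, E) 𝓘(ℝ, E →L[ℝ] ℝ) ∞ (φ.coeff x) (extChartAt 𝓘(ℝ, E) x).source :=
  (φ.contDiffOn_inChart x).contMDiffOn.comp (contMDiffOn_chart x)
    fun _ hy => (extChartAt 𝓘(ℝ, E) x).map_source hy

theorem OneForm.coeff_dChart (φ : OneForm E N) {x y : N}
    (hy : y ∈ (extChartAt 𝓘(ℝ, E) x).source) (v : TangentSpace 𝓘(ℝ, E) y) :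
    φ.coeff x y (dChart (E := E) x y v) = φ.toFun y v := by
  have h := mfderiv_chart_symm_dChart hy v
  have h2 : ∀ z : N, z = y → ∀ w : E, w = v → φ.toFun z (w : E) = φ.toFun y v := by
    rintro z rfl w rfl; rfl
  exact h2 _ ((extChartAt 𝓘(ℝ, E) x).left_inv hy) _ h

end Frames

/-! ### Smooth one-sided inverses, dual frames and division of forms by differentials. -/

section DualFrames

variable {E : Type*} [NormedAddCommGroup E] [NormedSpace ℝ E]
  {N : Type*} [TopologicalSpace N] [ChartedSpace E N] [IsManifold 𝓘(ℝ, E) ∞ N]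
  {F : Type*} [NormedAddCommGroup F] [NormedSpace ℝ F] [FiniteDimensional ℝ F]
  {F' : Type*} [NormedAddCommGroup F'] [NormedSpace ℝ F']

/-- A smooth family of endomorphisms which is the identity at `x` has a smooth inverse near `x`. -/
theorem exists_smooth_inverse {x : N} {U : Set N} (hU : IsOpen U) (hx : x ∈ U) {A : N → F →L[ℝ] F}
    (hA : ContMDiffOn 𝓘(ℝ, E) 𝓘(ℝ, F →L[ℝ] F) ∞ A U) (h1 : A x = .id ℝ F) :
    ∃ (W : Set N) (R : N → F →L[ℝ] F), IsOpen W ∧ x ∈ W ∧ W ⊆ U ∧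
      ContMDiffOn 𝓘(ℝ, E) 𝓘(ℝ, F →L[ℝ] F) ∞ R W ∧
      ∀ y ∈ W, (R y).comp (A y) = .id ℝ F ∧ (A y).comp (R y) = .id ℝ F := by
  have : CompleteSpace F := FiniteDimensional.complete ℝ F
  refine ⟨U ∩ A ⁻¹' {a | IsUnit a}, fun y => Ring.inverse (A y),
    hA.continuousOn.isOpen_inter_preimage hU Units.isOpen, ⟨hx, ?_⟩, Set.inter_subset_left, ?_, ?_⟩
  · change IsUnit (A x)
    rw [h1]
    exact isUnit_one
  · rintro y ⟨hy, ⟨a, ha⟩⟩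
    have h2 : ContDiffAt ℝ ∞ Ring.inverse (A y) := by
      rw [← ha]; exact contDiffAt_ringInverse ℝ a
    exact (h2.contMDiffAt.comp y (hA.contMDiffAt (hU.mem_nhds hy))).contMDiffWithinAt
  · rintro y ⟨-, hy⟩
    exact ⟨Ring.inverse_mul_cancel _ hy, Ring.mul_inverse_cancel _ hy⟩

/-- A left inverse `S` of `A x`, held fixed, makes `S ∘ A y` a smooth family of endomorphisms equal
to the identity at `x`; its inverse followed after `S` is the required family. -/
theorem exists_smooth_leftInverse {x : N} {U : Set N} (hU : IsOpen U) (hx : x ∈ U)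
    {A : N → F →L[ℝ] F'} (hA : ContMDiffOn 𝓘(ℝ, E) 𝓘(ℝ, F →L[ℝ] F') ∞ A U)
    [FiniteDimensional ℝ F'] (h1 : Function.Injective (A x)) :
    ∃ (W : Set N) (R : N → F' →L[ℝ] F), IsOpen W ∧ x ∈ W ∧ W ⊆ U ∧
      ContMDiffOn 𝓘(ℝ, E) 𝓘(ℝ, F' →L[ℝ] F) ∞ R W ∧ ∀ y ∈ W, (R y).comp (A y) = .id ℝ F := by
  obtain ⟨S, hS⟩ := LinearMap.exists_leftInverse_of_injective (A x).toLinearMap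
    (LinearMap.ker_eq_bot.2 h1)
  let S' : F' →L[ℝ] F := LinearMap.toContinuousLinearMap S
  have hS' : S'.comp (A x) = .id ℝ F := by
    ext v; exact LinearMap.congr_fun hS v
  obtain ⟨W, R, hW, hxW, hWU, hR, hRA⟩ := exists_smooth_inverse hU hx
    (A := fun y => S'.comp (A y)) (contMDiffOn_const.clm_comp hA) hS'
  refine ⟨W, fun y => (R y).comp S', hW, hxW, hWU, hR.clm_comp contMDiffOn_const, fun y hy => ?_⟩
  exact (hRA y hy).1

theorem exists_smooth_rightInverse {x : N} {U : Set N} (hU : IsOpen U) (hx : x ∈ U)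
    {A : N → F' →L[ℝ] F} (hA : ContMDiffOn 𝓘(ℝ, E) 𝓘(ℝ, F' →L[ℝ] F) ∞ A U)
    (h1 : Function.Surjective (A x)) :
    ∃ (W : Set N) (R : N → F →L[ℝ] F'), IsOpen W ∧ x ∈ W ∧ W ⊆ U ∧
      ContMDiffOn 𝓘(ℝ, E) 𝓘(ℝ, F →L[ℝ] F') ∞ R W ∧ ∀ y ∈ W, (A y).comp (R y) = .id ℝ F := by
  obtain ⟨S, hS⟩ := LinearMap.exists_rightInverse_of_surjective (A x).toLinearMap
    (LinearMap.range_eq_top.2 h1)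
  let S' : F →L[ℝ] F' := LinearMap.toContinuousLinearMap S
  have hS' : (A x).comp S' = .id ℝ F := by
    ext v; exact LinearMap.congr_fun hS v
  obtain ⟨W, R, hW, hxW, hWU, hR, hRA⟩ := exists_smooth_inverse hU hx
    (A := fun y => (A y).comp S') (hA.clm_comp contMDiffOn_const) hS'
  refine ⟨W, fun y => S'.comp (R y), hW, hxW, hWU, contMDiffOn_const.clm_comp hR, fun y hy => ?_⟩
  exact (hRA y hy).2

variable [FiniteDimensional ℝ E]

/-- A local frame of a subbundle has a smooth dual system of covector fields. -/
theorem exists_dualFrame {k : ℕ} {X : Fin k → ∀ y : N, TangentSpace 𝓘(ℝ, E) y} {x : N} {U : Set N}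
    (hU : IsOpen U) (hx : x ∈ U) (hX : ∀ i, SmoothFieldOn (X i) U)
    (hli : LinearIndependent ℝ fun i => X i x) :
    ∃ (W : Set N) (l : Fin k → ∀ y : N, TangentSpace 𝓘(ℝ, E) y →L[ℝ] ℝ), IsOpen W ∧ x ∈ W ∧ W ⊆ U ∧
      (∀ i, SmoothFormOn (l i) W) ∧ ∀ y ∈ W, ∀ i j, l i y (X j y) = if i = j then 1 else 0 := by
  set q := extChartAt 𝓘(ℝ, E) x
  -- The frame, read in the chart at `x`, is packed into one linear map from `ℝ^k`; the components
  -- of a left inverse are the dual covectors.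
  let A : N → (Fin k → ℝ) →L[ℝ] E := fun y =>
    ∑ i, (ContinuousLinearMap.proj (R := ℝ) (φ := fun _ : Fin k => ℝ) i).smulRight
      (dChart (E := E) x y (X i y))
  have hAy : ∀ y t, A y t = dChart (E := E) x y (∑ i, t i • X i y) := by
    intro y t
    simp [A, map_sum]
  have hA : ContMDiffOn 𝓘(ℝ, E) 𝓘(ℝ, (Fin k → ℝ) →L[ℝ] E) ∞ A (U ∩ q.source) := by
    refine contMDiffOn_finsetSum fun i _ => ?_
    exact (ContinuousLinearMap.contMDiff
      (ContinuousLinearMap.smulRightL ℝ (Fin k → ℝ) E (ContinuousLinearMap.proj i))).comp_contMDiffOn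
      (contMDiffOn_dChart_apply ((hX i).mono Set.inter_subset_left)
        (hU.inter (isOpen_extChartAt_source x)) Set.inter_subset_right)
  have hinj : Function.Injective (A x) := by
    rw [injective_iff_map_eq_zero]
    intro t ht
    rw [hAy] at ht
    have h0 := dChart_injective (mem_extChartAt_source (I := 𝓘(ℝ, E)) x) (ht.trans (map_zero _).symm)
    funext i
    exact Fintype.linearIndependent_iff.1 hli t h0 i
  obtain ⟨W, R, hW, hxW, hWU, hR, hRA⟩ := exists_smooth_leftInverse
    (hU.inter (isOpen_extChartAt_source x)) ⟨hx, mem_extChartAt_source x⟩ hA hinj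
  refine ⟨W, fun i y => ((ContinuousLinearMap.proj (R := ℝ) (φ := fun _ : Fin k => ℝ) i).comp
    (R y)).comp (dChart (E := E) x y), hW, hxW, hWU.trans Set.inter_subset_left, fun i => ?_,
    fun y hy i j => ?_⟩
  · have h1 : ContMDiffOn 𝓘(ℝ, E).tangent 𝓘(ℝ, E →L[ℝ] ℝ) ∞
        (fun v : TangentBundle 𝓘(ℝ, E) N =>
          (ContinuousLinearMap.proj (R := ℝ) (φ := fun _ : Fin k => ℝ) i).comp (R v.1))
        (Bundle.TotalSpace.proj ⁻¹' W) :=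
      (contMDiffOn_const.clm_comp hR).comp (Bundle.contMDiff_proj _).contMDiffOn fun _ hv => hv
    exact h1.clm_apply ((contMDiffOn_dChart x).mono fun v hv => (hWU hv).2)
  · have h2 := hAy y (Pi.single j 1)
    have h3 : ∑ i, (Pi.single j 1 : Fin k → ℝ) i • X i y = X j y := by
      rw [Finset.sum_eq_single j] <;> simp +contextual
    rw [h3] at h2
    have h4 := congrArg (fun L : (Fin k → ℝ) →L[ℝ] (Fin k → ℝ) => L (Pi.single j 1) i) (hRA y hy)
    simp only [ContinuousLinearMap.comp_apply, h2, ContinuousLinearMap.id_apply, Pi.single_apply] at h4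
    exact h4

variable [T2Space N]

/-- A vector field along which all smooth functions have smooth derivatives is smooth. -/
theorem smoothFieldOn_of_forall {X : ∀ y : N, TangentSpace 𝓘(ℝ, E) y} {W : Set N} (hW : IsOpen W)
    (h : ∀ f : N → ℝ, ContMDiff 𝓘(ℝ, E) 𝓘(ℝ, ℝ) ∞ f →
      ContMDiffOn 𝓘(ℝ, E) 𝓘(ℝ, ℝ) ∞ (fun y => mvfderiv 𝓘(ℝ, E) f y (X y)) W) :
    SmoothFieldOn X W := by
  refine smoothFieldOn_of_dChart fun x hx => ?_
  -- The hypothesis speaks of global functions only, so the chart is replaced by a global map with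
  -- the same germ and tested coordinate by coordinate.
  obtain ⟨q, hq, hqx⟩ := exists_global_function (isOpen_extChartAt_source (I := 𝓘(ℝ, E)) x)
    (mem_extChartAt_source x) (contMDiffOn_chart x)
  let e := (Module.finBasis ℝ E).equivFunL
  suffices hs : ContMDiffAt 𝓘(ℝ, E) 𝓘(ℝ, Fin (Module.finrank ℝ E) → ℝ) ∞
      (fun y => e (dChart (E := E) x y (X y))) x by
    have := ((e.symm : (Fin (Module.finrank ℝ E) → ℝ) →L[ℝ] E).contMDiff.contMDiffAt (n := ∞)).comp x hs
    simpa [Function.comp_def] using this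
  rw [contMDiffAt_pi_space]
  intro i
  let l : E →L[ℝ] ℝ := (ContinuousLinearMap.proj i).comp (e : E →L[ℝ] Fin (Module.finrank ℝ E) → ℝ)
  have h1 := (h (fun y => l (q y)) (l.contMDiff.comp hq)).contMDiffAt (hW.mem_nhds hx)
  refine h1.congr_of_eventuallyEq ?_
  filter_upwards [hqx.eventuallyEq_nhds] with y hy
  rw [mvfderiv_clm_comp l (hq.mdifferentiableAt (by simp)), mvfderiv_congr hy]
  rfl

/-- A one-form which vanishes on the kernel of a submersion with values in a vector space is a
linear combination of the components of its differential. -/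
theorem exists_coeff_of_ker_le (φ : OneForm E N) {Φ : N → F} (hΦ : ContMDiff 𝓘(ℝ, E) 𝓘(ℝ, F) ∞ Φ)
    {x : N} (hs : Function.Surjective (mvfderiv 𝓘(ℝ, E) Φ x))
    (hk : ∀ᶠ y in 𝓝 x, ∀ v, mvfderiv 𝓘(ℝ, E) Φ y v = 0 → φ.toFun y v = 0) :
    ∃ c : N → F →L[ℝ] ℝ, ContMDiff 𝓘(ℝ, E) 𝓘(ℝ, F →L[ℝ] ℝ) ∞ c ∧
      ∀ᶠ y in 𝓝 x, ∀ v, φ.toFun y v = c y (mvfderiv 𝓘(ℝ, E) Φ y v) := by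
  have hsurj : Function.Surjective (chartDeriv (E := E) Φ x x) := by
    intro w
    obtain ⟨v, hv⟩ := hs w
    exact ⟨dChart (E := E) x x v, (chartDeriv_dChart (hΦ.mdifferentiableAt (by simp)) (mem_extChartAt_source x) v).trans hv⟩
  -- With `R` a right inverse of `dΦ` in the chart, `id - R ∘ dΦ` takes values in the kernel of
  -- `dΦ`, on which `φ` vanishes. Hence `φ = (φ ∘ R) ∘ dΦ`, and `c` is `φ ∘ R`.
  obtain ⟨W, R, hW, hxW, hWU, hR, hRA⟩ := exists_smooth_rightInverse
    (isOpen_extChartAt_source (I := 𝓘(ℝ, E)) x) (mem_extChartAt_source x)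
    (contMDiffOn_chartDeriv hΦ x) hsurj
  obtain ⟨c, hc, hce⟩ := exists_global_function hW hxW
    (((φ.contMDiffOn_coeff x).mono hWU).clm_comp hR)
  refine ⟨c, hc, ?_⟩
  filter_upwards [hce, hW.mem_nhds hxW, hk] with y hy hyW hky v
  have hys := hWU hyW
  obtain ⟨w, hw⟩ : ∃ w : TangentSpace 𝓘(ℝ, E) y, dChart (E := E) x y w
      = R y (mvfderiv 𝓘(ℝ, E) Φ y v) := by
    let D : E →L[ℝ] E := dChart (E := E) x y
    have hi : Function.Injective D.toLinearMap := dChart_injective hys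
    exact LinearMap.injective_iff_surjective.1 hi _
  have h1 : mvfderiv 𝓘(ℝ, E) Φ y (v - w) = 0 := by
    rw [map_sub, ← chartDeriv_dChart (hΦ.mdifferentiableAt (by simp)) hys w, hw]
    have := congrArg (fun L : F →L[ℝ] F => L (mvfderiv 𝓘(ℝ, E) Φ y v)) (hRA y hyW)
    exact sub_eq_zero.2 this.symm
  have h2 := hky _ h1
  rw [map_sub, sub_eq_zero] at h2
  rw [h2, ← φ.coeff_dChart hys w, hw, hy]
  rfl

end DualFrames

/-! ### Calculus of `δ` and of the symbol. -/

section Operators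

variable {E : Type*} [NormedAddCommGroup E] [NormedSpace ℝ E]
  {N : Type*} [TopologicalSpace N] [ChartedSpace E N] [IsManifold 𝓘(ℝ, E) ∞ N]

/-- The linear combination `∑ i ∈ s, g i • φ i` of one-forms. -/
def OneForm.linComb {κ : Type*} (s : Finset κ) (g : κ → N → ℝ)
    (hg : ∀ i, ContMDiff 𝓘(ℝ, E) 𝓘(ℝ, ℝ) ∞ (g i)) (φ : κ → OneForm E N) : OneForm E N :=
  .mk' (fun y => ∑ i ∈ s, g i y • (φ i).toFun y)
    (SmoothFormOn.sum s fun i _ => SmoothFormOn.smul (hg i).contMDiffOn ((φ i).smoothFormOn _))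

/-- The product of a smooth function and a one-form. -/
def OneForm.smul (g : N → ℝ) (hg : ContMDiff 𝓘(ℝ, E) 𝓘(ℝ, ℝ) ∞ g) (φ : OneForm E N) :
    OneForm E N :=
  .mk' (fun y => g y • φ.toFun y) (SmoothFormOn.smul hg.contMDiffOn (φ.smoothFormOn _))

namespace DiffusionOperator

variable (B : DiffusionOperator E N)

theorem delta_congr {φ ψ : OneForm E N} {x : N} (h : ∀ᶠ y in 𝓝 x, φ.toFun y = ψ.toFun y) :
    B.delta φ x = B.delta ψ x := by
  have e : OneForm.inChart φ x =ᶠ[𝓝 (extChartAt 𝓘(ℝ, E) x x)] OneForm.inChart ψ x := by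
    have hc := (continuousAt_extChartAt_symm (I := 𝓘(ℝ, E)) x).eventually
      (p := fun y => φ.toFun y = ψ.toFun y) (by rwa [extChartAt_to_inv])
    filter_upwards [hc] with y hy
    simp only [OneForm.inChart, hy]
  rw [delta, delta, e.fderiv_eq, h.self_of_nhds]

theorem squareField_comm (f g : C2 E N) (x : N) :
    squareField B.toLin f g x = squareField B.toLin g f x := by
  simp only [squareField, mul_comm f g]
  ring

theorem contMDiff_squareField {f g : N → ℝ} (hf : ContMDiff 𝓘(ℝ, E) 𝓘(ℝ, ℝ) ∞ f)
    (hg : ContMDiff 𝓘(ℝ, E) 𝓘(ℝ, ℝ) ∞ g) :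
    ContMDiff 𝓘(ℝ, E) 𝓘(ℝ, ℝ) ∞ (squareField B.toLin (toC2 f hf) (toC2 g hg)) := by
  have h1 := B.smooth (toC2 f hf * toC2 g hg) (hf.mul hg)
  have h2 := B.smooth (toC2 f hf) hf
  have h3 := B.smooth (toC2 g hg) hg
  exact ((contMDiff_const.mul h1).sub ((contMDiff_const.mul h2).mul hg)).sub
    ((contMDiff_const.mul hf).mul h3)

theorem symbolForm_symm (x : N) (ξ η : E →L[ℝ] ℝ) : B.symbolForm x ξ η = B.symbolForm x η ξ := by
  rw [symbolForm_apply]; rfl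

variable [FiniteDimensional ℝ E]

theorem symbolForm_mvfderiv (f g : C2 E N) (x : N) :
    B.symbolForm x (mvfderiv 𝓘(ℝ, E) f x) (mvfderiv 𝓘(ℝ, E) g x) = squareField B.toLin f g x := by
  rw [squareField_comm, ← symbol_spec, apply_symbol]

/-- The rule for `δ` of a linear combination of one-forms. -/
theorem delta_linComb {κ : Type*} (s : Finset κ) {g : κ → N → ℝ}
    (hg : ∀ i, ContMDiff 𝓘(ℝ, E) 𝓘(ℝ, ℝ) ∞ (g i)) (φ : κ → OneForm E N) (x : N) :
    B.delta (.linComb s g hg φ) x =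
      ∑ i ∈ s, (B.symbolForm x ((φ i).toFun x) (mvfderiv 𝓘(ℝ, E) (g i) x) + g i x * B.delta (φ i) x) := by
  classical
  induction s using Finset.induction_on with
  | empty =>
    have h := B.delta_smul (0 : C2 E N) (.linComb ∅ g hg φ) (.linComb ∅ g hg φ)
      (fun y => by simp [OneForm.linComb, OneForm.mk']) x
    rw [h]
    have h0 : ((0 : C2 E N) : N → ℝ) = 0 := rfl
    rw [h0, mvfderiv_zero]
    simp
  | insert i s hi ih =>
    rw [Finset.sum_insert hi, ← ih]
    have h1 := B.delta_smul (toC2 (g i) (hg i)) (φ i) (.smul (g i) (hg i) (φ i)) (fun y => rfl) x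
    rw [apply_symbol] at h1
    have h2 := B.delta_add (.smul (g i) (hg i) (φ i)) (.linComb s g hg φ)
      (.linComb (insert i s) g hg φ) (fun y => Finset.sum_insert hi) x
    rw [h2, h1]
    rfl

theorem delta_eq_sum {κ : Type*} (s : Finset κ) {g : κ → N → ℝ}
    (hg : ∀ i, ContMDiff 𝓘(ℝ, E) 𝓘(ℝ, ℝ) ∞ (g i)) {φ : κ → OneForm E N} {ψ : OneForm E N} {x : N}
    (h : ∀ᶠ y in 𝓝 x, ψ.toFun y = ∑ i ∈ s, g i y • (φ i).toFun y) :
    B.delta ψ x =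
      ∑ i ∈ s, (B.symbolForm x ((φ i).toFun x) (mvfderiv 𝓘(ℝ, E) (g i) x) + g i x * B.delta (φ i) x) := by
  rw [← B.delta_linComb s hg φ x]
  exact B.delta_congr h

/-- The main tool for `δ`: together with `OneForm.exists_eq_sum_d` it reduces every question about
`δ` to values of `B` on functions, without reference to the coefficients in a chart. -/
theorem delta_eq_sum_d {κ : Type*} (s : Finset κ) {g f : κ → N → ℝ}
    (hg : ∀ i, ContMDiff 𝓘(ℝ, E) 𝓘(ℝ, ℝ) ∞ (g i)) (hf : ∀ i, ContMDiff 𝓘(ℝ, E) 𝓘(ℝ, ℝ) ∞ (f i))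
    {ψ : OneForm E N} {x : N}
    (h : ∀ᶠ y in 𝓝 x, ψ.toFun y = ∑ i ∈ s, g i y • mvfderiv 𝓘(ℝ, E) (f i) y) :
    B.delta ψ x = ∑ i ∈ s, (squareField B.toLin (toC2 (g i) (hg i)) (toC2 (f i) (hf i)) x
      + g i x * B (toC2 (f i) (hf i)) x) := by
  rw [B.delta_eq_sum s hg (φ := fun i => .d (f i) (hf i)) h]
  refine Finset.sum_congr rfl fun i _ => ?_
  rw [B.delta_d (toC2 (f i) (hf i)) _ (fun y => rfl), squareField_comm, ← symbolForm_mvfderiv]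
  rfl

end DiffusionOperator

variable [FiniteDimensional ℝ E] [T2Space N]

/-- Compose `ξ` with a global extension of the germ of the chart at `x`, whose derivative at `x` is
the identity. Identities between covectors can then be checked on differentials. -/
theorem exists_function_of_covector (x : N) (ξ : TangentSpace 𝓘(ℝ, E) x →L[ℝ] ℝ) :
    ∃ f : N → ℝ, ContMDiff 𝓘(ℝ, E) 𝓘(ℝ, ℝ) ∞ f ∧ mvfderiv 𝓘(ℝ, E) f x = ξ := by
  obtain ⟨q, hq, hqx⟩ := exists_global_function (isOpen_extChartAt_source (I := 𝓘(ℝ, E)) x)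
    (mem_extChartAt_source x) (contMDiffOn_chart x)
  let l : E →L[ℝ] ℝ := ξ
  refine ⟨fun y => l (q y), l.contMDiff.comp hq, ?_⟩
  ext v
  rw [mvfderiv_clm_comp l (hq.mdifferentiableAt (by simp)), mvfderiv_congr hqx]
  have h := mfderiv_extChartAt_self (I := 𝓘(ℝ, E)) (x := x)
  exact congrArg l (congrArg (fun L : E →L[ℝ] E => L v) h)

theorem OneForm.exists_eq_sum (φ : OneForm E N) {F : Type*} [NormedAddCommGroup F]
    [NormedSpace ℝ F] [FiniteDimensional ℝ F] {Φ : N → F} (hΦ : ContMDiff 𝓘(ℝ, E) 𝓘(ℝ, F) ∞ Φ)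
    {x : N} (hs : Function.Surjective (mvfderiv 𝓘(ℝ, E) Φ x))
    (hk : ∀ᶠ y in 𝓝 x, ∀ v, mvfderiv 𝓘(ℝ, E) Φ y v = 0 → φ.toFun y v = 0) :
    ∃ (g : Fin (Module.finrank ℝ F) → N → ℝ), (∀ i, ContMDiff 𝓘(ℝ, E) 𝓘(ℝ, ℝ) ∞ (g i)) ∧
      ∀ᶠ y in 𝓝 x, φ.toFun y = ∑ i, g i y •
        mvfderiv 𝓘(ℝ, E) (fun z => LinearMap.toContinuousLinearMap ((Module.finBasis ℝ F).coord i) (Φ z)) y := by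
  obtain ⟨c, hc, hce⟩ := exists_coeff_of_ker_le φ hΦ hs hk
  refine ⟨fun i y => c y (Module.finBasis ℝ F i), fun i => hc.clm_apply contMDiff_const, ?_⟩
  filter_upwards [hce] with y hy
  ext v
  rw [hy v, sum_apply]
  conv_lhs => rw [← (Module.finBasis ℝ F).sum_repr (mvfderiv 𝓘(ℝ, E) Φ y v)]
  rw [map_sum]
  refine Finset.sum_congr rfl fun i _ => ?_
  rw [smul_apply, mvfderiv_clm_comp _ (hΦ.mdifferentiableAt (by simp)), map_smul]
  simp [mul_comm]

/-- Near a given point some smooth map to the model space is a local diffeomorphism. -/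
theorem exists_bijective_mvfderiv (x : N) : ∃ q : N → E, ContMDiff 𝓘(ℝ, E) 𝓘(ℝ, E) ∞ q ∧
    ∀ᶠ y in 𝓝 x, Function.Bijective (mvfderiv 𝓘(ℝ, E) q y) := by
  obtain ⟨q, hq, hqx⟩ := exists_global_function (isOpen_extChartAt_source (I := 𝓘(ℝ, E)) x)
    (mem_extChartAt_source x) (contMDiffOn_chart x)
  refine ⟨q, hq, ?_⟩
  filter_upwards [hqx.eventuallyEq_nhds, (isOpen_extChartAt_source (I := 𝓘(ℝ, E)) x).mem_nhds
    (mem_extChartAt_source x)] with y hy hys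
  rw [mvfderiv_congr hy]
  let D : E →L[ℝ] E := dChart (E := E) x y
  have hi : Function.Injective D.toLinearMap := dChart_injective hys
  have hD : Function.Surjective D.toLinearMap := LinearMap.injective_iff_surjective.1 hi
  exact ⟨hi, hD⟩

/-- A one-form is locally a linear combination of differentials. -/
theorem OneForm.exists_eq_sum_d (φ : OneForm E N) (x : N) :
    ∃ (g f : Fin (Module.finrank ℝ E) → N → ℝ), (∀ i, ContMDiff 𝓘(ℝ, E) 𝓘(ℝ, ℝ) ∞ (g i)) ∧
      (∀ i, ContMDiff 𝓘(ℝ, E) 𝓘(ℝ, ℝ) ∞ (f i)) ∧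
      ∀ᶠ y in 𝓝 x, φ.toFun y = ∑ i, g i y • mvfderiv 𝓘(ℝ, E) (f i) y := by
  obtain ⟨q, hq, hd⟩ := exists_bijective_mvfderiv (E := E) x
  obtain ⟨g, hg, he⟩ := φ.exists_eq_sum hq hd.self_of_nhds.2 (hd.mono fun y hy v hv => by
    rw [hy.1 (hv.trans (map_zero _).symm), map_zero])
  exact ⟨g, _, hg, fun i => (ContinuousLinearMap.contMDiff _).comp hq, he⟩

namespace DiffusionOperator

variable (B : DiffusionOperator E N)

theorem symbolForm_nonneg (x : N) (ξ : TangentSpace 𝓘(ℝ, E) x →L[ℝ] ℝ) :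
    0 ≤ B.symbolForm x ξ ξ := by
  obtain ⟨f, hf, rfl⟩ := exists_function_of_covector x ξ
  have h := B.symbolForm_mvfderiv (toC2 f hf) (toC2 f hf) x
  exact (B.semiElliptic (toC2 f hf) x).trans_eq h.symm

/-- The degenerate case of Cauchy–Schwarz: along `t • ξ + η` the nonnegative quadratic form is
affine in `t`, so its slope vanishes. -/
theorem symbolForm_eq_zero {x : N} {ξ : TangentSpace 𝓘(ℝ, E) x →L[ℝ] ℝ}
    (h : B.symbolForm x ξ ξ = 0) (η : TangentSpace 𝓘(ℝ, E) x →L[ℝ] ℝ) : B.symbolForm x ξ η = 0 := by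
  have key : ∀ t : ℝ, 0 ≤ t * (2 * B.symbolForm x ξ η) + B.symbolForm x η η := by
    intro t
    have h1 := B.symbolForm_nonneg x (t • ξ + η)
    have h2 : B.symbolForm x (t • ξ + η) (t • ξ + η) =
        t * (t * B.symbolForm x ξ ξ) + t * B.symbolForm x ξ η + t * B.symbolForm x η ξ
          + B.symbolForm x η η := by
      let ξ' : E →L[ℝ] ℝ := ξ
      let η' : E →L[ℝ] ℝ := η
      change B.symbolForm x (t • ξ' + η') (t • ξ' + η') =
        t * (t * B.symbolForm x ξ' ξ') + t * B.symbolForm x ξ' η' + t * B.symbolForm x η' ξ'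
          + B.symbolForm x η' η'
      simp only [map_add, map_smul, LinearMap.add_apply, LinearMap.smul_apply, smul_eq_mul]
      ring
    rw [h2, h, B.symbolForm_symm x η ξ] at h1
    linarith
  by_contra hne
  -- For this `t` the right-hand side of `key` equals `-1`.
  have h1 := key (-(B.symbolForm x η η + 1) / (2 * B.symbolForm x ξ η))
  rw [div_mul_cancel₀ _ (mul_ne_zero two_ne_zero hne)] at h1
  linarith

/-- The coefficients in the definition of `δ` are chosen point by point, so smoothness is not
visible there. It comes from the local formula for `∑ g i • d(f i)`, which involves only `B` applied
to smooth functions. -/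
theorem contMDiff_delta (φ : OneForm E N) : ContMDiff 𝓘(ℝ, E) 𝓘(ℝ, ℝ) ∞ (B.delta φ) := by
  intro x
  obtain ⟨g, f, hg, hf, he⟩ := φ.exists_eq_sum_d x
  have h : ContMDiff 𝓘(ℝ, E) 𝓘(ℝ, ℝ) ∞ fun y =>
      ∑ i, (squareField B.toLin (toC2 (g i) (hg i)) (toC2 (f i) (hf i)) y
        + g i y * B (toC2 (f i) (hf i)) y) :=
    contMDiff_finsetSum fun i _ => (B.contMDiff_squareField (hg i) (hf i)).add
      ((hg i).mul (B.smooth _ (hf i)))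
  refine h.contMDiffAt.congr_of_eventuallyEq ?_
  filter_upwards [he.eventually_nhds] with y hy
  exact B.delta_eq_sum_d Finset.univ hg hf hy

theorem delta_smul' {g : N → ℝ} (hg : ContMDiff 𝓘(ℝ, E) 𝓘(ℝ, ℝ) ∞ g) (φ : OneForm E N) (x : N) :
    B.delta (.smul g hg φ) x =
      B.symbolForm x (φ.toFun x) (mvfderiv 𝓘(ℝ, E) g x) + g x * B.delta φ x := by
  have h := B.delta_smul (toC2 g hg) φ (.smul g hg φ) (fun y => rfl) x
  rw [apply_symbol] at h
  exact h

/-- The product rule gives `dg (σ φ) = δ (g φ) - g δ φ`, a smooth function for every smooth `g`. -/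
theorem smoothFieldOn_symbol (φ : OneForm E N) (W : Set N) :
    SmoothFieldOn (fun x => B.symbol x (φ.toFun x)) W := by
  refine (smoothFieldOn_of_forall isOpen_univ fun g hg => ?_).mono (Set.subset_univ W)
  refine (((B.contMDiff_delta (.smul g hg φ)).sub (hg.mul (B.contMDiff_delta φ))).congr
    fun x => ?_).contMDiffOn
  rw [B.delta_smul' hg, apply_symbol]
  simp only [Pi.mul_apply]
  ring

theorem contMDiff_symbolForm (φ ψ : OneForm E N) :
    ContMDiff 𝓘(ℝ, E) 𝓘(ℝ, ℝ) ∞ (fun x => B.symbolForm x (φ.toFun x) (ψ.toFun x)) := by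
  refine contMDiffOn_univ.1 (((ψ.smoothFormOn _).apply (B.smoothFieldOn_symbol φ _)).congr
    fun x _ => ?_)
  rw [apply_symbol]

variable {B}

/-- With `φ` also `g φ` vanishes on `S`, so `δ` kills both and the product rule leaves `dg (σ φ) =
0`; the differentials `dg` exhaust the covectors. -/
theorem IsAlong.symbolForm_eq_zero {S : ∀ x : N, Submodule ℝ (TangentSpace 𝓘(ℝ, E) x)}
    (h : B.IsAlong S) {φ : OneForm E N} (hφ : ∀ x, ∀ v ∈ S x, φ.toFun x v = 0) (x : N)
    (η : TangentSpace 𝓘(ℝ, E) x →L[ℝ] ℝ) : B.symbolForm x (φ.toFun x) η = 0 := by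
  obtain ⟨g, hg, rfl⟩ := exists_function_of_covector x η
  have h1 := B.delta_smul' hg φ x
  rw [h φ hφ, h _ (fun y v hv => by
    change g y * φ.toFun y v = 0
    rw [hφ y v hv, mul_zero])] at h1
  linarith

/-- The operator `δ` depends additively on the diffusion operator. -/
theorem delta_of_add {B A C : DiffusionOperator E N}
    (h : ∀ (f : C2 E N) (x : N), B f x = A f x + C f x) (φ : OneForm E N) (x : N) :
    B.delta φ x = A.delta φ x + C.delta φ x := by
  obtain ⟨g, f, hg, hf, he⟩ := φ.exists_eq_sum_d x
  rw [B.delta_eq_sum_d _ hg hf he, A.delta_eq_sum_d _ hg hf he, C.delta_eq_sum_d _ hg hf he,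
    ← Finset.sum_add_distrib]
  refine Finset.sum_congr rfl fun i _ => ?_
  simp only [squareField, h]
  ring

theorem symbolForm_of_add {B A C : DiffusionOperator E N}
    (h : ∀ (f : C2 E N) (x : N), B f x = A f x + C f x) (x : N)
    (ξ η : TangentSpace 𝓘(ℝ, E) x →L[ℝ] ℝ) :
    B.symbolForm x ξ η = A.symbolForm x ξ η + C.symbolForm x ξ η := by
  obtain ⟨f, hf, rfl⟩ := exists_function_of_covector x ξ
  obtain ⟨g, hg, rfl⟩ := exists_function_of_covector x η
  have h1 := B.symbolForm_mvfderiv (toC2 f hf) (toC2 g hg) x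
  have h2 := A.symbolForm_mvfderiv (toC2 f hf) (toC2 g hg) x
  have h3 := C.symbolForm_mvfderiv (toC2 f hf) (toC2 g hg) x
  simp only [squareField, h] at h1 h2 h3
  refine h1.trans (Eq.trans ?_ (congrArg₂ (· + ·) h2 h3).symm)
  ring

end DiffusionOperator

end Operators

/-! ### Diffusion operators built from vector fields. -/

section FieldOperators

variable {E : Type*} [NormedAddCommGroup E] [NormedSpace ℝ E]
  {N : Type*} [TopologicalSpace N] [ChartedSpace E N] [IsManifold 𝓘(ℝ, E) ∞ N]

/-- General orders are needed because the operators act on functions that are only `C²`: one Lie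
derivative of such a function is `C¹`, which suffices for a second one. -/
theorem contMDiff_lieDeriv {n m : WithTop ℕ∞} (hmn : m + 1 ≤ n) (hn : n ≤ ∞)
    {X : ∀ x : N, TangentSpace 𝓘(ℝ, E) x} (hX : SmoothFieldOn X Set.univ) {f : N → ℝ}
    (hf : ContMDiff 𝓘(ℝ, E) 𝓘(ℝ, ℝ) n f) :
    ContMDiff 𝓘(ℝ, E) 𝓘(ℝ, ℝ) m (lieDeriv (EP := E) X f) :=
  contMDiffOn_univ.1 (contMDiffOn_mvfderiv_apply hmn hn isOpen_univ hf.contMDiffOn hX)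

theorem mdifferentiableAt_lieDeriv {X : ∀ x : N, TangentSpace 𝓘(ℝ, E) x}
    (hX : SmoothFieldOn X Set.univ) (f : C2 E N) (x : N) :
    MDifferentiableAt 𝓘(ℝ, E) 𝓘(ℝ, ℝ) (lieDeriv (EP := E) X f) x :=
  (contMDiff_lieDeriv (n := 2) (m := 1) (by norm_num) two_le_infty hX
    f.contMDiff).mdifferentiableAt (by simp)

theorem C2.mdifferentiableAt (f : C2 E N) (x : N) : MDifferentiableAt 𝓘(ℝ, E) 𝓘(ℝ, ℝ) f x :=
  f.contMDiff.mdifferentiableAt (by simp)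

theorem lieDeriv_add (X : ∀ x : N, TangentSpace 𝓘(ℝ, E) x) {f g : N → ℝ} {x : N}
    (hf : MDifferentiableAt 𝓘(ℝ, E) 𝓘(ℝ, ℝ) f x) (hg : MDifferentiableAt 𝓘(ℝ, E) 𝓘(ℝ, ℝ) g x) :
    lieDeriv (EP := E) X (f + g) x = lieDeriv (EP := E) X f x + lieDeriv (EP := E) X g x := by
  simp only [lieDeriv, mvfderiv_add hf hg, add_apply]

theorem lieDeriv_mul (X : ∀ x : N, TangentSpace 𝓘(ℝ, E) x) {f g : N → ℝ} {x : N}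
    (hf : MDifferentiableAt 𝓘(ℝ, E) 𝓘(ℝ, ℝ) f x) (hg : MDifferentiableAt 𝓘(ℝ, E) 𝓘(ℝ, ℝ) g x) :
    lieDeriv (EP := E) X (f * g) x
      = f x * lieDeriv (EP := E) X g x + g x * lieDeriv (EP := E) X f x := by
  simp only [lieDeriv, mvfderiv_mul hf hg, add_apply, smul_apply, smul_eq_mul]

theorem lieDeriv_const (X : ∀ x : N, TangentSpace 𝓘(ℝ, E) x) (r : ℝ) (x : N) :
    lieDeriv (EP := E) X (fun _ => r) x = 0 := by
  simp only [lieDeriv, mvfderiv_const, zero_apply]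

theorem lieDeriv_const_smul (X : ∀ x : N, TangentSpace 𝓘(ℝ, E) x) (r : ℝ) {f : N → ℝ} {x : N}
    (hf : MDifferentiableAt 𝓘(ℝ, E) 𝓘(ℝ, ℝ) f x) :
    lieDeriv (EP := E) X (r • f) x = r * lieDeriv (EP := E) X f x := by
  have h := lieDeriv_mul X (f := fun _ => r) (mdifferentiableAt_const (x := x)) hf
  rw [lieDeriv_const, mul_zero, add_zero] at h
  exact h

theorem lieDeriv_congr (X : ∀ x : N, TangentSpace 𝓘(ℝ, E) x) {f g : N → ℝ} {x : N}
    (h : f =ᶠ[𝓝 x] g) : lieDeriv (EP := E) X f x = lieDeriv (EP := E) X g x := by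
  rw [lieDeriv, mvfderiv_congr h]
  rfl

theorem lieDeriv_sum (X : ∀ x : N, TangentSpace 𝓘(ℝ, E) x) {κ : Type*} (s : Finset κ)
    {f : κ → N → ℝ} {x : N} (hf : ∀ i ∈ s, MDifferentiableAt 𝓘(ℝ, E) 𝓘(ℝ, ℝ) (f i) x) :
    lieDeriv (EP := E) X (∑ i ∈ s, f i) x = ∑ i ∈ s, lieDeriv (EP := E) X (f i) x := by
  suffices h : MDifferentiableAt 𝓘(ℝ, E) 𝓘(ℝ, ℝ) (∑ i ∈ s, f i) x ∧
      lieDeriv (EP := E) X (∑ i ∈ s, f i) x = ∑ i ∈ s, lieDeriv (EP := E) X (f i) x from h.2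
  classical
  induction s using Finset.induction_on with
  | empty => exact ⟨mdifferentiableAt_const, lieDeriv_const X 0 x⟩
  | insert i s hi ih =>
    obtain ⟨h1, h2⟩ := ih fun j hj => hf j (Finset.mem_insert_of_mem hj)
    have h3 := hf i (Finset.mem_insert_self i s)
    rw [Finset.sum_insert hi, Finset.sum_insert hi, lieDeriv_add X h3 h1, h2]
    exact ⟨h3.add h1, rfl⟩

theorem lieDeriv_lieDeriv_mul {X Y : ∀ x : N, TangentSpace 𝓘(ℝ, E) x}
    (hY : SmoothFieldOn Y Set.univ) (f g : C2 E N) (x : N) :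
    lieDeriv (EP := E) X (lieDeriv (EP := E) Y (f * g : C2 E N)) x =
      f x * lieDeriv (EP := E) X (lieDeriv (EP := E) Y g) x
      + lieDeriv (EP := E) Y g x * lieDeriv (EP := E) X f x
      + (g x * lieDeriv (EP := E) X (lieDeriv (EP := E) Y f) x
      + lieDeriv (EP := E) Y f x * lieDeriv (EP := E) X g x) := by
  have e : lieDeriv (EP := E) Y (f * g : C2 E N) =
      (f : N → ℝ) * lieDeriv (EP := E) Y g + (g : N → ℝ) * lieDeriv (EP := E) Y f := by
    funext y
    exact lieDeriv_mul Y (f.mdifferentiableAt y) (g.mdifferentiableAt y)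
  have hf := f.mdifferentiableAt x
  have hg := g.mdifferentiableAt x
  have hYf := mdifferentiableAt_lieDeriv hY f x
  have hYg := mdifferentiableAt_lieDeriv hY g x
  rw [e, lieDeriv_add X (hf.mul hYg) (hg.mul hYf), lieDeriv_mul X hf hYg, lieDeriv_mul X hg hYf]

theorem dChart_self (x : N) (v : TangentSpace 𝓘(ℝ, E) x) : dChart (E := E) x x v = v :=
  congrArg (fun L : E →L[ℝ] E => L v) (mfderiv_extChartAt_self (I := 𝓘(ℝ, E)) (x := x))

/-- The second order Lie derivative in the preferred chart. -/
theorem exists_lieDeriv_lieDeriv_coeff {X Y : ∀ x : N, TangentSpace 𝓘(ℝ, E) x}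
    (hY : SmoothFieldOn Y Set.univ) (x : N) : ∃ w : E, ∀ f : C2 E N,
      lieDeriv (EP := E) X (lieDeriv (EP := E) Y f) x =
        fderiv ℝ (fderiv ℝ (inChart f x)) (extChartAt 𝓘(ℝ, E) x x) (X x) (Y x)
        + fderiv ℝ (inChart f x) (extChartAt 𝓘(ℝ, E) x x) w := by
  set q := extChartAt 𝓘(ℝ, E) x with hq
  -- `Z` is the field `Y` in the chart. Differentiating `Df (Z)` along `X x` gives the second
  -- derivative term and the first derivative in the direction `w = DZ (X x)`.
  let Z : E → E := fun z => dChart (E := E) x (q.symm z) (Y (q.symm z))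
  have hZ : ContDiffOn ℝ ∞ Z q.target :=
    ((contMDiffOn_dChart_apply (hY.mono (Set.subset_univ _)) (isOpen_extChartAt_source x)
      subset_rfl).comp (contMDiffOn_extChartAt_symm x) fun z hz => q.map_target hz).contDiffOn
  have hZd : DifferentiableAt ℝ Z (q x) := (hZ.contDiffAt ((isOpen_extChartAt_target x).mem_nhds
    (mem_extChartAt_target x))).differentiableAt (by simp)
  refine ⟨fderiv ℝ Z (q x) (X x), fun f => ?_⟩
  rw [lieDeriv, DiffusionOperator.mvfderiv_eq_inChart (mdifferentiableAt_lieDeriv hY f x)]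
  have e : inChart (lieDeriv (EP := E) Y f) x =ᶠ[𝓝 (q x)] fun z => fderiv ℝ (inChart f x) z (Z z) := by
    filter_upwards [extChartAt_target_mem_nhds (I := 𝓘(ℝ, E)) x] with z hz
    have h1 := chartDeriv_dChart (f.mdifferentiableAt (q.symm z)) (q.map_target hz) (Y (q.symm z))
    refine h1.symm.trans ?_
    simp only [chartDeriv]
    rw [q.right_inv hz]
    rfl
  have hf := DiffusionOperator.contDiffAt_inChart f x
  have hf' : DifferentiableAt ℝ (fderiv ℝ (inChart f x)) (q x) :=
    (hf.fderiv_right (m := 1) (by norm_num)).differentiableAt (by simp)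
  have hZx : Z (q x) = Y x := by
    have h2 : ∀ z, z = x → (dChart (E := E) x z (Y z) : E) = Y x := by
      rintro z rfl; exact dChart_self z (Y z)
    exact h2 _ (extChartAt_to_inv (I := 𝓘(ℝ, E)) x)
  rw [e.fderiv_eq, (hf'.hasFDerivAt.clm_apply hZd.hasFDerivAt).fderiv]
  simp only [add_apply, ContinuousLinearMap.comp_apply, ContinuousLinearMap.flip_apply, hZx]
  exact add_comm _ _

variable {ι : Type*} [Fintype ι]

variable (X : ι → ∀ x : N, TangentSpace 𝓘(ℝ, E) x) (hX : ∀ i, SmoothFieldOn (X i) Set.univ)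
  (α : ι → ι → N → ℝ) (β : ι → N → ℝ)

/-- The linear operator `∑ α i j X_i X_j + ∑ β k X_k` on `C²` functions. -/
def fieldLin : C2 E N →ₗ[ℝ] (N → ℝ) where
  toFun f x := (∑ i, ∑ j, α i j x * lieDeriv (EP := E) (X i) (lieDeriv (EP := E) (X j) f) x)
    + ∑ k, β k x * lieDeriv (EP := E) (X k) f x
  map_add' f g := by
    have e : ∀ k, lieDeriv (EP := E) (X k) (f + g : C2 E N) =
        lieDeriv (EP := E) (X k) f + lieDeriv (EP := E) (X k) g := fun k =>
      funext fun y => lieDeriv_add _ (f.mdifferentiableAt y) (g.mdifferentiableAt y)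
    funext x
    simp only [e, Pi.add_apply, mul_add, Finset.sum_add_distrib,
      lieDeriv_add _ (mdifferentiableAt_lieDeriv (hX _) f x)
        (mdifferentiableAt_lieDeriv (hX _) g x)]
    ring
  map_smul' r f := by
    have e : ∀ k, lieDeriv (EP := E) (X k) (r • f : C2 E N) =
        r • lieDeriv (EP := E) (X k) f := fun k =>
      funext fun y => lieDeriv_const_smul _ r (f.mdifferentiableAt y)
    funext x
    simp only [e, Pi.smul_apply, smul_eq_mul, RingHom.id_apply, mul_add, Finset.mul_sum,
      lieDeriv_const_smul _ r (mdifferentiableAt_lieDeriv (hX _) f x), mul_left_comm _ r]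

/-- Derivations contribute nothing, and a composite `X_i X_j` leaves only its two cross terms.
Symmetry of `α` is not assumed here, so the result appears symmetrised. -/
theorem squareField_fieldLin (f g : C2 E N) (x : N) :
    squareField (fieldLin X hX α β) f g x = 1 / 2 * ∑ i, ∑ j, α i j x *
      (lieDeriv (EP := E) (X i) f x * lieDeriv (EP := E) (X j) g x
        + lieDeriv (EP := E) (X i) g x * lieDeriv (EP := E) (X j) f x) := by
  have e : ∀ k, lieDeriv (EP := E) (X k) (f * g : C2 E N) x =
      f x * lieDeriv (EP := E) (X k) g x + g x * lieDeriv (EP := E) (X k) f x := fun k =>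
    lieDeriv_mul _ (f.mdifferentiableAt x) (g.mdifferentiableAt x)
  have h1 : ∑ k, β k x * lieDeriv (EP := E) (X k) (f * g : C2 E N) x =
      f x * ∑ k, β k x * lieDeriv (EP := E) (X k) g x
        + g x * ∑ k, β k x * lieDeriv (EP := E) (X k) f x := by
    simp only [Finset.mul_sum, ← Finset.sum_add_distrib, e]
    exact Finset.sum_congr rfl fun k _ => by ring
  have h2 : ∑ i, ∑ j, α i j x *
        lieDeriv (EP := E) (X i) (lieDeriv (EP := E) (X j) (f * g : C2 E N)) x =
      f x * ∑ i, ∑ j, α i j x * lieDeriv (EP := E) (X i) (lieDeriv (EP := E) (X j) g) x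
        + g x * ∑ i, ∑ j, α i j x * lieDeriv (EP := E) (X i) (lieDeriv (EP := E) (X j) f) x
        + ∑ i, ∑ j, α i j x * (lieDeriv (EP := E) (X i) f x * lieDeriv (EP := E) (X j) g x
          + lieDeriv (EP := E) (X i) g x * lieDeriv (EP := E) (X j) f x) := by
    simp only [Finset.mul_sum, ← Finset.sum_add_distrib, lieDeriv_lieDeriv_mul (hX _)]
    exact Finset.sum_congr rfl fun i _ => Finset.sum_congr rfl fun j _ => by ring
  simp only [squareField, fieldLin, LinearMap.coe_mk, AddHom.coe_mk, h1, h2]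
  ring

variable (hα : ∀ i j, ContMDiff 𝓘(ℝ, E) 𝓘(ℝ, ℝ) ∞ (α i j))
  (hβ : ∀ k, ContMDiff 𝓘(ℝ, E) 𝓘(ℝ, ℝ) ∞ (β k))
  (hpos : ∀ (x : N) (t : ι → ℝ), 0 ≤ ∑ i, ∑ j, α i j x * (t i * t j))

/-- The diffusion operator `∑ α i j X_i X_j + ∑ β k X_k`. -/
def fieldOperator : DiffusionOperator E N where
  toLin := fieldLin X hX α β
  secondOrder x := by
    choose w hw using fun i j => exists_lieDeriv_lieDeriv_coeff (X := X i) (hX j) x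
    let Y : ι → E := fun i => X i x
    let a : (E →L[ℝ] E →L[ℝ] ℝ) →ₗ[ℝ] ℝ :=
      { toFun := fun S => ∑ i, ∑ j, α i j x * S (Y i) (Y j)
        map_add' := fun S T => by simp [mul_add, Finset.sum_add_distrib]
        map_smul' := fun r S => by simp [Finset.mul_sum, mul_left_comm _ r] }
    -- Besides the drift `β`, the first order part collects the derivatives of `X j` along `X i`,
    -- recorded by `w i j`.
    let b : (E →L[ℝ] ℝ) →ₗ[ℝ] ℝ :=
      { toFun := fun l => (∑ i, ∑ j, α i j x * l (w i j)) + ∑ k, β k x * l (Y k)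
        map_add' := fun S T => by
          simp only [add_apply, mul_add, Finset.sum_add_distrib]
          ring
        map_smul' := fun r S => by simp [mul_add, Finset.mul_sum, mul_left_comm _ r] }
    refine ⟨a, b, 0, fun f => ?_⟩
    simp only [fieldLin, LinearMap.coe_mk, AddHom.coe_mk, hw, a, b, mul_add,
      Finset.sum_add_distrib, zero_mul, add_zero, add_assoc]
    congr 2
    refine Finset.sum_congr rfl fun k _ => ?_
    rw [lieDeriv, DiffusionOperator.mvfderiv_eq_inChart (f.mdifferentiableAt x)]
    rfl
  semiElliptic f x := by
    rw [squareField_fieldLin, Finset.mul_sum]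
    refine (hpos x fun i => lieDeriv (EP := E) (X i) f x).trans_eq
      (Finset.sum_congr rfl fun i _ => ?_)
    rw [Finset.mul_sum]
    exact Finset.sum_congr rfl fun j _ => by ring
  map_const r x := by
    have e : ∀ k, lieDeriv (EP := E) (X k) (ContMDiffMap.const r : C2 E N) = fun _ => 0 := fun k =>
      funext fun y => lieDeriv_const _ r y
    simp only [fieldLin, LinearMap.coe_mk, AddHom.coe_mk, e, lieDeriv_const, mul_zero,
      Finset.sum_const_zero, add_zero]
  smooth f hf := by
    have h1 : ∀ {f : N → ℝ} k, ContMDiff 𝓘(ℝ, E) 𝓘(ℝ, ℝ) ∞ f →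
        ContMDiff 𝓘(ℝ, E) 𝓘(ℝ, ℝ) ∞ (lieDeriv (EP := E) (X k) f) := fun k hf =>
      contMDiff_lieDeriv (n := ∞) (by simp) le_rfl (hX k) hf
    exact (contMDiff_finsetSum fun i _ => contMDiff_finsetSum fun j _ =>
      (hα i j).mul (h1 i (h1 j hf))).add (contMDiff_finsetSum fun k _ => (hβ k).mul (h1 k hf))

theorem fieldOperator_apply (f : C2 E N) (x : N) :
    fieldOperator X hX α β hα hβ hpos f x =
      (∑ i, ∑ j, α i j x * lieDeriv (EP := E) (X i) (lieDeriv (EP := E) (X j) f) x)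
        + ∑ k, β k x * lieDeriv (EP := E) (X k) f x := rfl

variable [FiniteDimensional ℝ E] [T2Space N] (hsymm : ∀ i j x, α i j x = α j i x)

include hsymm in
theorem squareField_fieldOperator (f g : C2 E N) (x : N) :
    squareField (fieldOperator X hX α β hα hβ hpos).toLin f g x = ∑ i, ∑ j, α i j x *
      (lieDeriv (EP := E) (X i) f x * lieDeriv (EP := E) (X j) g x) := by
  refine (squareField_fieldLin X hX α β f g x).trans ?_
  have h : ∑ i, ∑ j, α i j x * (lieDeriv (EP := E) (X i) g x * lieDeriv (EP := E) (X j) f x)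
      = ∑ i, ∑ j, α i j x * (lieDeriv (EP := E) (X i) f x * lieDeriv (EP := E) (X j) g x) := by
    rw [Finset.sum_comm]
    exact Finset.sum_congr rfl fun i _ => Finset.sum_congr rfl fun j _ => by
      rw [hsymm j i, mul_comm (lieDeriv (EP := E) (X j) g x)]
  simp only [mul_add, Finset.sum_add_distrib, h]
  ring

include hsymm in
theorem symbolForm_fieldOperator (x : N) (ξ η : TangentSpace 𝓘(ℝ, E) x →L[ℝ] ℝ) :
    (fieldOperator X hX α β hα hβ hpos).symbolForm x ξ η =
      ∑ i, ∑ j, α i j x * (ξ (X i x) * η (X j x)) := by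
  obtain ⟨f, hf, rfl⟩ := exists_function_of_covector x ξ
  obtain ⟨g, hg, rfl⟩ := exists_function_of_covector x η
  have h := (fieldOperator X hX α β hα hβ hpos).symbolForm_mvfderiv (toC2 f hf) (toC2 g hg) x
  rw [squareField_fieldOperator _ _ _ _ _ _ _ hsymm] at h
  exact h

include hsymm in
-- On `g df` the derivative of `φ (X j) = g X_j f` splits into `g X_i X_j f`, matching `g` times the
-- operator, and `X_i g X_j f`, matching the square field. Symmetry of `α` is what makes the square
-- field have this form.
theorem delta_fieldOperator (φ : OneForm E N) (x : N) :
    (fieldOperator X hX α β hα hβ hpos).delta φ x =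
      (∑ i, ∑ j, α i j x * lieDeriv (EP := E) (X i) (fun y => φ.toFun y (X j y)) x)
        + ∑ k, β k x * φ.toFun x (X k x) := by
  obtain ⟨g, f, hg, hf, he⟩ := φ.exists_eq_sum_d x
  rw [DiffusionOperator.delta_eq_sum_d _ _ hg hf he]
  have hg' := fun l => (hg l).mdifferentiableAt (x := x) (by simp)
  have hf' : ∀ l j, MDifferentiableAt 𝓘(ℝ, E) 𝓘(ℝ, ℝ) (lieDeriv (EP := E) (X j) (f l)) x :=
    fun l j => mdifferentiableAt_lieDeriv (hX j) (toC2 (f l) (hf l)) x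
  have e : ∀ i j, lieDeriv (EP := E) (X i) (fun y => φ.toFun y (X j y)) x =
      ∑ l, (g l x * lieDeriv (EP := E) (X i) (lieDeriv (EP := E) (X j) (f l)) x
        + lieDeriv (EP := E) (X j) (f l) x * lieDeriv (EP := E) (X i) (g l) x) := by
    intro i j
    have e1 : (fun y => φ.toFun y (X j y)) =ᶠ[𝓝 x]
        ∑ l, g l * lieDeriv (EP := E) (X j) (f l) := by
      filter_upwards [he] with y hy
      simp only [hy, sum_apply, smul_apply, smul_eq_mul, Pi.mul_apply, lieDeriv,
        Finset.sum_apply]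
    rw [lieDeriv_congr _ e1, lieDeriv_sum _ _ fun l _ => (hg' l).mul (hf' l j)]
    exact Finset.sum_congr rfl fun l _ => lieDeriv_mul _ (hg' l) (hf' l j)
  have e2 : ∀ k, φ.toFun x (X k x) = ∑ l, g l x * lieDeriv (EP := E) (X k) (f l) x := by
    intro k
    simp only [he.self_of_nhds, sum_apply, smul_apply, smul_eq_mul, lieDeriv]
  have hc : ∀ T : ι → ι → Fin (Module.finrank ℝ E) → ℝ,
      ∑ i, ∑ j, ∑ l, T i j l = ∑ l, ∑ i, ∑ j, T i j l := fun T =>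
    (Finset.sum_congr rfl fun i _ => Finset.sum_comm).trans Finset.sum_comm
  simp only [squareField_fieldOperator _ _ _ _ _ _ _ hsymm, fieldOperator_apply, e, e2,
    Finset.mul_sum, hc]
  rw [Finset.sum_comm (s := (Finset.univ : Finset ι)), ← Finset.sum_add_distrib]
  refine Finset.sum_congr rfl fun l _ => ?_
  rw [mul_add, ← add_assoc, Finset.mul_sum, Finset.mul_sum]
  congr 1
  · rw [← Finset.sum_add_distrib]
    refine Finset.sum_congr rfl fun i _ => ?_
    rw [Finset.mul_sum, ← Finset.sum_add_distrib]
    refine Finset.sum_congr rfl fun j _ => ?_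
    simp only [toC2, ContMDiffMap.coeFn_mk]
    ring
  · refine Finset.sum_congr rfl fun k _ => ?_
    simp only [toC2, ContMDiffMap.coeFn_mk]
    ring

end FieldOperators

/-! ### Forms vanishing on a subbundle, and frames of the image of a symbol. -/

section SymbolFrames

variable {E : Type*} [NormedAddCommGroup E] [NormedSpace ℝ E] [FiniteDimensional ℝ E]
  {N : Type*} [TopologicalSpace N] [ChartedSpace E N] [IsManifold 𝓘(ℝ, E) ∞ N] [T2Space N]

omit [IsManifold 𝓘(ℝ, E) ∞ N] [T2Space N] in
theorem exists_covector_of_notMem {x : N} {S : Submodule ℝ (TangentSpace 𝓘(ℝ, E) x)}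
    {v : TangentSpace 𝓘(ℝ, E) x} (hv : v ∉ S) :
    ∃ ξ : TangentSpace 𝓘(ℝ, E) x →L[ℝ] ℝ, (∀ w ∈ S, ξ w = 0) ∧ ξ v ≠ 0 := by
  let S' : Submodule ℝ E := S
  let v' : E := v
  have hv' : v' ∉ S' := hv
  obtain ⟨f, hf, hS⟩ := Submodule.exists_le_ker_of_notMem hv'
  refine ⟨(LinearMap.toContinuousLinearMap f : E →L[ℝ] ℝ), fun w hw => ?_, hf⟩
  exact hS hw

omit [IsManifold 𝓘(ℝ, E) ∞ N] [T2Space N] in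
theorem eq_of_forall_covector {x : N} {v w : TangentSpace 𝓘(ℝ, E) x}
    (h : ∀ ξ : TangentSpace 𝓘(ℝ, E) x →L[ℝ] ℝ, ξ v = ξ w) : v = w := by
  by_contra hne
  obtain ⟨ξ, -, hξ⟩ := exists_covector_of_notMem (S := ⊥) (v := v - w)
    (fun hm => hne (sub_eq_zero.1 hm))
  exact hξ (by rw [map_sub, h, sub_self])

theorem eq_of_forall_mvfderiv {x : N} {v w : TangentSpace 𝓘(ℝ, E) x}
    (h : ∀ f : N → ℝ, ContMDiff 𝓘(ℝ, E) 𝓘(ℝ, ℝ) ∞ f →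
      mvfderiv 𝓘(ℝ, E) f x v = mvfderiv 𝓘(ℝ, E) f x w) : v = w := by
  refine eq_of_forall_covector fun ξ => ?_
  obtain ⟨f, hf, rfl⟩ := exists_function_of_covector x ξ
  exact h f hf

/-- A covector which vanishes on a smooth subbundle extends to a one-form with this property. -/
theorem exists_form_vanishing {S : ∀ x : N, Submodule ℝ (TangentSpace 𝓘(ℝ, E) x)}
    (hS : IsSmoothSubbundle S) {x : N} (ξ : TangentSpace 𝓘(ℝ, E) x →L[ℝ] ℝ)
    (hξ : ∀ v ∈ S x, ξ v = 0) :
    ∃ φ : OneForm E N, φ.toFun x = ξ ∧ ∀ y, ∀ v ∈ S y, φ.toFun y v = 0 := by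
  obtain ⟨U, hU, k, X, hX, hspan⟩ := hS x
  obtain ⟨V, hVU, hV, hxV⟩ := mem_nhds_iff.1 hU
  have hXV : ∀ i, SmoothFieldOn (X i) V := fun i => (hX i).mono hVU
  obtain ⟨W, l, hW, hxW, hWV, hl, hlX⟩ := exists_dualFrame hV hxV hXV (hspan x (hVU hxV)).1
  obtain ⟨f, hf, rfl⟩ := exists_function_of_covector x ξ
  -- Removing from `df` its components along the frame makes it vanish on `S`. At `x` nothing is
  -- removed, because `ξ` already vanishes on `S x`.
  let ψ : ∀ y : N, TangentSpace 𝓘(ℝ, E) y →L[ℝ] ℝ := fun y =>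
    mvfderiv 𝓘(ℝ, E) f y - ∑ i, mvfderiv 𝓘(ℝ, E) f y (X i y) • l i y
  have hf' : SmoothFormOn (mvfderiv 𝓘(ℝ, E) f) W := smoothFormOn_mvfderiv hW hf.contMDiffOn
  have hψ : SmoothFormOn ψ W := hf'.sub (SmoothFormOn.sum _ fun i _ =>
    SmoothFormOn.smul (hf'.apply ((hXV i).mono hWV)) (hl i))
  have hψS : ∀ y ∈ W, ∀ v ∈ S y, ψ y v = 0 := by
    intro y hy v hv
    rw [← (hspan y (hVU (hWV hy))).2] at hv
    induction hv using Submodule.span_induction with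
    | mem v hv =>
      obtain ⟨j, rfl⟩ := hv
      simp [ψ, hlX y hy, sum_apply]
    | zero => exact map_zero _
    | add v w _ _ h1 h2 => rw [map_add, h1, h2, add_zero]
    | smul r v _ h1 => rw [map_smul, h1, smul_zero]
  obtain ⟨φ, χ, hφ, h1, h0⟩ := exists_global_form hW hxW hψ
  refine ⟨φ, ?_, fun y v hv => ?_⟩
  · rw [hφ, h1.self_of_nhds, Pi.one_apply, one_smul]
    have h2 : ∀ i, mvfderiv 𝓘(ℝ, E) f x (X i x) = 0 := fun i => hξ _ (by
      rw [← (hspan x (hVU hxV)).2]; exact Submodule.subset_span ⟨i, rfl⟩)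
    simp [ψ, h2]
  · rw [hφ]
    by_cases hy : y ∈ W
    · rw [smul_apply, hψS y hy v hv, smul_zero]
    · rw [h0 y hy, zero_smul, zero_apply]

/-- The symbol of an operator along a smooth subbundle takes values in this subbundle. -/
theorem DiffusionOperator.IsAlong.symbol_mem {L : DiffusionOperator E N}
    {S : ∀ x : N, Submodule ℝ (TangentSpace 𝓘(ℝ, E) x)} (hL : L.IsAlong S)
    (hS : IsSmoothSubbundle S) (x : N) (ξ : TangentSpace 𝓘(ℝ, E) x →L[ℝ] ℝ) :
    L.symbol x ξ ∈ S x := by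
  by_contra hv
  -- A covector separating the value of the symbol from `S x` extends to a form vanishing on `S`;
  -- the symbol kills such a form, and symmetry of the symbol gives the contradiction.
  obtain ⟨η, hη, hne⟩ := exists_covector_of_notMem hv
  obtain ⟨φ, rfl, hφ⟩ := exists_form_vanishing hS η hη
  rw [L.apply_symbol] at hne
  exact hne ((L.symbolForm_symm x ξ _).trans (hL.symbolForm_eq_zero hφ x ξ))

/-- If the symbol has constant rank, then its image has a local frame of the form `σ (d f i)`, and
this frame has a smooth dual system. -/
theorem DiffusionOperator.exists_symbol_frame {A : DiffusionOperator E N} {p : ℕ}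
    (hp : ∀ x : N, Module.finrank ℝ (A.symbolRange x) = p) (x : N) :
    ∃ (W : Set N) (f : Fin p → N → ℝ) (l : Fin p → ∀ y : N, TangentSpace 𝓘(ℝ, E) y →L[ℝ] ℝ),
      IsOpen W ∧ x ∈ W ∧ (∀ i, ContMDiff 𝓘(ℝ, E) 𝓘(ℝ, ℝ) ∞ (f i)) ∧ (∀ i, SmoothFormOn (l i) W) ∧
      (∀ y ∈ W, ∀ i j, l i y (A.symbol y (mvfderiv 𝓘(ℝ, E) (f j) y)) = if i = j then 1 else 0) ∧
      ∀ y ∈ W, ∀ v ∈ A.symbolRange y,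
        v = ∑ i, l i y v • A.symbol y (mvfderiv 𝓘(ℝ, E) (f i) y) := by
  have hfd : FiniteDimensional ℝ (TangentSpace 𝓘(ℝ, E) x) := inferInstanceAs (FiniteDimensional ℝ E)
  let b := Module.finBasisOfFinrankEq ℝ (A.symbolRange x) (hp x)
  choose ξ hξ using fun i => (b i).2
  choose f hf hfξ using fun i => exists_function_of_covector x (ξ i)
  have hX : ∀ i, SmoothFieldOn (fun y => A.symbol y (mvfderiv 𝓘(ℝ, E) (f i) y)) Set.univ :=
    fun i => A.smoothFieldOn_symbol (.d (f i) (hf i)) _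
  have hli : LinearIndependent ℝ fun i => A.symbol x (mvfderiv 𝓘(ℝ, E) (f i) x) := by
    have h1 : (fun i => A.symbol x (mvfderiv 𝓘(ℝ, E) (f i) x)) = fun i => (b i : TangentSpace 𝓘(ℝ, E) x) := by
      funext i
      rw [hfξ, hξ]
    rw [h1]
    exact b.linearIndependent.map' (A.symbolRange x).subtype (Submodule.ker_subtype _)
  obtain ⟨W, l, hW, hxW, -, hl, hlX⟩ := exists_dualFrame isOpen_univ (Set.mem_univ x) hX hli
  refine ⟨W, f, l, hW, hxW, hf, hl, hlX, fun y hy v hv => ?_⟩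
  have hfdy : FiniteDimensional ℝ (TangentSpace 𝓘(ℝ, E) y) := inferInstanceAs (FiniteDimensional ℝ E)
  have hliy : LinearIndependent ℝ fun i => A.symbol y (mvfderiv 𝓘(ℝ, E) (f i) y) := by
    rw [Fintype.linearIndependent_iff]
    intro t ht j
    have h2 := congrArg (l j y) ht
    simpa [map_sum, hlX y hy] using h2
  -- The dual system shows that the `p` fields stay independent near `x`. Constant rank then makes
  -- them span the image at every such point.
  have hspan : Submodule.span ℝ (Set.range fun i => A.symbol y (mvfderiv 𝓘(ℝ, E) (f i) y)) =
      A.symbolRange y := by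
    refine Submodule.eq_of_le_of_finrank_eq ?_ ?_
    · rw [Submodule.span_le]
      rintro _ ⟨i, rfl⟩
      exact ⟨_, rfl⟩
    · rw [finrank_span_eq_card hliy, hp, Fintype.card_fin]
  rw [← hspan] at hv
  obtain ⟨t, rfl⟩ := (Submodule.mem_span_range_iff_exists_fun ℝ).1 hv
  refine Finset.sum_congr rfl fun i _ => ?_
  simp [map_sum, hlX y hy]

end SymbolFrames

/-! ### The semi-connection defined by the symbol, and its uniqueness. -/

section Lifts

variable {EM : Type*} [NormedAddCommGroup EM] [NormedSpace ℝ EM] [FiniteDimensional ℝ EM]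
  {M : Type*} [TopologicalSpace M] [ChartedSpace EM M] [IsManifold 𝓘(ℝ, EM) ∞ M] [T2Space M]
  {EG : Type*} [NormedAddCommGroup EG] [NormedSpace ℝ EG]
  {G : Type*} [TopologicalSpace G] [ChartedSpace EG G] [Group G]
  {EP : Type*} [NormedAddCommGroup EP] [NormedSpace ℝ EP] [FiniteDimensional ℝ EP]
  {P : Type*} [TopologicalSpace P] [ChartedSpace EP P] [IsManifold 𝓘(ℝ, EP) ∞ P] [T2Space P]
  [MulAction Gᵐᵒᵖ P] {π : P → M}

namespace IsPrincipalBundle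

variable (hπ : IsPrincipalBundle EM EG G EP π)
include hπ

theorem mdifferentiableAt_proj (u : P) : MDifferentiableAt 𝓘(ℝ, EP) 𝓘(ℝ, EM) π u :=
  hπ.smooth_proj.mdifferentiableAt (by simp)

theorem contMDiff_comp_proj {f : M → ℝ} (hf : ContMDiff 𝓘(ℝ, EM) 𝓘(ℝ, ℝ) ∞ f) :
    ContMDiff 𝓘(ℝ, EP) 𝓘(ℝ, ℝ) ∞ (f ∘ π) := hf.comp hπ.smooth_proj

theorem mvfderiv_comp_proj {f : M → ℝ} (hf : ContMDiff 𝓘(ℝ, EM) 𝓘(ℝ, ℝ) ∞ f) (u : P) :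
    mvfderiv 𝓘(ℝ, EP) (f ∘ π) u =
      (mvfderiv 𝓘(ℝ, EM) f (π u)).comp (mfderiv 𝓘(ℝ, EP) 𝓘(ℝ, EM) π u) :=
  mvfderiv_comp u (hf.mdifferentiableAt (by simp)) (hπ.mdifferentiableAt_proj u)

/-- The pullback of a one-form on the base. -/
def pullback (ψ : OneForm EM M) : OneForm EP P :=
  .mk' (fun u => (ψ.toFun (π u)).comp (mfderiv 𝓘(ℝ, EP) 𝓘(ℝ, EM) π u))
    ((ψ.smoothFormOn Set.univ).pullback isOpen_univ hπ.smooth_proj.contMDiffOn fun _ _ => trivial)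

variable {A : DiffusionOperator EM M} {L : DiffusionOperator EP P}

theorem squareField_lift (hL : hπ.IsLift A L) (f g : C2 EM M) (u : P) :
    squareField L.toLin (f.comp hπ.proj) (g.comp hπ.proj) u = squareField A.toLin f g (π u) := by
  have h1 := hL (f * g) u
  have h2 := hL f u
  have h3 := hL g u
  have h4 : (f * g).comp hπ.proj = f.comp hπ.proj * g.comp hπ.proj := rfl
  rw [h4] at h1
  simp only [squareField, h1, h2, h3]
  rfl

theorem symbolForm_lift (hL : hπ.IsLift A L) (u : P)
    (ξ η : TangentSpace 𝓘(ℝ, EM) (π u) →L[ℝ] ℝ) :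
    L.symbolForm u (ξ.comp (mfderiv 𝓘(ℝ, EP) 𝓘(ℝ, EM) π u))
      (η.comp (mfderiv 𝓘(ℝ, EP) 𝓘(ℝ, EM) π u)) = A.symbolForm (π u) ξ η := by
  obtain ⟨f, hf, rfl⟩ := exists_function_of_covector (π u) ξ
  obtain ⟨g, hg, rfl⟩ := exists_function_of_covector (π u) η
  have h1 := L.symbolForm_mvfderiv (toC2 (f ∘ π) (hπ.contMDiff_comp_proj hf))
    (toC2 (g ∘ π) (hπ.contMDiff_comp_proj hg)) u
  have h2 := A.symbolForm_mvfderiv (toC2 f hf) (toC2 g hg) (π u)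
  refine (congrArg₂ (fun ξ η : TangentSpace 𝓘(ℝ, EP) u →L[ℝ] ℝ => L.symbolForm u ξ η)
    (hπ.mvfderiv_comp_proj hf u).symm (hπ.mvfderiv_comp_proj hg u).symm).trans ?_
  exact h1.trans ((hπ.squareField_lift hL (toC2 f hf) (toC2 g hg) u).trans h2.symm)

/-- Locally `ψ = ∑ g i • d(f i)`, and the pullback replaces `g i` and `f i` by their composites with
`π`, on which `L` and its square field agree with those of `A`. -/
theorem delta_lift (hL : hπ.IsLift A L) (ψ : OneForm EM M) (u : P) :
    L.delta (hπ.pullback ψ) u = A.delta ψ (π u) := by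
  obtain ⟨g, f, hg, hf, he⟩ := ψ.exists_eq_sum_d (π u)
  rw [A.delta_eq_sum_d _ hg hf he, L.delta_eq_sum_d Finset.univ
    (fun i => hπ.contMDiff_comp_proj (hg i)) (fun i => hπ.contMDiff_comp_proj (hf i))]
  · refine Finset.sum_congr rfl fun i _ => ?_
    exact congrArg₂ (· + ·) (hπ.squareField_lift hL (toC2 (g i) (hg i)) (toC2 (f i) (hf i)) u)
      (congrArg (g i (π u) * ·) (hL (toC2 (f i) (hf i)) u))
  · filter_upwards [hπ.smooth_proj.continuous.continuousAt.eventually he] with v hv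
    ext w
    simp only [pullback, OneForm.mk', hv, ContinuousLinearMap.comp_apply, sum_apply, smul_apply,
      hπ.mvfderiv_comp_proj (hf _), Function.comp_apply]

/-- `T π (σ^L (π^* ξ)) = σ^A ξ` for a lift `L` of `A`. -/
theorem mfderiv_symbol_lift (hL : hπ.IsLift A L) (u : P)
    (ξ : TangentSpace 𝓘(ℝ, EM) (π u) →L[ℝ] ℝ) :
    mfderiv 𝓘(ℝ, EP) 𝓘(ℝ, EM) π u (L.symbol u (ξ.comp (mfderiv 𝓘(ℝ, EP) 𝓘(ℝ, EM) π u)))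
      = A.symbol (π u) ξ := by
  refine eq_of_forall_covector fun η => ?_
  rw [A.apply_symbol]
  exact (L.apply_symbol u _ (η.comp (mfderiv 𝓘(ℝ, EP) 𝓘(ℝ, EM) π u))).trans
    (hπ.symbolForm_lift hL u ξ η)

end IsPrincipalBundle

/-- The image under `σ^L` of the covectors pulled back from the base. -/
def liftedSpace (EM : Type*) [NormedAddCommGroup EM] [NormedSpace ℝ EM] {M : Type*}
    [TopologicalSpace M] [ChartedSpace EM M] (L : DiffusionOperator EP P) (π : P → M) (u : P) :
    Submodule ℝ (TangentSpace 𝓘(ℝ, EP) u) :=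
  LinearMap.range (L.symbol u ∘ₗ
    { toFun := fun ξ : TangentSpace 𝓘(ℝ, EM) (π u) →L[ℝ] ℝ =>
        ξ.comp (mfderiv 𝓘(ℝ, EP) 𝓘(ℝ, EM) π u)
      map_add' := fun _ _ => rfl
      map_smul' := fun _ _ => rfl })

namespace IsPrincipalBundle

variable (hπ : IsPrincipalBundle EM EG G EP π) {A : DiffusionOperator EM M}
  {L : DiffusionOperator EP P}
include hπ

theorem mem_liftedSpace {u : P} {v : TangentSpace 𝓘(ℝ, EP) u} : v ∈ liftedSpace EM L π u ↔
    ∃ f : M → ℝ, ContMDiff 𝓘(ℝ, EM) 𝓘(ℝ, ℝ) ∞ f ∧ L.symbol u (mvfderiv 𝓘(ℝ, EP) (f ∘ π) u) = v := by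
  constructor
  · rintro ⟨ξ, rfl⟩
    obtain ⟨f, hf, rfl⟩ := exists_function_of_covector (π u) ξ
    exact ⟨f, hf, by rw [hπ.mvfderiv_comp_proj hf]; rfl⟩
  · rintro ⟨f, hf, rfl⟩
    exact ⟨mvfderiv 𝓘(ℝ, EM) f (π u), by rw [hπ.mvfderiv_comp_proj hf]; rfl⟩

/-- Surjectivity is `Tπ (σ^L (π^*ξ)) = σ^A ξ`. For injectivity, `σ^A ξ = 0` makes `π^*ξ` a null
vector of the semidefinite form `σ^L`, hence an element of its kernel. -/
theorem bijOn_liftedSpace (hL : hπ.IsLift A L) (u : P) :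
    Set.BijOn (mfderiv 𝓘(ℝ, EP) 𝓘(ℝ, EM) π u) (liftedSpace EM L π u) (A.symbolRange (π u)) := by
  refine ⟨?_, ?_, ?_⟩
  · rintro _ ⟨ξ, rfl⟩
    exact ⟨ξ, (hπ.mfderiv_symbol_lift hL u ξ).symm⟩
  · have key : ∀ v ∈ liftedSpace EM L π u, mfderiv 𝓘(ℝ, EP) 𝓘(ℝ, EM) π u v = 0 → v = 0 := by
      rintro _ ⟨ξ, rfl⟩ h0
      have h1 : A.symbol (π u) ξ = 0 := (hπ.mfderiv_symbol_lift hL u ξ).symm.trans h0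
      have h2 : L.symbolForm u (ξ.comp (mfderiv 𝓘(ℝ, EP) 𝓘(ℝ, EM) π u))
          (ξ.comp (mfderiv 𝓘(ℝ, EP) 𝓘(ℝ, EM) π u)) = 0 := by
        refine (hπ.symbolForm_lift hL u ξ ξ).trans ((A.apply_symbol _ _ _).symm.trans ?_)
        rw [h1, map_zero]
      refine eq_of_forall_covector fun η => ?_
      rw [map_zero]
      exact (L.apply_symbol u _ η).trans (L.symbolForm_eq_zero h2 η)
    intro v hv w hw hvw
    refine sub_eq_zero.1 (key _ (Submodule.sub_mem _ hv hw) ?_)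
    rw [map_sub]
    exact sub_eq_zero.2 hvw
  · rintro _ ⟨ξ, rfl⟩
    exact ⟨_, ⟨ξ, rfl⟩, hπ.mfderiv_symbol_lift hL u ξ⟩

theorem proj_right (u : P) (a : G) : π (u <• a) = π u := ((hπ.orbit_iff u _).2 ⟨a, rfl⟩).symm

/-- Tested against `dg`, both sides are square fields, of `g ∘ R_a` with `f ∘ π` at `u` and of `g`
with `f ∘ π` at `u • a`. They agree by equivariance, since `f ∘ π` is invariant under `R_a`. -/
theorem mfderiv_right_symbol (hL : hπ.IsEquivariant L) (u : P) (a : G) {f : M → ℝ}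
    (hf : ContMDiff 𝓘(ℝ, EM) 𝓘(ℝ, ℝ) ∞ f) :
    mfderiv 𝓘(ℝ, EP) 𝓘(ℝ, EP) (fun v : P => v <• a) u
        (L.symbol u (mvfderiv 𝓘(ℝ, EP) (f ∘ π) u))
      = L.symbol (u <• a) (mvfderiv 𝓘(ℝ, EP) (f ∘ π) (u <• a)) := by
  refine eq_of_forall_mvfderiv fun g hg => ?_
  have hR := hπ.smooth_right a
  have h1 := mvfderiv_comp_mfderiv (hg.mdifferentiableAt (by simp))
    (hR.mdifferentiableAt (x := u) (by simp)) (L.symbol u (mvfderiv 𝓘(ℝ, EP) (f ∘ π) u))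
  rw [← h1]
  have hfπ := hπ.contMDiff_comp_proj hf
  have h2 := L.symbol_spec (toC2 (g ∘ fun v : P => v <• a) (hg.comp hR)) (toC2 (f ∘ π) hfπ) u
  have h3 := L.symbol_spec (toC2 g hg) (toC2 (f ∘ π) hfπ) (u <• a)
  refine h2.trans (Eq.trans ?_ h3.symm)
  have e : toC2 (f ∘ π) hfπ = (toC2 (f ∘ π) hfπ).comp (hπ.right a) :=
    DFunLike.ext _ _ fun w => congrArg f (hπ.proj_right w a).symm
  simp only [squareField]
  rw [hL a (toC2 g hg), hL a (toC2 (f ∘ π) hfπ), hL a (toC2 g hg * toC2 (f ∘ π) hfπ)]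
  have e2 : (toC2 g hg * toC2 (f ∘ π) hfπ).comp (hπ.right a) =
      (toC2 g hg).comp (hπ.right a) * (toC2 (f ∘ π) hfπ).comp (hπ.right a) := rfl
  rw [e2, ← e]
  have e3 : toC2 (f ∘ π) hfπ (u <• a) = toC2 (f ∘ π) hfπ u := congrArg f (hπ.proj_right u a)
  rw [e3]
  rfl

theorem map_right_liftedSpace (hL : hπ.IsEquivariant L) (u : P) (a : G) :
    (liftedSpace EM L π u).map
      (mfderiv 𝓘(ℝ, EP) 𝓘(ℝ, EP) (fun v : P => v <• a) u).toLinearMap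
      = liftedSpace EM L π (u <• a) := by
  ext v
  rw [Submodule.mem_map, hπ.mem_liftedSpace]
  constructor
  · rintro ⟨w, hw, rfl⟩
    obtain ⟨f, hf, rfl⟩ := hπ.mem_liftedSpace.1 hw
    exact ⟨f, hf, (hπ.mfderiv_right_symbol hL u a hf).symm⟩
  · rintro ⟨f, hf, rfl⟩
    exact ⟨_, hπ.mem_liftedSpace.2 ⟨f, hf, rfl⟩, hπ.mfderiv_right_symbol hL u a hf⟩

theorem mfderiv_symbol_comp_proj (hL : hπ.IsLift A L) (u : P) {f : M → ℝ}
    (hf : ContMDiff 𝓘(ℝ, EM) 𝓘(ℝ, ℝ) ∞ f) :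
    mfderiv 𝓘(ℝ, EP) 𝓘(ℝ, EM) π u (L.symbol u (mvfderiv 𝓘(ℝ, EP) (f ∘ π) u))
      = A.symbol (π u) (mvfderiv 𝓘(ℝ, EM) f (π u)) := by
  rw [hπ.mvfderiv_comp_proj hf]
  exact hπ.mfderiv_symbol_lift hL u _

/-- Both sides lie in the lifted space and have the same projection, where `Tπ` is injective. So a
frame of the image of `σ^A` lifts to a frame upstairs with the same coefficients. -/
theorem eq_sum_of_mem_liftedSpace (hL : hπ.IsLift A L) {κ : Type*} [Fintype κ] {u : P}
    {f : κ → M → ℝ} (hf : ∀ i, ContMDiff 𝓘(ℝ, EM) 𝓘(ℝ, ℝ) ∞ (f i))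
    {l : κ → TangentSpace 𝓘(ℝ, EM) (π u) →L[ℝ] ℝ}
    (hl : ∀ v ∈ A.symbolRange (π u), v = ∑ i, l i v • A.symbol (π u) (mvfderiv 𝓘(ℝ, EM) (f i) (π u)))
    {v : TangentSpace 𝓘(ℝ, EP) u} (hv : v ∈ liftedSpace EM L π u) :
    v = ∑ i, l i (mfderiv 𝓘(ℝ, EP) 𝓘(ℝ, EM) π u v) •
      L.symbol u (mvfderiv 𝓘(ℝ, EP) (f i ∘ π) u) := by
  refine (hπ.bijOn_liftedSpace hL u).injOn hv (Submodule.sum_mem _ fun i _ =>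
    Submodule.smul_mem _ _ (hπ.mem_liftedSpace.2 ⟨f i, hf i, rfl⟩)) ?_
  rw [map_sum]
  simp only [map_smul, hπ.mfderiv_symbol_comp_proj hL u (hf _)]
  exact hl _ ((hπ.bijOn_liftedSpace hL u).mapsTo hv)

theorem isSmoothSubbundle_liftedSpace (hL : hπ.IsLift A L) {p : ℕ}
    (hp : ∀ x : M, Module.finrank ℝ (A.symbolRange x) = p) :
    IsSmoothSubbundle (liftedSpace EM L π) := by
  intro u₀
  obtain ⟨W, f, l, hW, hxW, hf, -, hlX, hsp⟩ := A.exists_symbol_frame hp (π u₀)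
  have hmem : ∀ u i, L.symbol u (mvfderiv 𝓘(ℝ, EP) (f i ∘ π) u) ∈ liftedSpace EM L π u :=
    fun u i => hπ.mem_liftedSpace.2 ⟨f i, hf i, rfl⟩
  refine ⟨π ⁻¹' W, (hW.preimage hπ.smooth_proj.continuous).mem_nhds hxW, p,
    fun i u => L.symbol u (mvfderiv 𝓘(ℝ, EP) (f i ∘ π) u), fun i =>
    L.smoothFieldOn_symbol (.d (f i ∘ π) (hπ.contMDiff_comp_proj (hf i))) _, fun u hu => ⟨?_, ?_⟩⟩
  · rw [Fintype.linearIndependent_iff]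
    intro t ht j
    have h1 := congrArg (fun v => l j (π u) (mfderiv 𝓘(ℝ, EP) 𝓘(ℝ, EM) π u v)) ht
    simp only [map_sum, map_smul, hπ.mfderiv_symbol_comp_proj hL u (hf _), hlX _ hu, map_zero] at h1
    simpa using h1
  · refine le_antisymm (Submodule.span_le.2 ?_) fun v hv => ?_
    · rintro _ ⟨i, rfl⟩
      exact hmem u i
    · rw [hπ.eq_sum_of_mem_liftedSpace hL hf (hsp _ hu) hv]
      exact Submodule.sum_mem _ fun i _ => Submodule.smul_mem _ _ (Submodule.subset_span ⟨i, rfl⟩)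

theorem isSemiConnection_liftedSpace (hL : hπ.IsLift A L) (hL' : hπ.IsEquivariant L) {p : ℕ}
    (hp : ∀ x : M, Module.finrank ℝ (A.symbolRange x) = p) :
    IsSemiConnection G π A.symbolRange (liftedSpace EM L π) where
  smooth := hπ.isSmoothSubbundle_liftedSpace hL hp
  bijOn := hπ.bijOn_liftedSpace hL
  map_right := hπ.map_right_liftedSpace hL'

/-- On `d(f ∘ π)`, which vanishes on vertical vectors, the symbol of `BV` is zero, so the symbol of
`L` is that of `AH` and lies in `H`. Of two nested subspaces that project bijectively onto the same
space, neither is larger. -/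
theorem eq_liftedSpace (hL : hπ.IsLift A L) {H : ∀ u : P, Submodule ℝ (TangentSpace 𝓘(ℝ, EP) u)}
    (hH : IsSemiConnection G π A.symbolRange H) {AH BV : DiffusionOperator EP P}
    (hd : IsDecomposition EM π H L AH BV) : H = liftedSpace EM L π := by
  have hle : ∀ u, liftedSpace EM L π u ≤ H u := by
    intro u v hv
    obtain ⟨f, hf, rfl⟩ := hπ.mem_liftedSpace.1 hv
    have h1 : L.symbol u (mvfderiv 𝓘(ℝ, EP) (f ∘ π) u) =
        AH.symbol u (mvfderiv 𝓘(ℝ, EP) (f ∘ π) u) := by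
      refine eq_of_forall_covector fun η => ?_
      rw [L.apply_symbol, AH.apply_symbol, DiffusionOperator.symbolForm_of_add hd.sum_eq]
      have h2 := hd.vertical.symbolForm_eq_zero (φ := .d (f ∘ π) (hπ.contMDiff_comp_proj hf))
        (fun w v hv => by
          have h3 : mfderiv 𝓘(ℝ, EP) 𝓘(ℝ, EM) π w v = 0 := hv
          change mvfderiv 𝓘(ℝ, EP) (f ∘ π) w v = 0
          rw [hπ.mvfderiv_comp_proj hf, ContinuousLinearMap.comp_apply, h3, map_zero]) u η
      exact (congrArg _ h2).trans (add_zero _)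
    rw [h1]
    exact hd.horizontal.symbol_mem hH.smooth u _
  funext u
  refine le_antisymm (fun v hv => ?_) (hle u)
  obtain ⟨w, hw, hwv⟩ := (hπ.bijOn_liftedSpace hL u).surjOn ((hH.bijOn u).mapsTo hv)
  rwa [← (hH.bijOn u).injOn (hle u hw) hv hwv]

end IsPrincipalBundle

end Lifts

/-! ### Derivatives in one variable of a product, with smooth parameters. -/

section PartialDerivatives

variable {EQ : Type*} [NormedAddCommGroup EQ] [NormedSpace ℝ EQ] {HQ : Type*} [TopologicalSpace HQ]
  {IQ : ModelWithCorners ℝ EQ HQ} {Q : Type*} [TopologicalSpace Q] [ChartedSpace HQ Q]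
  {E₁ : Type*} [NormedAddCommGroup E₁] [NormedSpace ℝ E₁]
  {N₁ : Type*} [TopologicalSpace N₁] [ChartedSpace E₁ N₁] [IsManifold 𝓘(ℝ, E₁) ∞ N₁]
  {E₂ : Type*} [NormedAddCommGroup E₂] [NormedSpace ℝ E₂]
  {N₂ : Type*} [TopologicalSpace N₂] [ChartedSpace E₂ N₂] [IsManifold 𝓘(ℝ, E₂) ∞ N₂]

/-- Smoothness of a partial derivative of a function on a product. -/
theorem contMDiffOn_partial {O : Set (N₁ × N₂)} (hO : IsOpen O) {Λ : N₁ × N₂ → ℝ}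
    (hΛ : ContMDiffOn (𝓘(ℝ, E₁).prod 𝓘(ℝ, E₂)) 𝓘(ℝ, ℝ) ∞ Λ O) {S : Set Q} {c : Q → N₁}
    (hc : ContMDiffOn IQ 𝓘(ℝ, E₁) ∞ c S) {w : Q → TangentBundle 𝓘(ℝ, E₂) N₂}
    (hw : ContMDiffOn IQ 𝓘(ℝ, E₂).tangent ∞ w S) (hS : ∀ t ∈ S, (c t, (w t).1) ∈ O) :
    ContMDiffOn IQ 𝓘(ℝ, ℝ) ∞
      (fun t => mvfderiv 𝓘(ℝ, E₂) (fun y => Λ (c t, y)) (w t).1 (w t).2) S := by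
  -- The partial derivative is the tangent map of `Λ` evaluated at the tangent vector `(0, w t)` of
  -- the product.
  have h0 : ContMDiffOn IQ 𝓘(ℝ, E₁).tangent ∞
      (fun t => Bundle.zeroSection E₁ (TangentSpace 𝓘(ℝ, E₁)) (c t)) S :=
    (Bundle.contMDiff_zeroSection ℝ (TangentSpace 𝓘(ℝ, E₁) : N₁ → Type _)).comp_contMDiffOn hc
  have h1 : ContMDiffOn IQ (𝓘(ℝ, E₁).prod 𝓘(ℝ, E₂)).tangent ∞ (fun t =>
      (equivTangentBundleProd 𝓘(ℝ, E₁) N₁ 𝓘(ℝ, E₂) N₂).symm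
        (Bundle.zeroSection E₁ (TangentSpace 𝓘(ℝ, E₁)) (c t), w t)) S :=
    contMDiff_equivTangentBundleProd_symm.comp_contMDiffOn (h0.prodMk hw)
  have h2 := hΛ.contMDiffOn_tangentMapWithin (m := ∞) (by simp) hO.uniqueMDiffOn
  have h3 := (contMDiff_snd_tangentBundle_modelSpace ℝ 𝓘(ℝ, ℝ)).comp_contMDiffOn
    (h2.comp h1 fun t ht => hS t ht)
  refine h3.congr fun t ht => ?_
  have hd : MDifferentiableAt (𝓘(ℝ, E₁).prod 𝓘(ℝ, E₂)) 𝓘(ℝ, ℝ) Λ (c t, (w t).1) :=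
    (hΛ.contMDiffAt (hO.mem_nhds (hS t ht))).mdifferentiableAt (by simp)
  have h4 := mfderiv_comp_apply (I := 𝓘(ℝ, E₂)) (I' := 𝓘(ℝ, E₁).prod 𝓘(ℝ, E₂)) (f := fun y : N₂ => (c t, y)) (w t).1 hd
    (mdifferentiableAt_const.prodMk mdifferentiableAt_id) (w t).2
  refine h4.trans ?_
  rw [mfderiv_prod_right]
  simp only [Function.comp, tangentMapWithin]
  exact congrArg (fun L : E₁ × E₂ →L[ℝ] ℝ => L (0, (w t).2))
    (mfderivWithin_of_isOpen (I := 𝓘(ℝ, E₁).prod 𝓘(ℝ, E₂)) (I' := 𝓘(ℝ, ℝ)) (f := Λ) hO (hS t ht)).symm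

end PartialDerivatives

/-! ### Local sections, gauges and the pulled back Maurer–Cartan form. -/

section Gauges

variable {EM : Type*} [NormedAddCommGroup EM] [NormedSpace ℝ EM]
  {M : Type*} [TopologicalSpace M] [ChartedSpace EM M]
  {EG : Type*} [NormedAddCommGroup EG] [NormedSpace ℝ EG]
  {G : Type*} [TopologicalSpace G] [ChartedSpace EG G] [Group G]
  {EP : Type*} [NormedAddCommGroup EP] [NormedSpace ℝ EP]
  {P : Type*} [TopologicalSpace P] [ChartedSpace EP P]
  [MulAction Gᵐᵒᵖ P] {π : P → M}

variable (EM EG EP) in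
/-- Over `U` the principal bundle has the smooth section `s`, and `γ` gives the position of a point
relative to this section. -/
structure IsGauge (π : P → M) (U : Set M) (γ : P → G) (s : M → P) : Prop where
  isOpen : IsOpen U
  smooth_gauge : ContMDiffOn 𝓘(ℝ, EP) 𝓘(ℝ, EG) ∞ γ (π ⁻¹' U)
  smooth_section : ContMDiffOn 𝓘(ℝ, EM) 𝓘(ℝ, EP) ∞ s U
  gauge_right : ∀ u ∈ π ⁻¹' U, ∀ a : G, γ (u <• a) = γ u * a
  section_right : ∀ u ∈ π ⁻¹' U, s (π u) <• γ u = u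

theorem right_right (u : P) (a b : G) : (u <• a) <• b = u <• (a * b) := by
  rw [smul_smul, ← MulOpposite.op_mul]

theorem right_one (u : P) : u <• (1 : G) = u := by
  rw [MulOpposite.op_one, one_smul]

theorem IsPrincipalBundle.exists_gauge (hπ : IsPrincipalBundle EM EG G EP π) (x : M) :
    ∃ (U : Set M) (γ : P → G) (s : M → P), x ∈ U ∧ IsGauge EM EG EP π U γ s := by
  obtain ⟨U, τ, hU, hx, hs, ht, hτ, hτs, hloc⟩ := hπ.locallyTrivial x
  have hmem : ∀ y ∈ U, (y, (1 : G)) ∈ τ.target := fun y hy => by simp [ht, hy]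
  refine ⟨U, fun u => (τ u).2, fun y => τ.symm (y, 1), hx, hU, ?_, ?_, ?_, ?_⟩
  · rw [← hs]
    exact contMDiff_snd.comp_contMDiffOn hτ
  · exact hτs.comp (contMDiff_id.prodMk contMDiff_const).contMDiffOn hmem
  · intro u hu a
    rw [← hs] at hu
    rw [(hloc u hu).2 a]
  · intro u hu
    have hm := hmem _ hu
    have h1 := (hloc _ (τ.map_target hm)).2 (τ u).2
    have hsrc : τ.symm (π u, (1 : G)) ∈ τ.source := τ.map_target hm
    have h2 : π (τ.symm (π u, (1 : G))) = π u := by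
      rw [← (hloc _ hsrc).1, τ.right_inv hm]
    rw [τ.right_inv hm, one_mul, h2] at h1
    rw [← hs] at hu
    refine τ.injOn ?_ hu ?_
    · rw [hs] at hsrc ⊢
      change π _ ∈ U
      rw [← (hπ.orbit_iff _ _).2 ⟨(τ u).2, rfl⟩]
      exact hsrc
    · rw [h1, ← (hloc u hu).1]

/-- The pullback of the Maurer-Cartan form under a gauge. -/
def gaugeForm (γ : P → G) (u : P) : TangentSpace 𝓘(ℝ, EP) u →L[ℝ] GroupLieAlgebra 𝓘(ℝ, EG) G :=
  (mfderiv 𝓘(ℝ, EP) 𝓘(ℝ, EG) (fun v => (γ u)⁻¹ * γ v) u : EP →L[ℝ] EG)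

variable [LieGroup 𝓘(ℝ, EG) ∞ G]

namespace IsGauge

variable {U : Set M} {γ : P → G} {s : M → P} (h : IsGauge EM EG EP π U γ s)
  (hπ : IsPrincipalBundle EM EG G EP π)
include h hπ

theorem isOpen_preimage : IsOpen (π ⁻¹' U) := h.isOpen.preimage hπ.smooth_proj.continuous

theorem mdifferentiableAt_mul_gauge (b : G) {u : P} (hu : u ∈ π ⁻¹' U) :
    MDifferentiableAt 𝓘(ℝ, EP) 𝓘(ℝ, EG) (fun v => b * γ v) u :=
  ((contMDiff_mul_left (I := 𝓘(ℝ, EG)) (n := ∞) (a := b)).contMDiffAt.comp u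
    (h.smooth_gauge.contMDiffAt ((h.isOpen_preimage hπ).mem_nhds hu))).mdifferentiableAt (by simp)

omit [LieGroup 𝓘(ℝ, EG) ∞ G] h in
theorem _root_.EquivariantDiffusion.IsPrincipalBundle.mdifferentiableAt_orbit (u : P) (a : G) :
    MDifferentiableAt 𝓘(ℝ, EG) 𝓘(ℝ, EP) (fun a : G => u <• a) a :=
  (hπ.smooth_action.comp (contMDiff_const.prodMk contMDiff_id)).mdifferentiableAt (by simp)

/-- Along the orbit of `u`, `(γ u)⁻¹ * γ (u • a) = a`, whose derivative at `a = 1` is the identity.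
-/
theorem gaugeForm_fundamentalField {u : P} (hu : u ∈ π ⁻¹' U) (A : GroupLieAlgebra 𝓘(ℝ, EG) G) :
    gaugeForm (EP := EP) γ u (fundamentalField A u) = A := by
  have h1 := mfderiv_comp_apply_of_eq (1 : G) (h.mdifferentiableAt_mul_gauge hπ (γ u)⁻¹ hu)
    (hπ.mdifferentiableAt_orbit u 1) (right_one u) A
  have e : (fun v => (γ u)⁻¹ * γ v) ∘ (fun a : G => u <• a) = id := by
    funext a
    simp [h.gauge_right u hu]
  rw [e, mfderiv_id] at h1
  exact h1.symm

omit [LieGroup 𝓘(ℝ, EG) ∞ G] h in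
theorem _root_.EquivariantDiffusion.IsPrincipalBundle.mdifferentiableAt_right (u : P) (a : G) :
    MDifferentiableAt 𝓘(ℝ, EP) 𝓘(ℝ, EP) (fun v : P => v <• a) u :=
  (hπ.smooth_right a).mdifferentiableAt (by simp)

/-- Differentiate `(γ (u • a))⁻¹ * γ (w • a) = a⁻¹ * ((γ u)⁻¹ * γ w) * a` in `w` at `w = u`. -/
theorem gaugeForm_right {u : P} (hu : u ∈ π ⁻¹' U) (a : G) (v : TangentSpace 𝓘(ℝ, EP) u) :
    gaugeForm (EG := EG) γ (u <• a) (mfderiv 𝓘(ℝ, EP) 𝓘(ℝ, EP) (fun w : P => w <• a) u v)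
      = adjoint (EG := EG) a⁻¹ (gaugeForm γ u v) := by
  have hu' : u <• a ∈ π ⁻¹' U := by
    change π _ ∈ U
    rw [← (hπ.orbit_iff u _).2 ⟨a, rfl⟩]
    exact hu
  have h1 := mfderiv_comp_apply u (h.mdifferentiableAt_mul_gauge hπ (γ (u <• a))⁻¹ hu')
    (hπ.mdifferentiableAt_right u a) v
  have hadj : MDifferentiableAt 𝓘(ℝ, EG) 𝓘(ℝ, EG) (fun g : G => a⁻¹ * g * a⁻¹⁻¹) 1 :=
    (((contMDiff_mul_left (I := 𝓘(ℝ, EG)) (n := ∞) (a := a⁻¹)).mul contMDiff_const)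
      ).mdifferentiableAt (by simp)
  have h2 := mfderiv_comp_apply_of_eq u hadj (h.mdifferentiableAt_mul_gauge hπ (γ u)⁻¹ hu)
    (inv_mul_cancel (γ u)) v
  have e : (fun w => (γ (u <• a))⁻¹ * γ w) ∘ (fun w : P => w <• a) =ᶠ[𝓝 u]
      (fun g : G => a⁻¹ * g * a⁻¹⁻¹) ∘ fun w => (γ u)⁻¹ * γ w := by
    filter_upwards [(h.isOpen_preimage hπ).mem_nhds hu] with w hw
    simp [h.gauge_right u hu, h.gauge_right w hw, mul_assoc]
  have h3 := congrArg (fun L : EP →L[ℝ] EG => L v)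
    (e.mfderiv_eq (I := 𝓘(ℝ, EP)) (I' := 𝓘(ℝ, EG)))
  exact h1.symm.trans (h3.trans h2)

/-- A vertical vector is the value of a fundamental vector field. -/
theorem eq_fundamentalField {u : P} (hu : u ∈ π ⁻¹' U) {v : TangentSpace 𝓘(ℝ, EP) u}
    (hv : v ∈ verticalSpace (EM := EM) π u) : v = fundamentalField (gaugeForm (EG := EG) γ u v) u := by
  have hv0 : mfderiv 𝓘(ℝ, EP) 𝓘(ℝ, EM) π u v = 0 := hv
  have hsd : MDifferentiableAt 𝓘(ℝ, EM) 𝓘(ℝ, EP) s (π u) :=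
    (h.smooth_section.contMDiffAt (h.isOpen.mem_nhds hu)).mdifferentiableAt (by simp)
  have hγd : MDifferentiableAt 𝓘(ℝ, EP) 𝓘(ℝ, EG) γ u :=
    (h.smooth_gauge.contMDiffAt ((h.isOpen_preimage hπ).mem_nhds hu)).mdifferentiableAt (by simp)
  have hπd : MDifferentiableAt 𝓘(ℝ, EP) 𝓘(ℝ, EM) π u :=
    hπ.smooth_proj.mdifferentiableAt (by simp)
  have hm : MDifferentiableAt (𝓘(ℝ, EP).prod 𝓘(ℝ, EG)) 𝓘(ℝ, EP) (fun q : P × G => q.1 <• q.2)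
      (s (π u), γ u) := hπ.smooth_action.mdifferentiableAt (by simp)
  have h1 := mfderiv_comp_apply (I := 𝓘(ℝ, EP)) (I' := 𝓘(ℝ, EP).prod 𝓘(ℝ, EG)) (f := fun w => (s (π w), γ w)) u hm ((hsd.comp u hπd).prodMk hγd) v
  have h2 := mfderiv_comp_apply (I := 𝓘(ℝ, EP)) (I' := 𝓘(ℝ, EP).prod 𝓘(ℝ, EG)) (f := fun w => (s (π u), γ w)) u hm
    (mdifferentiableAt_const.prodMk hγd) v
  have h3 := mfderiv_comp_apply_of_eq (I'' := 𝓘(ℝ, EP)) u (hπ.mdifferentiableAt_orbit u 1)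
    (h.mdifferentiableAt_mul_gauge hπ (γ u)⁻¹ hu) (inv_mul_cancel (γ u)) v
  have e1 : (fun q : P × G => q.1 <• q.2) ∘ (fun w => (s (π w), γ w)) =ᶠ[𝓝 u] id := by
    filter_upwards [(h.isOpen_preimage hπ).mem_nhds hu] with w hw
    exact h.section_right w hw
  have e3 : (fun a : G => u <• a) ∘ (fun w => (γ u)⁻¹ * γ w) =
      (fun q : P × G => q.1 <• q.2) ∘ (fun w => (s (π u), γ w)) := by
    funext w
    have h4 : ∀ b : G, u <• b = s (π u) <• (γ u * b) := fun b => by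
      rw [← right_right]
      exact congrArg (· <• b) (h.section_right u hu).symm
    exact (h4 _).trans (congrArg (s (π u) <• ·) (mul_inv_cancel_left _ _))
  -- In `w = s (π w) • γ w` the section is stationary along a vertical vector, so only the group
  -- factor contributes; with the section frozen, `e3` makes this the orbit map of `u` after `(γ
  -- u)⁻¹ * γ`.
  have e4 : (mfderiv 𝓘(ℝ, EP) (𝓘(ℝ, EP).prod 𝓘(ℝ, EG)) (fun w => (s (π w), γ w)) u v : EP × EG) =
      mfderiv 𝓘(ℝ, EP) (𝓘(ℝ, EP).prod 𝓘(ℝ, EG)) (fun w => (s (π u), γ w)) u v := by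
    have h4 : mfderiv 𝓘(ℝ, EP) 𝓘(ℝ, EP) (fun w => s (π w)) u v = 0 :=
      (mfderiv_comp_apply u hsd hπd v).trans (by rw [hv0, map_zero])
    have h5 : MDifferentiableAt 𝓘(ℝ, EP) 𝓘(ℝ, EP) (fun w => s (π w)) u := hsd.comp u hπd
    rw [mfderiv_prodMk h5 hγd, mfderiv_prodMk mdifferentiableAt_const hγd, mfderiv_const]
    exact Prod.ext h4 rfl
  have h6 : (mfderiv 𝓘(ℝ, EP) 𝓘(ℝ, EP)
      ((fun q : P × G => q.1 <• q.2) ∘ (fun w => (s (π w), γ w))) u v : EP) = v := by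
    have h7 := congrArg (fun L : EP →L[ℝ] EP => L v) (e1.mfderiv_eq (I := 𝓘(ℝ, EP)) (I' := 𝓘(ℝ, EP)))
    rw [mfderiv_id] at h7
    exact h7
  have h8 : (mfderiv 𝓘(ℝ, EP) 𝓘(ℝ, EP)
      ((fun a : G => u <• a) ∘ (fun w => (γ u)⁻¹ * γ w)) u v : EP) =
      fundamentalField (gaugeForm (EG := EG) γ u v) u := h3
  rw [e3] at h8
  refine h6.symm.trans (Eq.trans ?_ h8)
  refine h1.trans (Eq.trans ?_ h2.symm)
  exact congrArg (mfderiv (𝓘(ℝ, EP).prod 𝓘(ℝ, EG)) 𝓘(ℝ, EP) (fun q : P × G => q.1 <• q.2)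
      (s (π u), γ u)) e4

end IsGauge

end Gauges

/-! ### Connection forms vanishing on the semi-connection. -/

section ConnectionForms

variable {EM : Type*} [NormedAddCommGroup EM] [NormedSpace ℝ EM] [FiniteDimensional ℝ EM]
  {M : Type*} [TopologicalSpace M] [ChartedSpace EM M] [IsManifold 𝓘(ℝ, EM) ∞ M] [T2Space M]
  {EG : Type*} [NormedAddCommGroup EG] [NormedSpace ℝ EG] [FiniteDimensional ℝ EG]
  {G : Type*} [TopologicalSpace G] [ChartedSpace EG G] [Group G] [LieGroup 𝓘(ℝ, EG) ∞ G] [T2Space G]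
  {EP : Type*} [NormedAddCommGroup EP] [NormedSpace ℝ EP] [FiniteDimensional ℝ EP]
  {P : Type*} [TopologicalSpace P] [ChartedSpace EP P] [IsManifold 𝓘(ℝ, EP) ∞ P] [T2Space P]
  [MulAction Gᵐᵒᵖ P] {π : P → M}

namespace IsPrincipalBundle

variable (hπ : IsPrincipalBundle EM EG G EP π)
include hπ

/-- The derivative of `f` along the field is the partial derivative of `f (u • a)` in `a` at `1`,
which is smooth in the parameter `u`. -/
theorem smoothFieldOn_fundamentalField (A : GroupLieAlgebra 𝓘(ℝ, EG) G) :
    SmoothFieldOn (fundamentalField (EP := EP) (P := P) A) Set.univ := by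
  have hG : IsManifold 𝓘(ℝ, EG) ∞ G := (inferInstance : LieGroup 𝓘(ℝ, EG) ∞ G).toIsManifold
  refine smoothFieldOn_of_forall isOpen_univ fun f hf => ?_
  have h1 := contMDiffOn_partial (E₂ := EG) (N₂ := G) (IQ := 𝓘(ℝ, EP)) (Q := P) isOpen_univ
    (hf.comp hπ.smooth_action).contMDiffOn
    (contMDiff_id (M := P) (I := 𝓘(ℝ, EP)) (n := ∞)).contMDiffOn (S := Set.univ)
    (w := fun _ => ⟨1, A⟩) contMDiffOn_const (fun _ _ => trivial)
  refine h1.congr fun u _ => ?_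
  have h2 := mfderiv_comp_apply_of_eq (I'' := 𝓘(ℝ, ℝ)) (1 : G) (hf.mdifferentiableAt (by simp))
    (hπ.mdifferentiableAt_orbit u 1) (right_one u) A
  exact h2.symm

theorem mfderiv_fundamentalField (A : GroupLieAlgebra 𝓘(ℝ, EG) G) (u : P) :
    mfderiv 𝓘(ℝ, EP) 𝓘(ℝ, EM) π u (fundamentalField A u) = 0 := by
  have h2 := mfderiv_comp_apply_of_eq (I'' := 𝓘(ℝ, EM)) (1 : G) (hπ.mdifferentiableAt_proj u)
    (hπ.mdifferentiableAt_orbit u 1) (right_one u) A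
  have e : π ∘ (fun a : G => u <• a) = fun _ => π u := funext fun a => hπ.proj_right u a
  rw [e, mfderiv_const] at h2
  exact h2.symm

/-- A covector field on the base, pulled back to `P`, is invariant under right translations. -/
theorem apply_mfderiv_right (ψ : ∀ y : M, TangentSpace 𝓘(ℝ, EM) y →L[ℝ] ℝ) (u : P) (a : G)
    (v : TangentSpace 𝓘(ℝ, EP) u) :
    ψ (π (u <• a)) (mfderiv 𝓘(ℝ, EP) 𝓘(ℝ, EM) π (u <• a)
      (mfderiv 𝓘(ℝ, EP) 𝓘(ℝ, EP) (fun w : P => w <• a) u v))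
      = ψ (π u) (mfderiv 𝓘(ℝ, EP) 𝓘(ℝ, EM) π u v) := by
  have h1 := mfderiv_comp_apply (I'' := 𝓘(ℝ, EM)) u (hπ.mdifferentiableAt_proj (u <• a))
    (hπ.mdifferentiableAt_right u a) v
  have h2 : ∀ g : P → M, g = π → ψ (g u) (mfderiv 𝓘(ℝ, EP) 𝓘(ℝ, EM) g u v)
      = ψ (π u) (mfderiv 𝓘(ℝ, EP) 𝓘(ℝ, EM) π u v) := by
    rintro g rfl; rfl
  exact (congrArg (ψ (π (u <• a))) h1).symm.trans
    (h2 (π ∘ fun w : P => w <• a) (funext fun w => hπ.proj_right w a))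

omit [FiniteDimensional ℝ EM] [IsManifold 𝓘(ℝ, EM) ∞ M] [T2Space M] [FiniteDimensional ℝ EP]
  [T2Space P] in
-- The point `u` occurs twice, as a parameter in `(γ u)⁻¹` and as the variable of differentiation.
-- Separating the two on `P × P`, with `f` such that `df = l` at `1`, gives a partial derivative of
-- a smooth function, taken on the diagonal.
theorem _root_.EquivariantDiffusion.IsGauge.smoothFormOn_gaugeForm {U : Set M} {γ : P → G}
    {s : M → P} (h : IsGauge EM EG EP π U γ s) (l : GroupLieAlgebra 𝓘(ℝ, EG) G →L[ℝ] ℝ) :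
    SmoothFormOn (fun u : P => l.comp (gaugeForm (EP := EP) γ u)) (π ⁻¹' U) := by
  have hG : IsManifold 𝓘(ℝ, EG) ∞ G := (inferInstance : LieGroup 𝓘(ℝ, EG) ∞ G).toIsManifold
  obtain ⟨f, hf, hfl⟩ := exists_function_of_covector (1 : G) l
  have hO := h.isOpen_preimage hπ
  have hΛ : ContMDiffOn (𝓘(ℝ, EP).prod 𝓘(ℝ, EP)) 𝓘(ℝ, ℝ) ∞
      (fun q : P × P => f ((γ q.1)⁻¹ * γ q.2)) ((π ⁻¹' U) ×ˢ (π ⁻¹' U)) :=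
    hf.comp_contMDiffOn (((h.smooth_gauge.comp contMDiffOn_fst fun q hq => hq.1).inv).mul
      (h.smooth_gauge.comp contMDiffOn_snd fun q hq => hq.2))
  have h1 := contMDiffOn_partial (IQ := 𝓘(ℝ, EP).tangent) (Q := TangentBundle 𝓘(ℝ, EP) P)
    (hO.prod hO) hΛ (Bundle.contMDiff_proj _).contMDiffOn
    (S := Bundle.TotalSpace.proj ⁻¹' (π ⁻¹' U)) contMDiff_id.contMDiffOn (fun v hv => ⟨hv, hv⟩)
  refine ContMDiffOn.congr h1 fun v hv => ?_
  have h2 := mfderiv_comp_apply_of_eq (I'' := 𝓘(ℝ, ℝ)) v.1 (hf.mdifferentiableAt (by simp))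
    (h.mdifferentiableAt_mul_gauge hπ (γ v.1)⁻¹ hv) (inv_mul_cancel (γ v.1)) v.2
  refine Eq.trans ?_ h2.symm
  exact congrArg (fun l : EG →L[ℝ] ℝ => l (gaugeForm (EG := EG) γ v.1 v.2)) hfl.symm

end IsPrincipalBundle

/-- Over `W`, `θ` is a connection form which vanishes on `H`. -/
structure IsConnectionOn (π : P → M) (H : ∀ u : P, Submodule ℝ (TangentSpace 𝓘(ℝ, EP) u))
    (W : Set M) (θ : ∀ u : P, TangentSpace 𝓘(ℝ, EP) u →L[ℝ] GroupLieAlgebra 𝓘(ℝ, EG) G) :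
    Prop where
  isOpen : IsOpen W
  smooth : ∀ l : GroupLieAlgebra 𝓘(ℝ, EG) G →L[ℝ] ℝ,
    SmoothFormOn (fun u : P => l.comp (θ u)) (π ⁻¹' W)
  apply_fundamentalField : ∀ u ∈ π ⁻¹' W, ∀ A, θ u (fundamentalField A u) = A
  map_right : ∀ u ∈ π ⁻¹' W, ∀ (a : G) (v : TangentSpace 𝓘(ℝ, EP) u),
    θ (u <• a) (mfderiv 𝓘(ℝ, EP) 𝓘(ℝ, EP) (fun w : P => w <• a) u v) = adjoint a⁻¹ (θ u v)
  vanishes : ∀ u ∈ π ⁻¹' W, ∀ v ∈ H u, θ u v = 0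

/-- Linearity of the adjoint action, used to move it through sums. -/
theorem exists_adjoint (a : G) : ∃ T : EG →L[ℝ] EG, ∀ A, adjoint (EG := EG) a A = T A :=
  ⟨_, fun _ => rfl⟩

namespace IsPrincipalBundle

variable (hπ : IsPrincipalBundle EM EG G EP π) {A : DiffusionOperator EM M}
  {L : DiffusionOperator EP P}
include hπ

/-- The endomorphism `v ↦ ∑ l i (Tπ v) • X i`, with `X i` the lifted frame, is a smooth invariant
projection onto the lifted space that kills vertical vectors. The gauge form composed with the
complementary projection keeps the properties of a connection form and vanishes on the lifted space.
-/
theorem exists_isConnectionOn (hL : hπ.IsLift A L) (hL' : hπ.IsEquivariant L) {p : ℕ}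
    (hp : ∀ x : M, Module.finrank ℝ (A.symbolRange x) = p) (x : M) :
    ∃ (W : Set M) (θ : ∀ u : P, TangentSpace 𝓘(ℝ, EP) u →L[ℝ] GroupLieAlgebra 𝓘(ℝ, EG) G),
      x ∈ W ∧ IsConnectionOn π (liftedSpace EM L π) W θ := by
  obtain ⟨U, γ, s, hxU, h⟩ := hπ.exists_gauge x
  obtain ⟨W, f, l, hW, hxW, hf, hl, hlX, hsp⟩ := A.exists_symbol_frame hp x
  let X : Fin p → ∀ u : P, TangentSpace 𝓘(ℝ, EP) u := fun i u =>
    L.symbol u (mvfderiv 𝓘(ℝ, EP) (f i ∘ π) u)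
  have hX : ∀ i W, SmoothFieldOn (X i) W := fun i W =>
    L.smoothFieldOn_symbol (.d (f i ∘ π) (hπ.contMDiff_comp_proj (hf i))) _
  let θ : ∀ u : P, TangentSpace 𝓘(ℝ, EP) u →L[ℝ] GroupLieAlgebra 𝓘(ℝ, EG) G := fun u =>
    gaugeForm γ u - ∑ i, ((l i (π u)).comp (mfderiv 𝓘(ℝ, EP) 𝓘(ℝ, EM) π u)).smulRight
      (gaugeForm γ u (X i u))
  have hθ : ∀ u v, θ u v = gaugeForm γ u v - ∑ i,
      l i (π u) (mfderiv 𝓘(ℝ, EP) 𝓘(ℝ, EM) π u v) • gaugeForm γ u (X i u) := fun u v => by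
    simp only [θ, sub_apply, sum_apply]
    rfl
  refine ⟨U ∩ W, θ, ⟨hxU, hxW⟩, h.isOpen.inter hW, fun m => ?_, fun u hu A => ?_,
    fun u hu a v => ?_, fun u hu v hv => ?_⟩
  · have h1 := (h.smoothFormOn_gaugeForm hπ m).mono (Set.preimage_mono (Set.inter_subset_left (t := W)))
    have hO : IsOpen (π ⁻¹' (U ∩ W)) := (h.isOpen.inter hW).preimage hπ.smooth_proj.continuous
    have h2 : SmoothFormOn (fun u => ∑ i, (m (gaugeForm γ u (X i u))) •
        ((l i (π u)).comp (mfderiv 𝓘(ℝ, EP) 𝓘(ℝ, EM) π u))) (π ⁻¹' (U ∩ W)) :=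
      SmoothFormOn.sum _ fun i _ => SmoothFormOn.smul (h1.apply (hX i _))
        ((hl i).pullback hO hπ.smooth_proj.contMDiffOn fun u hu => hu.2)
    refine ContMDiffOn.congr (h1.sub h2) fun v hv => ?_
    simp only [ContinuousLinearMap.comp_apply, hθ, map_sub, map_sum, map_smul, sub_apply,
      sum_apply, smul_apply, smul_eq_mul]
    congr 1
    exact Finset.sum_congr rfl fun i _ => mul_comm _ _
  · rw [hθ, h.gaugeForm_fundamentalField hπ hu.1, hπ.mfderiv_fundamentalField]
    simp
  · rw [hθ, hθ, h.gaugeForm_right hπ hu.1]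
    obtain ⟨T, hT⟩ := exists_adjoint (EG := EG) a⁻¹
    have h3 : ∀ i, gaugeForm (EG := EG) γ (u <• a) (X i (u <• a)) = T (gaugeForm γ u (X i u)) := by
      intro i
      have h4 := h.gaugeForm_right hπ hu.1 a (X i u)
      rw [hπ.mfderiv_right_symbol hL' u a (hf i)] at h4
      exact h4.trans (hT _)
    rw [hT, hT]
    refine Eq.trans ?_ (map_sub T _ _).symm
    congr 1
    refine Eq.trans (Finset.sum_congr rfl fun i _ => ?_) (map_sum T _ _).symm
    rw [hπ.apply_mfderiv_right, h3]
    exact (map_smul T _ _).symm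
  · rw [hθ, sub_eq_zero]
    conv_lhs => rw [hπ.eq_sum_of_mem_liftedSpace hL hf (hsp _ hu.2) hv]
    rw [map_sum]
    exact Finset.sum_congr rfl fun i _ => map_smul _ _ _

/-- The conditions are stable under combinations with weights that sum to one and are constant on
fibres. A partition of unity on `M`, composed with `π`, provides such weights. -/
theorem exists_connectionForm [SigmaCompactSpace M] {H : ∀ u : P, Submodule ℝ (TangentSpace 𝓘(ℝ, EP) u)}
    (h : ∀ x : M, ∃ (W : Set M)
      (θ : ∀ u : P, TangentSpace 𝓘(ℝ, EP) u →L[ℝ] GroupLieAlgebra 𝓘(ℝ, EG) G),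
      x ∈ W ∧ IsConnectionOn π H W θ) :
    ∃ θ : ConnectionForm EG G EP P, θ.VanishesOn H := by
  choose W θ hxW hθ using h
  obtain ⟨ρ, hρ⟩ := SmoothPartitionOfUnity.exists_isSubordinate 𝓘(ℝ, EM) isClosed_univ W
    (fun x => (hθ x).isOpen) (fun x _ => Set.mem_iUnion_of_mem x (hxW x))
  have hmem : ∀ {u : P} {x : M}, x ∈ ρ.finsupport (π u) → u ∈ π ⁻¹' W x := fun hx =>
    hρ _ (subset_tsupport _ ((ρ.mem_finsupport _).1 hx))
  have hsum : ∀ (u : P) (A : EG), ∑ x ∈ ρ.finsupport (π u), ρ x (π u) • A = A := fun u A => by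
    rw [← Finset.sum_smul, ρ.sum_finsupport _ (Set.mem_univ _), one_smul]
  let Θ : ∀ u : P, TangentSpace 𝓘(ℝ, EP) u →L[ℝ] GroupLieAlgebra 𝓘(ℝ, EG) G := fun u =>
    ∑ x ∈ ρ.finsupport (π u), ρ x (π u) • θ x u
  have hΘ : ∀ u v, Θ u v = ∑ x ∈ ρ.finsupport (π u), ρ x (π u) • θ x u v := fun u v => by
    simp only [Θ, sum_apply, smul_apply]
  refine ⟨⟨Θ, fun l => ?_, fun u A => ?_, fun a u v => ?_⟩, fun u v hv => ?_⟩
  · intro v₀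
    let s := ρ.fintsupport (π v₀.1)
    have h1 : SmoothFormOn (fun u : P => ∑ x ∈ s, (ρ x ∘ π) u • l.comp (θ x u)) Set.univ :=
      SmoothFormOn.sum _ fun x _ => ((hθ x).smooth l).smul_bump
        ((hθ x).isOpen.preimage hπ.smooth_proj.continuous) (hπ.contMDiff_comp_proj (ρ x).contMDiff)
        ((closure_minimal (Set.preimage_mono subset_closure)
          ((isClosed_tsupport (ρ x)).preimage hπ.smooth_proj.continuous)).trans
            (Set.preimage_mono (hρ x)))
    refine ((contMDiffOn_univ.1 h1) v₀).congr_of_eventuallyEq ?_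
    have h2 := ((hπ.smooth_proj.continuous.comp
      (FiberBundle.continuous_proj EP (TangentSpace 𝓘(ℝ, EP)))).continuousAt (x := v₀)).eventually
        (ρ.eventually_finsupport_subset (π v₀.1))
    filter_upwards [h2] with v hv
    rw [hΘ, map_sum, sum_apply]
    refine Eq.trans (Finset.sum_subset hv fun x _ hx => ?_) (Finset.sum_congr rfl fun x _ => ?_)
    · have h3 : ρ x (π v.1) = 0 := by
        by_contra h0
        exact hx ((ρ.mem_finsupport _).2 h0)
      rw [h3, zero_smul, map_zero]
    · rw [map_smul]
      rfl
  · rw [hΘ, ← hsum u A]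
    refine Finset.sum_congr rfl fun x hx => ?_
    rw [hsum u A, (hθ x).apply_fundamentalField u (hmem hx)]
    rfl
  · obtain ⟨T, hT⟩ := exists_adjoint (EG := EG) a⁻¹
    rw [hΘ, hΘ, hT, hπ.proj_right]
    refine Eq.trans (Finset.sum_congr rfl fun x hx => ?_) (map_sum T _ _).symm
    rw [(hθ x).map_right u (hmem hx), hT]
    exact (map_smul T _ _).symm
  · refine (hΘ u v).trans (Finset.sum_eq_zero fun x hx => ?_)
    rw [(hθ x).vanishes u (hmem hx) v hv, smul_zero]

/-- A vertical vector is determined by the value of a connection form. -/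
theorem eq_fundamentalField (θ : ConnectionForm EG G EP P) {u : P} {v : TangentSpace 𝓘(ℝ, EP) u}
    (hv : v ∈ verticalSpace (EM := EM) π u) : v = fundamentalField (θ.toFun u v) u := by
  obtain ⟨U, γ, s, hxU, h⟩ := hπ.exists_gauge (π u)
  have h1 := h.eq_fundamentalField hπ hxU hv
  have h2 := θ.apply_fundamentalField u (gaugeForm γ u v)
  rw [← h1] at h2
  rw [h2]
  exact h1

/-- Translating a local section by `γ u` gives a section through `u`, whose derivative is a right
inverse of `Tπ`. -/
theorem surjective_mfderiv_proj (u : P) :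
    Function.Surjective (mfderiv 𝓘(ℝ, EP) 𝓘(ℝ, EM) π u) := by
  obtain ⟨U, γ, s, hxU, h⟩ := hπ.exists_gauge (π u)
  have hUn : U ∈ 𝓝 (π u) := h.isOpen.mem_nhds hxU
  have hsd : MDifferentiableAt 𝓘(ℝ, EM) 𝓘(ℝ, EP) s (π u) :=
    (h.smooth_section.contMDiffAt hUn).mdifferentiableAt (by simp)
  have hu : s (π u) <• γ u = u := h.section_right u hxU
  intro w
  have h1 : MDifferentiableAt 𝓘(ℝ, EM) 𝓘(ℝ, EP) (fun y => s y <• γ u) (π u) :=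
    (hπ.mdifferentiableAt_right (s (π u)) (γ u)).comp _ hsd
  have h2 := mfderiv_comp_apply_of_eq (I'' := 𝓘(ℝ, EM)) (π u) (hπ.mdifferentiableAt_proj u) h1 hu w
  refine ⟨_, h2.symm.trans ?_⟩
  have e : π ∘ (fun y => s y <• γ u) =ᶠ[𝓝 (π u)] id := by
    filter_upwards [hUn] with y hy
    obtain ⟨v, rfl⟩ := hπ.surjective_proj y
    change π (s (π v) <• γ u) = π v
    rw [hπ.proj_right]
    conv_rhs => rw [← h.section_right v hy, hπ.proj_right]
  have h3 := congrArg (fun L : EM →L[ℝ] EM => L w)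
    (e.mfderiv_eq (I := 𝓘(ℝ, EM)) (I' := 𝓘(ℝ, EM)))
  rw [mfderiv_id] at h3
  exact h3

end IsPrincipalBundle

theorem fundamentalField_sum {κ : Type*} [Fintype κ] (t : κ → ℝ)
    (A : κ → GroupLieAlgebra 𝓘(ℝ, EG) G) (u : P) :
    fundamentalField (∑ i, t i • A i) u = ∑ i, t i • fundamentalField (EP := EP) (A i) u := by
  let T : EG →L[ℝ] EP := mfderiv 𝓘(ℝ, EG) 𝓘(ℝ, EP) (fun a : G => u <• a) 1
  have h : ∀ A : κ → EG, T (∑ i, t i • A i) = ∑ i, t i • T (A i) := fun A => by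
    simp only [map_sum, map_smul]
  exact h A

end ConnectionForms

/-! ### Subtraction of diffusion operators. -/

section Difference

variable {E : Type*} [NormedAddCommGroup E] [NormedSpace ℝ E]
  {N : Type*} [TopologicalSpace N] [ChartedSpace E N]

/-- The difference of two diffusion operators, when it is semi-elliptic. -/
def DiffusionOperator.sub (B C : DiffusionOperator E N)
    (h : ∀ f x, squareField C.toLin f f x ≤ squareField B.toLin f f x) :
    DiffusionOperator E N where
  toLin := B.toLin - C.toLin
  secondOrder x := by
    obtain ⟨a, b, hB⟩ := B.exists_coeff x
    obtain ⟨a', b', hC⟩ := C.exists_coeff x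
    refine ⟨a - a', b - b', 0, fun f => ?_⟩
    have h1 : (B.toLin - C.toLin) f x = B f x - C f x := rfl
    rw [h1, hB, hC]
    simp only [LinearMap.sub_apply]
    ring
  semiElliptic f x := by
    have h1 : squareField (B.toLin - C.toLin) f f x =
        squareField B.toLin f f x - squareField C.toLin f f x := by
      simp only [squareField, LinearMap.sub_apply, Pi.sub_apply]
      ring
    rw [h1]
    exact sub_nonneg.2 (h f x)
  map_const r x := by
    rw [LinearMap.sub_apply, Pi.sub_apply, B.map_const, C.map_const, sub_zero]
  smooth f hf := (B.smooth f hf).sub (C.smooth f hf)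

end Difference

/-! ### Lifts of a cohesive operator annihilate forms that vanish over the image of its symbol. -/

section HorizontalForms

variable {EM : Type*} [NormedAddCommGroup EM] [NormedSpace ℝ EM] [FiniteDimensional ℝ EM]
  {M : Type*} [TopologicalSpace M] [ChartedSpace EM M] [IsManifold 𝓘(ℝ, EM) ∞ M] [T2Space M]
  {EG : Type*} [NormedAddCommGroup EG] [NormedSpace ℝ EG]
  {G : Type*} [TopologicalSpace G] [ChartedSpace EG G] [Group G]
  {EP : Type*} [NormedAddCommGroup EP] [NormedSpace ℝ EP] [FiniteDimensional ℝ EP]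
  {P : Type*} [TopologicalSpace P] [ChartedSpace EP P] [IsManifold 𝓘(ℝ, EP) ∞ P] [T2Space P]
  [MulAction Gᵐᵒᵖ P] {π : P → M}

/-- Near `x`, the differentials `df_a` can be corrected to one-forms `ψ_a` that vanish on the image of
the symbol: at each point near `x`, `ψ_a v = df_a (v - e)` with `e` in this image, not depending
on `a`. -/
theorem DiffusionOperator.exists_form_vanishing_symbolRange {A : DiffusionOperator EM M} {p : ℕ}
    (hp : ∀ x : M, Module.finrank ℝ (A.symbolRange x) = p) (x : M) {κ : Type*} {f : κ → M → ℝ}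
    (hf : ∀ a, ContMDiff 𝓘(ℝ, EM) 𝓘(ℝ, ℝ) ∞ (f a)) [Finite κ] :
    ∃ ψ : κ → OneForm EM M, (∀ a y, ∀ v ∈ A.symbolRange y, (ψ a).toFun y v = 0) ∧
      ∀ᶠ y in 𝓝 x, ∀ v, ∃ e ∈ A.symbolRange y, ∀ a,
        (ψ a).toFun y v = mvfderiv 𝓘(ℝ, EM) (f a) y (v - e) := by
  obtain ⟨W, h, l, hW, hxW, hh, hl, hlX, hsp⟩ := A.exists_symbol_frame hp x
  let X : Fin p → ∀ y : M, TangentSpace 𝓘(ℝ, EM) y := fun i y =>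
    A.symbol y (mvfderiv 𝓘(ℝ, EM) (h i) y)
  have hX : ∀ i, SmoothFieldOn (X i) W := fun i => A.smoothFieldOn_symbol (.d (h i) (hh i)) W
  have hd : ∀ a, SmoothFormOn (mvfderiv 𝓘(ℝ, EM) (f a)) W := fun a =>
    smoothFormOn_mvfderiv hW (hf a).contMDiffOn
  have hs : ∀ a, SmoothFormOn (fun y => mvfderiv 𝓘(ℝ, EM) (f a) y -
      ∑ i, mvfderiv 𝓘(ℝ, EM) (f a) y (X i y) • l i y) W := fun a =>
    (hd a).sub (SmoothFormOn.sum _ fun i _ => SmoothFormOn.smul ((hd a).apply (hX i)) (hl i))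
  have key : ∀ a y v, (mvfderiv 𝓘(ℝ, EM) (f a) y -
      ∑ i, mvfderiv 𝓘(ℝ, EM) (f a) y (X i y) • l i y) v =
      mvfderiv 𝓘(ℝ, EM) (f a) y (v - ∑ i, l i y v • X i y) := by
    intro a y v
    rw [map_sub, map_sum, sub_apply, sum_apply]
    congr 1
    refine Finset.sum_congr rfl fun i _ => ?_
    rw [map_smul, smul_apply, smul_eq_mul, smul_eq_mul, mul_comm]
  choose ψ χ hψ hχ hχW using fun a => exists_global_form hW hxW (hs a)
  refine ⟨ψ, fun a y v hv => ?_, ?_⟩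
  · rw [hψ, smul_apply]
    by_cases hy : y ∈ W
    · rw [key]
      have h1 : v - ∑ i, l i y v • X i y = 0 := sub_eq_zero.2 (hsp y hy v hv)
      rw [h1, map_zero, smul_zero]
    · rw [hχW a y hy, zero_smul]
  · filter_upwards [Filter.eventually_all.2 hχ] with y hy v
    refine ⟨∑ i, l i y v • X i y, Submodule.sum_mem _ fun i _ => Submodule.smul_mem _ _ ⟨_, rfl⟩,
      fun a => ?_⟩
    rw [hψ, smul_apply, hy a, key, Pi.one_apply, one_smul]

theorem exists_eq_comp_mfderiv {u : P} (hs : Function.Surjective (mfderiv 𝓘(ℝ, EP) 𝓘(ℝ, EM) π u))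
    {ξ : TangentSpace 𝓘(ℝ, EP) u →L[ℝ] ℝ}
    (hξ : ∀ v ∈ verticalSpace (EM := EM) π u, ξ v = 0) :
    ∃ ζ : TangentSpace 𝓘(ℝ, EM) (π u) →L[ℝ] ℝ, ξ = ζ.comp (mfderiv 𝓘(ℝ, EP) 𝓘(ℝ, EM) π u) := by
  let T : EP →L[ℝ] EM := mfderiv 𝓘(ℝ, EP) 𝓘(ℝ, EM) π u
  let ξ' : EP →L[ℝ] ℝ := ξ
  obtain ⟨S, hS⟩ := T.toLinearMap.exists_rightInverse_of_surjective (LinearMap.range_eq_top.2 hs)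
  let ζ : EM →L[ℝ] ℝ := LinearMap.toContinuousLinearMap (ξ'.toLinearMap ∘ₗ S)
  refine ⟨ζ, ?_⟩
  have h : ∀ v : EP, ξ' v = ξ' (S (T v)) := fun v => by
    have h1 : T (v - S (T v)) = 0 := by
      rw [map_sub, sub_eq_zero]
      exact (LinearMap.congr_fun hS (T v)).symm
    have h2 : ξ' (v - S (T v)) = 0 := hξ _ h1
    rwa [map_sub, sub_eq_zero] at h2
  ext v
  exact h v

namespace IsPrincipalBundle

variable (hπ : IsPrincipalBundle EM EG G EP π)

variable {A : DiffusionOperator EM M} {L : DiffusionOperator EP P}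

/-- Such a form kills `ker Tπ`, so locally it is a combination of the `d(f i ∘ π)`; as it kills all
of `Tπ⁻¹ E`, the `d(f i)` may be replaced by forms `ψ i` vanishing on `E`. On `π^*(ψ i)` the
operator `δ^L` is zero by cohesion of `A`. The terms with derivatives of the coefficients drop out
because `π^*(ψ i)` is null for the semidefinite symbol of `L`. -/
theorem delta_eq_zero_of_isLift (hL : hπ.IsLift A L) (hA : A.IsStronglyCohesive)
    (hs : ∀ u, Function.Surjective (mfderiv 𝓘(ℝ, EP) 𝓘(ℝ, EM) π u)) (φ : OneForm EP P)
    (hφ : ∀ u v, mfderiv 𝓘(ℝ, EP) 𝓘(ℝ, EM) π u v ∈ A.symbolRange (π u) → φ.toFun u v = 0)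
    (u : P) : L.delta φ u = 0 := by
  obtain ⟨⟨p, hp⟩, hA⟩ := hA
  obtain ⟨q, hq, hqd⟩ := exists_bijective_mvfderiv (E := EM) (π u)
  have hcomp : ∀ w v, mvfderiv 𝓘(ℝ, EP) (q ∘ π) w v =
      mvfderiv 𝓘(ℝ, EM) q (π w) (mfderiv 𝓘(ℝ, EP) 𝓘(ℝ, EM) π w v) := fun w v =>
    mvfderiv_comp_mfderiv (hq.mdifferentiableAt (by simp)) (hπ.mdifferentiableAt_proj w) v
  have hc : ContinuousAt π u := hπ.smooth_proj.continuous.continuousAt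
  obtain ⟨g, hg, hge⟩ := φ.exists_eq_sum (hq.comp hπ.smooth_proj) (x := u)
    (fun w => by
      obtain ⟨z, hz⟩ := hqd.self_of_nhds.2 w
      obtain ⟨v, hv⟩ := hs u z
      exact ⟨v, by rw [hcomp, hv, hz]⟩)
    (by
      filter_upwards [hc.eventually hqd] with w hw v hv
      refine hφ w v ?_
      rw [hcomp] at hv
      rw [hw.1 (hv.trans (map_zero _).symm)]
      exact Submodule.zero_mem _)
  let f : Fin (Module.finrank ℝ EM) → M → ℝ := fun i y =>
    LinearMap.toContinuousLinearMap ((Module.finBasis ℝ EM).coord i) (q y)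
  have hf : ∀ i, ContMDiff 𝓘(ℝ, EM) 𝓘(ℝ, ℝ) ∞ (f i) := fun i =>
    (LinearMap.toContinuousLinearMap ((Module.finBasis ℝ EM).coord i)).contMDiff.comp hq
  obtain ⟨ψ, hψ, hψe⟩ := A.exists_form_vanishing_symbolRange hp (π u) hf
  rw [L.delta_eq_sum Finset.univ hg (φ := fun i => hπ.pullback (ψ i))]
  · refine Finset.sum_eq_zero fun i _ => ?_
    rw [hπ.delta_lift hL, hA _ (hψ i), mul_zero, add_zero]
    refine L.symbolForm_eq_zero ?_ _
    exact (hπ.symbolForm_lift hL u _ _).trans (hA.symbolForm_eq_zero (hψ i) _ _)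
  · filter_upwards [hge, hc.eventually hψe] with w hw hψw
    ext v
    -- One vector `e` serves all indices, so one lift `v'` of it, killed by `φ`, can be subtracted
    -- from `v`; this turns every `d(f i)` into `ψ i` at once.
    obtain ⟨e, he, hev⟩ := hψw (mfderiv 𝓘(ℝ, EP) 𝓘(ℝ, EM) π w v)
    obtain ⟨v', hv'⟩ := hs w e
    have h1 : φ.toFun w v' = 0 := hφ w v' (by rw [hv']; exact he)
    have h2 : φ.toFun w v = φ.toFun w (v - v') := by rw [map_sub, h1, sub_zero]
    rw [h2, hw, sum_apply, sum_apply]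
    refine Finset.sum_congr rfl fun i _ => ?_
    rw [smul_apply, smul_apply]
    congr 1
    refine Eq.trans ?_ (hev i).symm
    refine (mvfderiv_comp_mfderiv (g := f i) ((hf i).mdifferentiableAt (by simp))
      (hπ.mdifferentiableAt_proj w) _).trans ?_
    rw [map_sub, hv']

end IsPrincipalBundle

end HorizontalForms

/-! ### The vertical and horizontal parts of the operator. -/

section Decomposition

variable {EM : Type*} [NormedAddCommGroup EM] [NormedSpace ℝ EM] [FiniteDimensional ℝ EM]
  {M : Type*} [TopologicalSpace M] [ChartedSpace EM M] [IsManifold 𝓘(ℝ, EM) ∞ M] [T2Space M]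
  {EG : Type*} [NormedAddCommGroup EG] [NormedSpace ℝ EG] [FiniteDimensional ℝ EG]
  {G : Type*} [TopologicalSpace G] [ChartedSpace EG G] [Group G] [LieGroup 𝓘(ℝ, EG) ∞ G] [T2Space G]
  {EP : Type*} [NormedAddCommGroup EP] [NormedSpace ℝ EP] [FiniteDimensional ℝ EP]
  {P : Type*} [TopologicalSpace P] [ChartedSpace EP P] [IsManifold 𝓘(ℝ, EP) ∞ P] [T2Space P]
  [MulAction Gᵐᵒᵖ P] {π : P → M} {ι : Type*} (b : Module.Basis ι ℝ (GroupLieAlgebra 𝓘(ℝ, EG) G))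

namespace ConnectionForm

variable (θ : ConnectionForm EG G EP P)

/-- The coordinates of a connection form with respect to a basis of the Lie algebra. -/
abbrev coord (k : ι) : OneForm EP P := θ.component (coordCLM b k)

theorem coord_apply (k : ι) (u : P) (v : TangentSpace 𝓘(ℝ, EP) u) :
    (θ.coord b k).toFun u v = b.coord k (θ.toFun u v) := rfl

theorem coord_fundamentalField [DecidableEq ι] (j k : ι) (u : P) :
    (θ.coord b k).toFun u (fundamentalField (b j) u) = if j = k then 1 else 0 := by
  rw [coord_apply, θ.apply_fundamentalField, Module.Basis.coord_apply, Module.Basis.repr_self,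
    Finsupp.single_apply]

end ConnectionForm

theorem DiffusionOperator.sum_symbolForm_nonneg [Fintype ι] (L : DiffusionOperator EP P) {u : P}
    (ξ : ι → TangentSpace 𝓘(ℝ, EP) u →L[ℝ] ℝ) (t : ι → ℝ) :
    0 ≤ ∑ i, ∑ j, L.symbolForm u (ξ i) (ξ j) * (t i * t j) := by
  have h := L.symbolForm_nonneg u (∑ i, t i • ξ i)
  let ξ' : ι → EP →L[ℝ] ℝ := ξ
  have h2 : L.symbolForm u (∑ i, t i • ξ' i) (∑ i, t i • ξ' i) =
      ∑ i, ∑ j, L.symbolForm u (ξ' i) (ξ' j) * (t i * t j) := by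
    simp only [map_sum, map_smul, LinearMap.sum_apply, LinearMap.smul_apply, smul_eq_mul,
      Finset.mul_sum]
    rw [Finset.sum_comm]
    exact Finset.sum_congr rfl fun i _ => Finset.sum_congr rfl fun j _ => by ring
  exact h.trans_eq h2

namespace IsPrincipalBundle

variable (hπ : IsPrincipalBundle EM EG G EP π) (L : DiffusionOperator EP P)
  (θ : ConnectionForm EG G EP P)

variable [Fintype ι]

/-- The vertical part of a diffusion operator, with respect to a connection form. -/
def verticalPart : DiffusionOperator EP P :=
  fieldOperator (fun i => fundamentalField (b i)) (fun i => hπ.smoothFieldOn_fundamentalField (b i))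
    (fun k l u => L.symbolForm u ((θ.coord b k).toFun u) ((θ.coord b l).toFun u))
    (fun l => L.delta (θ.coord b l)) (fun k l => L.contMDiff_symbolForm (θ.coord b k) (θ.coord b l))
    (fun l => L.contMDiff_delta (θ.coord b l))
    (fun _ t => L.sum_symbolForm_nonneg (fun k => (θ.coord b k).toFun _) t)

theorem symbolForm_verticalPart (u : P) (ξ η : TangentSpace 𝓘(ℝ, EP) u →L[ℝ] ℝ) :
    (hπ.verticalPart b L θ).symbolForm u ξ η =
      ∑ i, ∑ j, L.symbolForm u ((θ.coord b i).toFun u) ((θ.coord b j).toFun u) *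
        (ξ (fundamentalField (b i) u) * η (fundamentalField (b j) u)) :=
  symbolForm_fieldOperator (fun i => fundamentalField (b i))
    (fun i => hπ.smoothFieldOn_fundamentalField (b i))
    (fun k l u => L.symbolForm u ((θ.coord b k).toFun u) ((θ.coord b l).toFun u))
    (fun l => L.delta (θ.coord b l)) (fun k l => L.contMDiff_symbolForm (θ.coord b k) (θ.coord b l))
    (fun l => L.contMDiff_delta (θ.coord b l))
    (fun _ t => L.sum_symbolForm_nonneg (fun k => (θ.coord b k).toFun _) t) (fun _ _ _ => L.symbolForm_symm _ _ _) u ξ η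

theorem delta_verticalPart (φ : OneForm EP P) (u : P) :
    (hπ.verticalPart b L θ).delta φ u =
      (∑ i, ∑ j, L.symbolForm u ((θ.coord b i).toFun u) ((θ.coord b j).toFun u) *
        lieDeriv (EP := EP) (fundamentalField (b i))
          (fun y => φ.toFun y (fundamentalField (b j) y)) u)
        + ∑ k, L.delta (θ.coord b k) u * φ.toFun u (fundamentalField (b k) u) :=
  delta_fieldOperator (fun i => fundamentalField (b i))
    (fun i => hπ.smoothFieldOn_fundamentalField (b i))
    (fun k l u => L.symbolForm u ((θ.coord b k).toFun u) ((θ.coord b l).toFun u))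
    (fun l => L.delta (θ.coord b l)) (fun k l => L.contMDiff_symbolForm (θ.coord b k) (θ.coord b l))
    (fun l => L.contMDiff_delta (θ.coord b l))
    (fun _ t => L.sum_symbolForm_nonneg (fun k => (θ.coord b k).toFun _) t) (fun _ _ _ => L.symbolForm_symm _ _ _) φ u

/-- All connection forms agree on fundamental fields, so the coefficients built from `θ` are
recovered by any `θ'`. This is why the final formulas hold for every admissible connection form. -/
theorem symbolForm_verticalPart_coord (θ' : ConnectionForm EG G EP P) (k l : ι) (u : P) :
    (hπ.verticalPart b L θ).symbolForm u ((θ'.coord b k).toFun u) ((θ'.coord b l).toFun u) =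
      L.symbolForm u ((θ.coord b k).toFun u) ((θ.coord b l).toFun u) := by
  classical
  rw [symbolForm_verticalPart]
  simp only [ConnectionForm.coord_fundamentalField]
  simp

/-- The second order terms differentiate the constant functions `θ'^l (A_j*)` and vanish; only the
drift remains. -/
theorem delta_verticalPart_coord (θ' : ConnectionForm EG G EP P) (l : ι) (u : P) :
    (hπ.verticalPart b L θ).delta (θ'.coord b l) u = L.delta (θ.coord b l) u := by
  classical
  rw [delta_verticalPart]
  simp only [ConnectionForm.coord_fundamentalField, lieDeriv_const]
  simp

theorem isAlong_verticalPart :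
    (hπ.verticalPart b L θ).IsAlong (verticalSpace (EM := EM) π) := by
  intro φ hφ u
  rw [delta_verticalPart]
  have h : ∀ j u, φ.toFun u (fundamentalField (b j) u) = 0 := fun j u =>
    hφ u _ (hπ.mfderiv_fundamentalField (b j) u)
  simp only [h, lieDeriv_const]
  simp

theorem verticalPart_comp_proj (f : C2 EM M) (u : P) :
    hπ.verticalPart b L θ (f.comp hπ.proj) u = 0 := by
  refine (fieldOperator_apply _ _ _ _ _ _ _ _ _).trans ?_
  have h : ∀ k, lieDeriv (EP := EP) (fundamentalField (b k)) (f.comp hπ.proj) = fun _ => 0 := by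
    intro k
    funext w
    refine (mvfderiv_comp_mfderiv (f.mdifferentiableAt (π w)) (hπ.mdifferentiableAt_proj w) _).trans ?_
    rw [hπ.mfderiv_fundamentalField, map_zero]
  simp only [h, lieDeriv_const]
  simp

include hπ

theorem apply_eq_sum_of_mem_verticalSpace {u : P} {v : TangentSpace 𝓘(ℝ, EP) u}
    (hv : v ∈ verticalSpace (EM := EM) π u) (ξ : TangentSpace 𝓘(ℝ, EP) u →L[ℝ] ℝ) :
    ξ v = ∑ k, ξ (fundamentalField (b k) u) * (θ.coord b k).toFun u v := by
  have h1 := hπ.eq_fundamentalField θ hv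
  rw [← b.sum_repr (θ.toFun u v), fundamentalField_sum] at h1
  conv_lhs => rw [h1, map_sum]
  refine Finset.sum_congr rfl fun k _ => ?_
  rw [map_smul, smul_eq_mul, mul_comm]
  rfl

/-- A covector splits into a combination of the coordinates of a connection form and a covector
pulled back from the base. -/
theorem exists_eq_sum_add_comp (u : P) (ξ : TangentSpace 𝓘(ℝ, EP) u →L[ℝ] ℝ) :
    ∃ ζ : TangentSpace 𝓘(ℝ, EM) (π u) →L[ℝ] ℝ,
      ξ = (∑ k, ξ (fundamentalField (b k) u) • (θ.coord b k).toFun u) +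
        ζ.comp (mfderiv 𝓘(ℝ, EP) 𝓘(ℝ, EM) π u) := by
  obtain ⟨ζ, hζ⟩ := exists_eq_comp_mfderiv (hπ.surjective_mfderiv_proj u)
    (ξ := ξ - ∑ k, ξ (fundamentalField (b k) u) • (θ.coord b k).toFun u) (fun v hv => by
      rw [sub_apply, sum_apply, sub_eq_zero]
      exact hπ.apply_eq_sum_of_mem_verticalSpace b θ hv ξ)
  exact ⟨ζ, sub_eq_iff_eq_add'.1 hζ⟩

variable {L θ} {A : DiffusionOperator EM M} (hθ : θ.VanishesOn (liftedSpace EM L π))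
include hθ

omit [Fintype ι] hπ in
-- The value of the symbol on a pulled back covector lies in the lifted space, where `θ` vanishes.
-- Thus the splitting of covectors into coordinates of `θ` and pullbacks is orthogonal for the
-- symbol.
theorem symbolForm_coord_comp (k : ι) (u : P) (ζ : TangentSpace 𝓘(ℝ, EM) (π u) →L[ℝ] ℝ) :
    L.symbolForm u ((θ.coord b k).toFun u) (ζ.comp (mfderiv 𝓘(ℝ, EP) 𝓘(ℝ, EM) π u)) = 0 := by
  refine (L.symbolForm_symm u _ _).trans ((L.apply_symbol u _ ((θ.coord b k).toFun u)).symm.trans ?_)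
  refine (congrArg (b.coord k) (hθ u _ ⟨ζ, rfl⟩)).trans (map_zero _)

/-- The symbol of the vertical part. -/
theorem symbolForm_coord (k : ι) (u : P) (η : TangentSpace 𝓘(ℝ, EP) u →L[ℝ] ℝ) :
    L.symbolForm u ((θ.coord b k).toFun u) η =
      (hπ.verticalPart b L θ).symbolForm u ((θ.coord b k).toFun u) η := by
  classical
  obtain ⟨ζ, hζ⟩ := hπ.exists_eq_sum_add_comp b θ u η
  have h1 : L.symbolForm u ((θ.coord b k).toFun u) η =
      ∑ j, η (fundamentalField (b j) u) •
        L.symbolForm u ((θ.coord b k).toFun u) ((θ.coord b j).toFun u) := by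
    refine (congrArg (fun η : EP →L[ℝ] ℝ => L.symbolForm u ((θ.coord b k).toFun u) η) hζ).trans ?_
    refine (map_add (L.symbolForm u ((θ.coord b k).toFun u)) _ _).trans ?_
    have h2 := symbolForm_coord_comp b hθ k u ζ
    refine (congrArg₂ (· + ·) (map_sum (L.symbolForm u ((θ.coord b k).toFun u)) _ _) h2).trans ?_
    rw [add_zero]
    exact Finset.sum_congr rfl fun j _ => map_smul (L.symbolForm u ((θ.coord b k).toFun u)) _ _
  rw [h1, symbolForm_verticalPart]
  simp only [ConnectionForm.coord_fundamentalField]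
  simp [mul_comm]

/-- The difference `D` of the two forms has every `θ^k` in its kernel, so it depends only on the
pulled back component `ζ'` of `ξ`. The vertical part vanishes there, and `D ξ ξ` is the nonnegative
number `σ^L (ζ', ζ')`. -/
theorem symbolForm_verticalPart_le (u : P) (ξ : TangentSpace 𝓘(ℝ, EP) u →L[ℝ] ℝ) :
    (hπ.verticalPart b L θ).symbolForm u ξ ξ ≤ L.symbolForm u ξ ξ := by
  obtain ⟨ζ, hζ⟩ := hπ.exists_eq_sum_add_comp b θ u ξ
  let ζ' : EP →L[ℝ] ℝ := ζ.comp (mfderiv 𝓘(ℝ, EP) 𝓘(ℝ, EM) π u)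
  let ξ' : EP →L[ℝ] ℝ := ξ
  let c : ι → ℝ := fun k => ξ (fundamentalField (b k) u)
  let Θ : ι → EP →L[ℝ] ℝ := fun k => (θ.coord b k).toFun u
  let D := L.symbolForm u - (hπ.verticalPart b L θ).symbolForm u
  have hD : ∀ ξ η : EP →L[ℝ] ℝ, D ξ η = D η ξ := fun ξ η => by
    simp only [D, LinearMap.sub_apply]
    rw [L.symbolForm_symm, (hπ.verticalPart b L θ).symbolForm_symm u ξ η]
  have h1 : D ξ' = D ζ' := by
    have h2 : ξ' = (∑ k, c k • Θ k) + ζ' := hζ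
    have h3 : ∀ k, D (Θ k) = 0 := fun k =>
      LinearMap.ext fun η => sub_eq_zero.2 (hπ.symbolForm_coord b hθ k u η)
    rw [h2]
    simp [h3]
  have h4 : (hπ.verticalPart b L θ).symbolForm u ζ' ζ' = 0 := by
    refine (hπ.symbolForm_verticalPart b L θ u _ _).trans ?_
    have h5 : ∀ k, ζ' (fundamentalField (b k) u) = 0 := fun k =>
      (congrArg ζ (hπ.mfderiv_fundamentalField (b k) u)).trans (map_zero ζ)
    refine Finset.sum_eq_zero fun i _ => Finset.sum_eq_zero fun j _ => ?_
    exact mul_eq_zero_of_right _ (mul_eq_zero_of_left (h5 i) _)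
  have h6 : D ξ' ξ' = L.symbolForm u ζ' ζ' := by
    rw [h1, hD, h1]
    simp only [D, LinearMap.sub_apply, h4, sub_zero]
  exact sub_nonneg.1 ((L.symbolForm_nonneg u ζ').trans_eq h6.symm)

/-- The horizontal part of a diffusion operator, with respect to a connection form. -/
def horizontalPart : DiffusionOperator EP P :=
  L.sub (hπ.verticalPart b L θ) fun f u => by
    rw [← DiffusionOperator.symbolForm_mvfderiv, ← DiffusionOperator.symbolForm_mvfderiv]
    exact hπ.symbolForm_verticalPart_le b hθ u _

theorem eq_horizontalPart_add (f : C2 EP P) (u : P) :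
    L f u = hπ.horizontalPart b hθ f u + hπ.verticalPart b L θ f u :=
  (sub_add_cancel (L f u) _).symm

variable (hL : hπ.IsLift A L)
include hL

theorem isLift_horizontalPart : hπ.IsLift A (hπ.horizontalPart b hθ) := fun f u => by
  have h := hπ.eq_horizontalPart_add b hθ (f.comp hπ.proj) u
  rw [hπ.verticalPart_comp_proj, add_zero, hL] at h
  exact h.symm

omit hL in
theorem symbolForm_horizontalPart_coord (k : ι) (u : P) (η : TangentSpace 𝓘(ℝ, EP) u →L[ℝ] ℝ) :
    (hπ.horizontalPart b hθ).symbolForm u ((θ.coord b k).toFun u) η = 0 := by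
  have h1 := DiffusionOperator.symbolForm_of_add (hπ.eq_horizontalPart_add b hθ) u
    ((θ.coord b k).toFun u) η
  exact left_eq_add.1 ((hπ.symbolForm_coord b hθ k u η).symm.trans (h1.trans (add_comm _ _)))

omit hL in
theorem delta_horizontalPart_coord (k : ι) (u : P) :
    (hπ.horizontalPart b hθ).delta (θ.coord b k) u = 0 := by
  have h1 := DiffusionOperator.delta_of_add (hπ.eq_horizontalPart_add b hθ) (θ.coord b k) u
  rw [delta_verticalPart_coord] at h1
  exact right_eq_add.1 h1

/-- Subtract `ψ = ∑ φ (A_k*) • θ^k` from `φ`. The horizontal part annihilates `ψ`, since it kills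
each `θ^k` under both `δ` and the symbol. The remainder vanishes on vertical vectors and on the
lifted space, hence on their sum `Tπ⁻¹ E`. -/
theorem isAlong_horizontalPart (hA : A.IsStronglyCohesive) :
    (hπ.horizontalPart b hθ).IsAlong (liftedSpace EM L π) := by
  intro φ hφ u
  classical
  have hg : ∀ k, ContMDiff 𝓘(ℝ, EP) 𝓘(ℝ, ℝ) ∞ (fun u => φ.toFun u (fundamentalField (b k) u)) :=
    fun k => contMDiffOn_univ.1
      ((φ.smoothFormOn _).apply (hπ.smoothFieldOn_fundamentalField (b k)))
  let ψ : OneForm EP P := .linComb Finset.univ _ hg (θ.coord b)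
  let φ' : OneForm EP P := .mk' (fun u => φ.toFun u - ψ.toFun u)
    ((φ.smoothFormOn _).sub (ψ.smoothFormOn _))
  rw [DiffusionOperator.delta_add _ ψ φ' φ (fun u => (add_sub_cancel _ _).symm)]
  have h1 : (hπ.horizontalPart b hθ).delta ψ u = 0 := by
    rw [DiffusionOperator.delta_linComb]
    refine Finset.sum_eq_zero fun k _ => ?_
    rw [hπ.delta_horizontalPart_coord b hθ, mul_zero, add_zero]
    exact hπ.symbolForm_horizontalPart_coord b hθ k u _
  have hψ : ∀ u v, ψ.toFun u v =
      ∑ k, φ.toFun u (fundamentalField (b k) u) * (θ.coord b k).toFun u v := fun u v => by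
    simp only [ψ, OneForm.linComb, OneForm.mk', sum_apply, smul_apply, smul_eq_mul]
  rw [h1, zero_add]
  refine hπ.delta_eq_zero_of_isLift (hπ.isLift_horizontalPart b hθ hL) hA
    hπ.surjective_mfderiv_proj φ' (fun u v hv => ?_) u
  obtain ⟨w, hw, hwv⟩ := (hπ.bijOn_liftedSpace hL u).surjOn hv
  have h2 : φ'.toFun u w = 0 := by
    refine (congrArg₂ (· - ·) (hφ u w hw) (hψ u w)).trans ?_
    rw [zero_sub, neg_eq_zero]
    refine Finset.sum_eq_zero fun k _ => ?_
    rw [θ.coord_apply, hθ u w hw, map_zero, mul_zero]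
  have h3 : φ'.toFun u (v - w) = 0 := by
    have h4 : v - w ∈ verticalSpace (EM := EM) π u := by
      have h6 : mfderiv 𝓘(ℝ, EP) 𝓘(ℝ, EM) π u (v - w) = 0 := by rw [map_sub, hwv, sub_self]
      exact h6
    exact sub_eq_zero.2
      ((hπ.apply_eq_sum_of_mem_verticalSpace b θ h4 _).trans (hψ u _).symm)
  rw [map_sub, h2, sub_zero] at h3
  exact h3

end IsPrincipalBundle

end Decomposition

end

end EquivariantDiffusion

/-! ### The decomposition theorem. -/

theorem theorem2p4
    {EM : Type*} [NormedAddCommGroup EM] [NormedSpace ℝ EM] [FiniteDimensional ℝ EM]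
    {M : Type*} [TopologicalSpace M] [ChartedSpace EM M] [IsManifold 𝓘(ℝ, EM) ∞ M]
    [T2Space M] [SigmaCompactSpace M]
    {EG : Type*} [NormedAddCommGroup EG] [NormedSpace ℝ EG] [FiniteDimensional ℝ EG]
    {G : Type*} [TopologicalSpace G] [ChartedSpace EG G] [Group G] [LieGroup 𝓘(ℝ, EG) ∞ G]
    [T2Space G]
    {EP : Type*} [NormedAddCommGroup EP] [NormedSpace ℝ EP] [FiniteDimensional ℝ EP]
    {P : Type*} [TopologicalSpace P] [ChartedSpace EP P] [IsManifold 𝓘(ℝ, EP) ∞ P] [T2Space P]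
    [MulAction Gᵐᵒᵖ P]
    {π : P → M} (hπ : IsPrincipalBundle EM EG G EP π)
    (B : DiffusionOperator EP P) (hB : hπ.IsEquivariant B)
    (hA : (inducedOperator hπ B hB).IsStronglyCohesive)
    {ι : Type*} [Fintype ι] (b : Module.Basis ι ℝ (GroupLieAlgebra 𝓘(ℝ, EG) G)) :
    ∃ H : ∀ u : P, Submodule ℝ (TangentSpace 𝓘(ℝ, EP) u),
      IsSemiConnection G π (inducedOperator hπ B hB).symbolRange H ∧
      -- uniqueness of the semi-connection
      (∀ H' : ∀ u : P, Submodule ℝ (TangentSpace 𝓘(ℝ, EP) u),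
        IsSemiConnection G π (inducedOperator hπ B hB).symbolRange H' →
        (∃ AH' BV' : DiffusionOperator EP P, IsDecomposition EM π H' B AH' BV') → H' = H) ∧
      -- existence of the decomposition, `AH` being the horizontal lift of the induced operator
      ∃ AH BV : DiffusionOperator EP P,
        IsDecomposition EM π H B AH BV ∧ hπ.IsLift (inducedOperator hπ B hB) AH ∧
        -- the expression for the vertical part
        (∃ θ : ConnectionForm EG G EP P, θ.VanishesOn H) ∧
        ∃ (α : ι → ι → P → ℝ) (β : ι → P → ℝ),
          (∀ i j, ContMDiff 𝓘(ℝ, EP) 𝓘(ℝ, ℝ) ∞ (α i j)) ∧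
          (∀ k, ContMDiff 𝓘(ℝ, EP) 𝓘(ℝ, ℝ) ∞ (β k)) ∧
          (∀ (f : C2 EP P) (u : P), BV f u =
            (∑ i, ∑ j, α i j u *
              lieDeriv (EP := EP) (fundamentalField (b i))
                (lieDeriv (EP := EP) (fundamentalField (b j)) f) u)
            + (∑ k, β k u * lieDeriv (EP := EP) (fundamentalField (b k)) f u)) ∧
          ∀ θ : ConnectionForm EG G EP P, θ.VanishesOn H → ∀ u : P,
            (∀ k l, α k l u = b.coord k (θ.toFun u
              (B.symbol u ((θ.component (coordCLM b l)).toFun u)))) ∧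
            (∀ l, β l u = B.delta (θ.component (coordCLM b l)) u) := by
  have hL : hπ.IsLift (inducedOperator hπ B hB) B := fun f u =>
    (inducedOperator_apply hπ B hB f u).symm
  obtain ⟨p, hp⟩ := hA.1
  obtain ⟨θ, hθ⟩ := hπ.exists_connectionForm (hπ.exists_isConnectionOn hL hB hp)
  have hadd := hπ.eq_horizontalPart_add b hθ
  have halong := hπ.isAlong_horizontalPart b hθ hL hA
  -- The semi-connection depends on `B` alone. The choice of `θ` enters only the construction of the
  -- two parts.
  refine ⟨liftedSpace EM B π, hπ.isSemiConnection_liftedSpace hL hB hp, ?_,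
    hπ.horizontalPart b hθ, hπ.verticalPart b B θ,
    ⟨halong, hπ.isAlong_verticalPart b B θ, hadd⟩, hπ.isLift_horizontalPart b hθ hL, ⟨θ, hθ⟩,
    fun k l u => B.symbolForm u ((θ.coord b k).toFun u) ((θ.coord b l).toFun u),
    fun l => B.delta (θ.coord b l), fun k l => B.contMDiff_symbolForm _ _,
    fun l => B.contMDiff_delta _, fun f u => fieldOperator_apply _ _ _ _ _ _ _ f u,
    fun θ' hθ' u => ?_⟩
  · rintro H' hH' ⟨AH', BV', hd⟩
    exact hπ.eq_liftedSpace hL hH' hd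
  -- Since the horizontal part is along `H`, it contributes nothing to the symbol or to `δ` on the
  -- coordinates of any `θ'` vanishing on `H`. There `B` reduces to the vertical part, whose values
  -- on these coordinates do not depend on `θ'`.
  have hker : ∀ l x, ∀ v ∈ liftedSpace EM B π x, (θ'.coord b l).toFun x v = 0 := fun l x v hv => by
    rw [θ'.coord_apply, hθ' x v hv, map_zero]
  constructor
  · intro k l
    refine Eq.trans ?_ (B.apply_symbol u ((θ'.coord b l).toFun u) ((θ'.coord b k).toFun u)).symm
    refine Eq.trans ?_ (DiffusionOperator.symbolForm_of_add hadd u _ _).symm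
    refine Eq.trans ?_ (congrArg₂ (· + ·) (halong.symbolForm_eq_zero (hker l) u _).symm
      (hπ.symbolForm_verticalPart_coord b B θ θ' l k u).symm)
    rw [zero_add]
    exact B.symbolForm_symm u _ _
  · intro l
    rw [DiffusionOperator.delta_of_add hadd, halong _ (hker l), zero_add]
    exact (hπ.delta_verticalPart_coord b B θ θ' l u).symm
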